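/- Let $\mathbb T^d=\mathbb R^d/\mathbb Z^d$, $\rho>0$, and let $p\ge 2$ be an integer. Let $r:\mathbb T^d\to\mathbb R$, $b:\mathbb T^d\to\mathbb R^d$, $\sigma:\mathbb T^d\to\mathbb R^{d\times d_W}$ be of class $C^p$, and let $\varphi:\mathbb T^d\to\mathbb R^{q}$ be of class $C^{p+2}$ with linearly independent coordinate functions. Set $v(x,\theta)=\theta^\top\varphi(x)$ and $\mathcal L f=\rho f-\tfrac12\mathrm{tr}(\sigma\sigma^\top D^2f)-b\cdot\nabla f$. Let $m$ be a stationary probability measure, with full support, of the dynamics $dX_t=b(X_t)\,dt+\sigma(X_t)\,dW_t$ on $\mathbb T^d$. Let $\Delta t_k>0$ ($k\ge0$) be time steps and let $(X_k,X_k',R_k)_{k\ge0}$ be independent observations, each of one of two kinds: either a real-world one, $X_k=\widetilde X_0$, $X_k'=\widetilde X_{\Delta t_k}$, $R_k=\frac1{\Delta t_k}\int_0^{\Delta t_k}r(\widetilde X_t)\,dt$ for a solution $\widetilde X$ of the dynamics, or one from a simulator, $X_k'=X_k+\Delta t_k\,b(X_k)+\sqrt{\Delta t_k}\,\sigma(X_k)\xi_k$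 and $R_k=r(X_k)$, with $\xi_k$ a standard Gaussian vector independent of $X_k$. (The displacement $X_k'-X_k$ is understood in $\mathbb R^d$, along the path, and is part of the observation.) Assume that for every $f\in C^p(\mathbb T^d)$ there is $C_f>0$ such that $|\mathbb E[f(X_k)]-\int f\,dm|\le C_f\,\Delta t_k$ for all $k\ge0$. The standard and stochastic temporal differences are $$\delta_k(\theta)=\tfrac1{\Delta t_k}\big(v(X_k,\theta)-e^{-\rho\Delta t_k}v(X_k',\theta)-\Delta t_k R_k\big),\qquad \widetilde\delta_k(\theta)=\delta_k(\theta)+\tfrac1{\Delta t_k}\big(X_k'-X_k-\Delta t_k\,b(X_k)\big)\cdot\nabla_xv(X_k,\theta).$$ For $\mu>0$ and $M\ge0$, with $\alpha_k=\frac{2}{\mu(k+1)}$ and $\Pi_{B_M}$ the Euclidean projection onto the closed ball of radius $M$ centred at $0$, the regularised TD(0) iterations from $\theta_0=\widetilde\theta_0\in\mathbb R^{q}$ are $$\theta_{k+1}=\Pi_{B_M}\big(\theta_k-\alpha_k(\delta_k(\theta_k)\varphi(X_k)+\mu\theta_k)\big),\qquad \widetilde\theta_{k+1}=\Pi_{B_M}\big(\widetilde\theta_k-\alpha_k(\widetilde\delta_k(\widetilde\theta_k)\varphi(X_k)+\mu\widetilde\theta_k)\big).$$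 Then there is exactly one $\theta^*\in\mathbb R^{q}$ such that $\mathbb E_m[\varphi(X)\,\mathcal L\varphi(X)^\top]\,\theta^*=\mathbb E_m[r(X)\varphi(X)]$, and the following holds for every $M'\ge0$. (i) If $\Delta t_k=(k+1)^{-1/3}$ for all $k\ge 0$, there is $C>0$ such that for every $K\ge2$, with $\mu=K^{-1/6}$, for every $M\le M'$ with $M\ge\min(|\theta^*|,\mu^{-1}\|r\|_\infty)$ and every $\theta_0$, $$\mathbb E\big[|\theta_K-\theta^*|^2\big]\le\frac{C}{K^{1/3}}.$$ (ii) If $\Delta t_k\le(k+1)^{-1/2}$ for all $k\ge 0$, there is $C>0$ such that for every $K\ge2$, with $\mu=K^{-1/4}$, for every $M\le M'$ with $M\ge\min(|\theta^*|,\mu^{-1}\|r\|_\infty)$ and every $\widetilde\theta_0$, $$\mathbb E\big[|\widetilde\theta_K-\theta^*|^2\big]\le\frac{C}{\sqrt K}.$$ -/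

import Mathlib

open MeasureTheory ProbabilityTheory
open scoped NNReal

noncomputable section

namespace ContTD

/-- The Euclidean space `ℝⁿ`. -/
abbrev Vec (n : ℕ) := EuclideanSpace ℝ (Fin n)

/-- The state space: the torus `𝕋ᵈ = ℝᵈ / ℤᵈ`. -/
abbrev Torus (d : ℕ) := Fin d → UnitAddCircle

/-- The quotient map `ℝᵈ → 𝕋ᵈ`. -/
def proj {d : ℕ} (y : Vec d) : Torus d := fun i => ((y i : ℝ) : UnitAddCircle)

/-- `f` is of class `C^p` on the torus (its periodic lift is of class `C^p` on `ℝᵈ`). -/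
def IsCk {d : ℕ} {F : Type*} [NormedAddCommGroup F] [NormedSpace ℝ F] (p : ℕ)
    (f : Torus d → F) : Prop :=
  ContDiff ℝ p (fun y : Vec d => f (proj y))

/-- `D²f(y)(u, u)`, for a function on `ℝᵈ`. -/
def hess {d : ℕ} (f : Vec d → ℝ) (y u : Vec d) : ℝ := fderiv ℝ (fderiv ℝ f) y u u

/-- For a drift vector `β` and a diffusion matrix `S` (as a linear map `ℝⁿ → ℝᵈ`), the number
`½ tr(S Sᵀ D²f(y)) + β · ∇f(y)`; the trace is the sum of `D²f(y)(S eⱼ, S eⱼ)` over the columns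
`S eⱼ` of `S`. -/
def diffOp {d n : ℕ} (β : Vec d) (S : Vec n →L[ℝ] Vec d) (f : Vec d → ℝ) (y : Vec d) : ℝ :=
  (1 / 2) * ∑ j : Fin n, hess f y (S (EuclideanSpace.single j 1)) + fderiv ℝ f y β

/-- The operator `𝓛 f = ρ f - ½ tr(σ σᵀ D²f) - b · ∇f` on functions on the torus. Derivatives at
`x` are those at `0` of the function `h ↦ f (x + h)` on `ℝᵈ`. -/
def opL {d n : ℕ} (ρ : ℝ) (b : Torus d → Vec d) (σ : Torus d → Vec n →L[ℝ] Vec d)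
    (f : Torus d → ℝ) (x : Torus d) : ℝ :=
  ρ * f x - diffOp (b x) (σ x) (fun h => f (x + proj h)) 0

/-- The process `Z`, with values in `ℝᵈ`, is a (weak) solution of
`dZ = b(Z) dt + σ(Z) dW`, in the sense of the martingale problem: it has continuous paths and, for
every bounded `C²` function `f` with bounded derivatives of order one and two,
`f(Z_t) - f(Z_0) - ∫₀ᵗ (½ tr(σ σᵀ D²f) + b · ∇f)(Z_s) ds` is a martingale. The coefficients are
functions on the torus, and `proj ∘ Z` is the corresponding process on the torus. -/
def IsSolution {d n : ℕ} (b : Torus d → Vec d) (σ : Torus d → Vec n →L[ℝ] Vec d)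
    {Ω : Type*} [mΩ : MeasurableSpace Ω] (P : Measure Ω) (Z : ℝ≥0 → Ω → Vec d) : Prop :=
  (∀ ω, Continuous fun t => Z t ω) ∧
  ∃ 𝓕 : Filtration ℝ≥0 mΩ, Adapted 𝓕 Z ∧
    ∀ f : Vec d → ℝ, ContDiff ℝ 2 f →
      (∃ c : ℝ, ∀ y, |f y| ≤ c ∧ ‖fderiv ℝ f y‖ ≤ c ∧ ‖fderiv ℝ (fderiv ℝ f) y‖ ≤ c) →
      Martingale (fun (t : ℝ≥0) (ω : Ω) =>
        f (Z t ω) - f (Z 0 ω) -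
          ∫ s in (0 : ℝ)..t, diffOp (b (proj (Z s.toNNReal ω))) (σ (proj (Z s.toNNReal ω))) f
            (Z s.toNNReal ω)) 𝓕 P

/-- `m` is a stationary measure of the dynamics: there is a solution of the SDE whose law on the
torus is `m` at all times. -/
def IsStationary {d n : ℕ} (b : Torus d → Vec d) (σ : Torus d → Vec n →L[ℝ] Vec d)
    (m : Measure (Torus d)) : Prop :=
  ∃ (Ω : Type) (_ : MeasurableSpace Ω) (P : Measure Ω) (Z : ℝ≥0 → Ω → Vec d),
    IsProbabilityMeasure P ∧ IsSolution b σ P Z ∧ ∀ t, P.map (fun ω => proj (Z t ω)) = m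

/-- Real-world observation with time step `Δ`: `X` is the state at time `0` of a solution `Z` of
the SDE, `D = Z_Δ - Z_0` is the displacement during `[0, Δ]` (so that `X' = X + D` on the torus)
and `R` is the average reward on `[0, Δ]`. -/
def IsRealObs {d n : ℕ} (b : Torus d → Vec d) (σ : Torus d → Vec n →L[ℝ] Vec d)
    (r : Torus d → ℝ) {Ω : Type*} [MeasurableSpace Ω] (P : Measure Ω) (Δ : ℝ)
    (X : Ω → Torus d) (D : Ω → Vec d) (R : Ω → ℝ) : Prop :=
  ∃ Z : ℝ≥0 → Ω → Vec d, IsSolution b σ P Z ∧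
    ∀ᵐ ω ∂P, X ω = proj (Z 0 ω) ∧ D ω = Z Δ.toNNReal ω - Z 0 ω ∧
      R ω = (1 / Δ) * ∫ s in (0 : ℝ)..Δ, r (proj (Z s.toNNReal ω))

/-- Observation from a simulator with time step `Δ`: the displacement `D` is the one of the
Euler-Maruyama scheme, `D = Δ b(X) + √Δ σ(X) ξ` with `ξ` standard Gaussian and independent of `X`
(so that `X' = X + D` on the torus), and `R = r(X)`. -/
def IsSimObs {d n : ℕ} (b : Torus d → Vec d) (σ : Torus d → Vec n →L[ℝ] Vec d)
    (r : Torus d → ℝ) {Ω : Type*} [MeasurableSpace Ω] (P : Measure Ω) (Δ : ℝ)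
    (X : Ω → Torus d) (D : Ω → Vec d) (R : Ω → ℝ) : Prop :=
  ∃ ξ : Ω → Vec n, Measurable ξ ∧ P.map ξ = stdGaussian (Vec n) ∧ IndepFun ξ X P ∧
    ∀ᵐ ω ∂P, D ω = Δ • b (X ω) + √Δ • σ (X ω) (ξ ω) ∧ R ω = r (X ω)

/-- The linear parametrisation `v(x, θ) = θᵀ φ(x)`. -/
def value {d q : ℕ} (φ : Torus d → Vec q) (x : Torus d) (θ : Vec q) : ℝ := inner ℝ θ (φ x)

/-- The standard temporal difference `(v(X, θ) - e^{-ρ Δ} v(X', θ) - Δ R) / Δ`, for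
`X' = X + D`. -/
def tdError {d q : ℕ} (ρ : ℝ) (φ : Torus d → Vec q) (Δ : ℝ) (X : Torus d) (D : Vec d) (R : ℝ)
    (θ : Vec q) : ℝ :=
  (1 / Δ) * (value φ X θ - Real.exp (-ρ * Δ) * value φ (X + proj D) θ - Δ * R)

/-- The stochastic temporal difference: the standard one plus
`(X' - X - Δ b(X)) · ∇ₓ v(X, θ) / Δ`. -/
def stochTdError {d q : ℕ} (ρ : ℝ) (b : Torus d → Vec d) (φ : Torus d → Vec q) (Δ : ℝ)
    (X : Torus d) (D : Vec d) (R : ℝ) (θ : Vec q) : ℝ :=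
  tdError ρ φ Δ X D R θ +
    (1 / Δ) * fderiv ℝ (fun h : Vec d => value φ (X + proj h) θ) 0 (D - Δ • b X)

/-- The Euclidean projection of `ℝ^q` on the closed ball of centre `0` and radius `M ≥ 0`. -/
def ballProj {q : ℕ} (M : ℝ) (θ : Vec q) : Vec q := if ‖θ‖ ≤ M then θ else (M / ‖θ‖) • θ

/-- The regularised TD(0) iterations with temporal differences `δ k θ` (the one at iteration `k`
as a function of the current parameter), states `x k` and learning rates `α k`:
`θ_{k+1} = Π (θ_k - α_k (δ_k ∇_θ v(x_k, θ_k) + μ θ_k))`, where `∇_θ v(x, θ) = φ(x)`. -/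
def regTD0 {d q : ℕ} (φ : Torus d → Vec q) (μ M : ℝ) (α : ℕ → ℝ) (x : ℕ → Torus d)
    (δ : ℕ → Vec q → ℝ) (θ₀ : Vec q) : ℕ → Vec q
  | 0 => θ₀
  | k + 1 =>
    let θ := regTD0 φ μ M α x δ θ₀ k
    ballProj M (θ - α k • (δ k θ • φ (x k) + μ • θ))

/-- The learning rates `α_k = 2 / (μ (k + 1))`. -/
def rate (μ : ℝ) (k : ℕ) : ℝ := 2 / (μ * ((k : ℝ) + 1))

/-- `θ` solves the linear system `E_m[φ(X) 𝓛φ(X)ᵀ] θ = E_m[r(X) φ(X)]`. -/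
def IsLimit {d n q : ℕ} (ρ : ℝ) (b : Torus d → Vec d) (σ : Torus d → Vec n →L[ℝ] Vec d)
    (r : Torus d → ℝ) (φ : Torus d → Vec q) (m : Measure (Torus d)) (θ : Vec q) : Prop :=
  ∀ i : Fin q,
    ∑ j : Fin q, (∫ x, φ x i * opL ρ b σ (fun y => φ y j) x ∂m) * θ j = ∫ x, r x * φ x i ∂m

end ContTD

end

noncomputable section

namespace ContTD

section

/-! ### Calculus on the torus through periodic lifts -/

section Torus

variable {d : ℕ} {F G : Type*} [NormedAddCommGroup F] [NormedSpace ℝ F]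
  [NormedAddCommGroup G] [NormedSpace ℝ G]

/-! The matrix A = E_m[φ 𝓛φᵀ] is coercive. For v = θᵀφ, stationarity gives ∫ gen(v²) dm = 0, while
gen(v²) = 2 v gen v + |σᵀ∇v|². Hence ∫ v gen v dm ≤ 0 and θᵀAθ = ∫ v 𝓛v dm ≥ ρ ∫ v² dm, which full
support and the independence of the features bound below by a multiple of |θ|²
(`IsStationary.exists_coercive`). So θ* exists and is unique, and the mean update contracts towards
it at a rate l that does not depend on μ.

Both temporal differences are affine in the parameter, δ = ⟨θ, U⟩ - R. Two facts about (U, R)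
suffice (`UpdateBound`): E[φUᵀ] and E[Rφ] equal A and c = E_m[rφ] up to O(Δ), and E|U|² ≤ V. The
bias bound is first-order weak consistency: Dynkin's formula, used twice, for a real observation; a
symmetrised Taylor expansion for an Euler step; and the assumed closeness of the law of X_k to m.
The size V separates the two methods. U contains an increment of φ divided by Δ, of order |D|/Δ with
E|D|² = O(Δ), so V = O(1/Δ) for the standard difference. The stochastic correction cancels the
first-order Taylor term and leaves |D|²/Δ, so V = O(1) because E|D|⁴ = O(Δ²). It costs no extra
order of bias, since E[G(X)(D - Δ b(X))] = O(Δ²).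

A solution is known only through the martingale problem, whose test functions are bounded. Moments
of the displacement are therefore reached through 2 sin(lx/2)/l, with Grönwall bounds uniform in l
and Fatou's lemma as l → 0.

With e_k = E|θ_k - θ*|², one step (`UpdateBound.integral_step_le`) gives e_{k+1} ≤ (1 - α_k(l + 2μ))
e_k + C α_k (μ² + Δ_k² + α_k(1 + V_k)); the μ² is the price of regularising towards 0. If Δ_k² and
V_k/(k+1) are O((k+1)^{-s}), the noise is O(α_k(μ² + μ⁻¹(k+1)^{-s})). In `recursion_le`, 2μα_k =
4/(k+1) pays for the decrease of k^{-s} and lα_k absorbs the noise, whence e_k ≤ C(μ² + μ⁻¹k^{-s}).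
For μ = K^{-γ} with 3γ ≤ s this is O(K^{-2γ}) at k = K. The two cases are s = 2/3, γ = 1/6 and s =
1, γ = 1/4.

All this needs θ* in the ball of projection. Otherwise M ≥ μ⁻¹‖r‖_∞, so μ⁻¹ ≤ |θ*|/‖r‖_∞: this
concerns finitely many K, and the constant absorbs them. -/

theorem proj_add (y z : Vec d) : proj (y + z) = proj y + proj z := by
  funext i
  simp [proj]

@[simp] theorem proj_zero : proj (0 : Vec d) = 0 := by
  funext i
  simp [proj]

theorem continuous_proj : Continuous (proj : Vec d → Torus d) := by
  refine continuous_pi fun i => ?_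
  exact (AddCircle.continuous_mk' (1 : ℝ)).comp (by fun_prop : Continuous fun y : Vec d => y i)

/-- Smoothness is assumed of periodic lifts only; the quotient topology makes the function on the
torus itself continuous, hence bounded by compactness. -/
theorem isOpenQuotientMap_proj : IsOpenQuotientMap (proj : Vec d → Torus d) := by
  have h1 : IsOpenQuotientMap (fun (y : Fin d → ℝ) (i : Fin d) => ((y i : ℝ) : UnitAddCircle)) :=
    IsOpenQuotientMap.piMap fun _ => QuotientAddGroup.isOpenQuotientMap_mk
  exact h1.comp (EuclideanSpace.equiv (Fin d) ℝ).toHomeomorph.isOpenQuotientMap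

theorem proj_surjective : Function.Surjective (proj : Vec d → Torus d) :=
  isOpenQuotientMap_proj.surjective

theorem continuous_of_comp_proj {Y : Type*} [TopologicalSpace Y] {f : Torus d → Y}
    (h : Continuous fun y : Vec d => f (proj y)) : Continuous f :=
  isOpenQuotientMap_proj.isQuotientMap.continuous_iff.2 h

theorem IsCk.continuous {p : ℕ} {f : Torus d → F} (hf : IsCk p f) : Continuous f :=
  continuous_of_comp_proj (ContDiff.continuous hf)

theorem IsCk.of_le {p k : ℕ} {f : Torus d → F} (hf : IsCk p f) (h : k ≤ p) : IsCk k f :=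
  ContDiff.of_le hf (by exact_mod_cast h)

theorem exists_bound_of_continuous {E : Type*} [NormedAddCommGroup E] {f : Torus d → E} (hf : Continuous f) :
    ∃ C : ℝ, 0 ≤ C ∧ ∀ x, ‖f x‖ ≤ C := by
  obtain ⟨C, hC⟩ := isCompact_univ.exists_bound_of_continuousOn (hf.continuousOn (s := Set.univ))
  exact ⟨|C|, abs_nonneg C, fun x => (hC x (Set.mem_univ x)).trans (le_abs_self C)⟩

/-- The derivative of a function on the torus. -/
def torusDeriv (f : Torus d → F) (x : Torus d) : Vec d →L[ℝ] F :=
  fderiv ℝ (fun h : Vec d => f (x + proj h)) 0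

/-- The torus is not a normed space, so derivatives are taken at 0 along translates. Translation
invariance identifies them with derivatives of the lift at every point, which allows `torusDeriv` to
be iterated. -/
theorem fderiv_add_proj (f : Torus d → F) (x : Torus d) (h : Vec d) :
    fderiv ℝ (fun k : Vec d => f (x + proj k)) h = torusDeriv f (x + proj h) := by
  have := fderiv_comp_add_left (𝕜 := ℝ) (f := fun k : Vec d => f (x + proj k)) (x := 0) h
  rw [add_zero] at this
  rw [← this, torusDeriv]
  congr 1
  funext k
  rw [proj_add, add_assoc]

theorem fderiv_comp_proj (f : Torus d → F) :
    fderiv ℝ (fun k : Vec d => f (proj k)) = fun y => torusDeriv f (proj y) := by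
  funext y
  simpa using fderiv_add_proj f 0 y

theorem contDiff_add_proj {p : ℕ} {f : Torus d → F} (hf : IsCk p f) (x : Torus d) :
    ContDiff ℝ p fun h : Vec d => f (x + proj h) := by
  obtain ⟨y, rfl⟩ := proj_surjective x
  simp only [← proj_add]
  exact ContDiff.comp (g := fun z : Vec d => f (proj z)) hf (contDiff_const.add contDiff_id)

theorem IsCk.torusDeriv {p : ℕ} {f : Torus d → F} (hf : IsCk (p + 1) f) :
    IsCk p (torusDeriv f) := by
  unfold IsCk
  rw [← fderiv_comp_proj]
  exact ContDiff.fderiv_right (m := p) hf (by norm_cast)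

theorem IsCk.hasFDerivAt {p : ℕ} {f : Torus d → F} (hf : IsCk (p + 1) f) (x : Torus d)
    (h : Vec d) :
    HasFDerivAt (fun k : Vec d => f (x + proj k)) (ContTD.torusDeriv f (x + proj h)) h := by
  rw [← fderiv_add_proj]
  exact ((contDiff_add_proj hf x).differentiable (by norm_cast)).differentiableAt.hasFDerivAt

theorem IsCk.comp_contDiff {p : ℕ} {f : Torus d → F} (hf : IsCk p f) {g : F → G}
    (hg : ContDiff ℝ p g) : IsCk p fun x => g (f x) := hg.comp hf

theorem IsCk.add {p : ℕ} {f g : Torus d → F} (hf : IsCk p f) (hg : IsCk p g) :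
    IsCk p fun x => f x + g x := ContDiff.add hf hg

theorem IsCk.sub {p : ℕ} {f g : Torus d → F} (hf : IsCk p f) (hg : IsCk p g) :
    IsCk p fun x => f x - g x := ContDiff.sub hf hg

theorem IsCk.mul {p : ℕ} {f g : Torus d → ℝ} (hf : IsCk p f) (hg : IsCk p g) :
    IsCk p fun x => f x * g x := ContDiff.mul hf hg

theorem IsCk.clm_apply {p : ℕ} {f : Torus d → F →L[ℝ] G} {g : Torus d → F} (hf : IsCk p f)
    (hg : IsCk p g) : IsCk p fun x => f x (g x) := ContDiff.clm_apply hf hg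

theorem isCk_const {p : ℕ} (c : F) : IsCk p fun _ : Torus d => c := contDiff_const

theorem IsCk.sum {p : ℕ} {ι : Type*} {s : Finset ι} {f : ι → Torus d → F}
    (hf : ∀ i ∈ s, IsCk p (f i)) : IsCk p fun x => ∑ i ∈ s, f i x := ContDiff.sum hf

theorem IsCk.coord {p q : ℕ} {f : Torus d → Vec q} (hf : IsCk p f) (i : Fin q) :
    IsCk p fun x => f x i :=
  hf.comp_contDiff (contDiff_piLp_apply (𝕜 := ℝ) 2)

end Torus

/-! ### The generator and its product rule -/

section Generator

variable {d n : ℕ}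

/-- The generator `½ tr(σ σᵀ D²f) + b · ∇f` of the dynamics on the torus. -/
def gen (b : Torus d → Vec d) (σ : Torus d → Vec n →L[ℝ] Vec d) (f : Torus d → ℝ)
    (x : Torus d) : ℝ :=
  (1 / 2) * ∑ j : Fin n, torusDeriv (torusDeriv f) x (σ x (EuclideanSpace.single j 1))
    (σ x (EuclideanSpace.single j 1)) + torusDeriv f x (b x)

variable {b : Torus d → Vec d} {σ : Torus d → Vec n →L[ℝ] Vec d}

/-- Bridge from `diffOp` on lifts, and so from `opL`, to `gen`, with which the later calculus on the
torus is done. -/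
theorem diffOp_add_proj (β : Vec d) (S : Vec n →L[ℝ] Vec d) (f : Torus d → ℝ) (x : Torus d)
    (h : Vec d) :
    diffOp β S (fun k => f (x + proj k)) h =
      (1 / 2) * ∑ j : Fin n, torusDeriv (torusDeriv f) (x + proj h) (S (EuclideanSpace.single j 1))
        (S (EuclideanSpace.single j 1)) + torusDeriv f (x + proj h) β := by
  unfold diffOp hess
  have : fderiv ℝ (fun k : Vec d => f (x + proj k)) = fun k => torusDeriv f (x + proj k) :=
    funext fun k => fderiv_add_proj f x k
  rw [this, fderiv_add_proj]

theorem diffOp_comp_proj (f : Torus d → ℝ) (y : Vec d) :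
    diffOp (b (proj y)) (σ (proj y)) (fun k => f (proj k)) y = gen b σ f (proj y) := by
  simpa [gen] using diffOp_add_proj (b (proj y)) (σ (proj y)) f 0 y

theorem opL_eq (ρ : ℝ) (f : Torus d → ℝ) (x : Torus d) :
    opL ρ b σ f x = ρ * f x - gen b σ f x := by
  rw [opL, diffOp_add_proj]
  simp [gen]

theorem IsCk.gen {p : ℕ} {f : Torus d → ℝ} (hf : IsCk (p + 2) f) (hb : IsCk p b)
    (hσ : IsCk p σ) : IsCk p (gen b σ f) := by
  have h1 : IsCk (p + 1) (ContTD.torusDeriv f) := hf.torusDeriv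
  refine ((isCk_const (1 / 2 : ℝ)).mul (IsCk.sum fun j _ => ?_)).add
    ((h1.of_le (Nat.le_succ p)).clm_apply hb)
  have h2 := hσ.clm_apply (isCk_const (EuclideanSpace.single j (1 : ℝ)))
  exact (h1.torusDeriv.clm_apply h2).clm_apply h2

theorem torusDeriv_mul {f g : Torus d → ℝ} (hf : IsCk 1 f) (hg : IsCk 1 g) :
    torusDeriv (fun x => f x * g x) =
      fun x => f x • torusDeriv g x + g x • torusDeriv f x := by
  funext x
  have h1 := IsCk.hasFDerivAt (p := 0) hf x 0
  have h2 := IsCk.hasFDerivAt (p := 0) hg x 0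
  simpa [torusDeriv] using (h1.fun_mul h2).fderiv

theorem torusDeriv_add {F : Type*} [NormedAddCommGroup F] [NormedSpace ℝ F] {f g : Torus d → F}
    (hf : IsCk 1 f) (hg : IsCk 1 g) :
    torusDeriv (fun x => f x + g x) = fun x => torusDeriv f x + torusDeriv g x := by
  funext x
  have h1 := IsCk.hasFDerivAt (p := 0) hf x 0
  have h2 := IsCk.hasFDerivAt (p := 0) hg x 0
  simpa [torusDeriv] using (h1.fun_add h2).fderiv

theorem torusDeriv_smul {F : Type*} [NormedAddCommGroup F] [NormedSpace ℝ F] {f : Torus d → ℝ}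
    {g : Torus d → F} (hf : IsCk 1 f) (hg : IsCk 1 g) (x : Torus d) (u : Vec d) :
    torusDeriv (fun x => f x • g x) x u = f x • torusDeriv g x u + torusDeriv f x u • g x := by
  have h1 := IsCk.hasFDerivAt (p := 0) hf x 0
  have h2 := IsCk.hasFDerivAt (p := 0) hg x 0
  have h3 := (h1.fun_smul h2).fderiv
  simp only [proj_zero, add_zero] at h3
  rw [torusDeriv]
  erw [h3]
  simp

/-- The carré du champ identity for the square of a function. -/
theorem gen_mul_self {f : Torus d → ℝ} (hf : IsCk 2 f) (x : Torus d) :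
    gen b σ (fun x => f x * f x) x = 2 * (f x * gen b σ f x) +
      ∑ j : Fin n, (torusDeriv f x (σ x (EuclideanSpace.single j 1))) ^ 2 := by
  have hf1 : IsCk 1 f := hf.of_le (by norm_num)
  have hdf : IsCk 1 (torusDeriv f) := hf.torusDeriv
  have h1 := torusDeriv_mul hf1 hf1
  have h2 : ∀ u, torusDeriv (torusDeriv fun x => f x * f x) x u u =
      2 * (f x * torusDeriv (torusDeriv f) x u u) + 2 * (torusDeriv f x u) ^ 2 := by
    intro u
    have hs : IsCk 1 fun x => f x • torusDeriv f x := ContDiff.smul hf1 hdf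
    rw [h1, torusDeriv_add hs hs]
    simp only [add_apply, torusDeriv_smul hf1 hdf]
    simp
    ring
  unfold gen
  simp only [h2]
  rw [h1, Finset.sum_add_distrib, ← Finset.mul_sum, ← Finset.mul_sum, ← Finset.mul_sum]
  simp
  ring

theorem gen_sum_smul {q : ℕ} {f : Fin q → Torus d → ℝ} (hf : ∀ i, IsCk 2 (f i)) (θ : Fin q → ℝ)
    (x : Torus d) :
    gen b σ (fun x => ∑ i, θ i * f i x) x = ∑ i, θ i * gen b σ (f i) x := by
  have key : ∀ {F : Type} [NormedAddCommGroup F] [NormedSpace ℝ F] (g : Fin q → Torus d → F),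
      (∀ i, IsCk 1 (g i)) → torusDeriv (fun x => ∑ i, θ i • g i x) =
        fun x => ∑ i, θ i • torusDeriv (g i) x := by
    intro F _ _ g hg
    funext x
    have h1 := HasFDerivAt.fun_sum (u := Finset.univ) fun i _ =>
      ((IsCk.hasFDerivAt (p := 0) (hg i) x 0).const_smul (θ i))
    simpa [torusDeriv] using h1.fderiv
  have e1 := key f fun i => (hf i).of_le (by norm_num)
  have e2 := key (fun i => torusDeriv (f i)) fun i => (hf i).torusDeriv
  simp only [smul_eq_mul] at e1
  unfold gen
  rw [e1, e2]
  simp only [sum_apply, smul_apply, smul_eq_mul, mul_add, Finset.sum_add_distrib, Finset.mul_sum]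
  rw [Finset.sum_comm]
  congr 1
  refine Finset.sum_congr rfl fun i _ => Finset.sum_congr rfl fun j _ => ?_
  ring

end Generator

end

section

/-! ### Dynkin's formula from the martingale problem -/

section Solution

variable {d n : ℕ} {b : Torus d → Vec d} {σ : Torus d → Vec n →L[ℝ] Vec d}
  {Ω : Type*} [mΩ : MeasurableSpace Ω] {P : Measure Ω} {Z : ℝ≥0 → Ω → Vec d}

theorem IsSolution.measurable (hZ : IsSolution b σ P Z) (t : ℝ≥0) : Measurable (Z t) := by
  obtain ⟨-, 𝓕, hA, -⟩ := hZ
  exact (hA t).mono (𝓕.le t) le_rfl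

theorem IsSolution.continuous_toNNReal (hZ : IsSolution b σ P Z) (ω : Ω) :
    Continuous fun s : ℝ => Z s.toNNReal ω :=
  (hZ.1 ω).comp continuous_real_toNNReal

theorem IsSolution.measurable_uncurry (hZ : IsSolution b σ P Z) :
    Measurable (Function.uncurry fun (s : ℝ) ω => Z s.toNNReal ω) :=
  measurable_uncurry_of_continuous_of_measurable (fun ω => hZ.continuous_toNNReal ω)
    fun _ => hZ.measurable _

theorem IsSolution.integrable_comp [IsProbabilityMeasure P] (hZ : IsSolution b σ P Z)
    {Φ : Vec d → Vec d → ℝ} (hΦ : Measurable (Function.uncurry Φ)) {C : ℝ}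
    (hC : ∀ z y, |Φ z y| ≤ C) (s : ℝ≥0) : Integrable (fun ω => Φ (Z 0 ω) (Z s ω)) P :=
  Integrable.of_bound (C := C)
    (hΦ.comp ((hZ.measurable 0).prodMk (hZ.measurable s))).aestronglyMeasurable
    (.of_forall fun _ => hC _ _)

/-- Fubini's theorem along a solution. -/
theorem IsSolution.integral_intervalIntegral [IsProbabilityMeasure P] (hZ : IsSolution b σ P Z)
    {Φ : Vec d → Vec d → ℝ} (hΦ : Measurable (Function.uncurry Φ)) {C : ℝ}
    (hC : ∀ z y, |Φ z y| ≤ C) {t : ℝ} (ht : 0 ≤ t) :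
    Integrable (fun ω => ∫ s in (0 : ℝ)..t, Φ (Z 0 ω) (Z s.toNNReal ω)) P ∧
    ∫ ω, (∫ s in (0 : ℝ)..t, Φ (Z 0 ω) (Z s.toNNReal ω)) ∂P =
      ∫ s in (0 : ℝ)..t, ∫ ω, Φ (Z 0 ω) (Z s.toNNReal ω) ∂P := by
  have hprod : Integrable (Function.uncurry fun (s : ℝ) ω => Φ (Z 0 ω) (Z s.toNNReal ω))
      ((volume.restrict (Set.Ioc 0 t)).prod P) :=
    Integrable.of_bound (C := C) (hΦ.comp (((hZ.measurable 0).comp measurable_snd).prodMk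
      hZ.measurable_uncurry)).aestronglyMeasurable (.of_forall fun x => hC _ _)
  simp only [intervalIntegral.integral_of_le ht]
  exact ⟨hprod.integral_prod_right, (integral_integral_swap hprod).symm⟩

/-- Dynkin's formula, tested against a bounded function of the initial state. -/
theorem IsSolution.dynkin [IsProbabilityMeasure P] (hZ : IsSolution b σ P Z) {F H : Vec d → ℝ}
    (hF : ContDiff ℝ 2 F)
    (hFb : ∃ c : ℝ, ∀ y, |F y| ≤ c ∧ ‖fderiv ℝ F y‖ ≤ c ∧ ‖fderiv ℝ (fderiv ℝ F) y‖ ≤ c)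
    (hFH : ∀ y, diffOp (b (proj y)) (σ (proj y)) F y = H y) (hH : Continuous H) {c : ℝ}
    (hHb : ∀ y, |H y| ≤ c) {ψ : Vec d → ℝ} (hψ : Measurable ψ) {c' : ℝ} (hψb : ∀ y, |ψ y| ≤ c')
    {t : ℝ} (ht : 0 ≤ t) :
    ∫ ω, ψ (Z 0 ω) * (F (Z t.toNNReal ω) - F (Z 0 ω)) ∂P =
      ∫ s in (0 : ℝ)..t, ∫ ω, ψ (Z 0 ω) * H (Z s.toNNReal ω) ∂P := by
  have hmeas := hZ.measurable
  obtain ⟨hint2, hswap⟩ := hZ.integral_intervalIntegral (Φ := fun z y => ψ z * H y)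
    (C := c' * c) (by fun_prop) (fun z y => by
      rw [abs_mul]
      exact mul_le_mul (hψb _) (hHb _) (abs_nonneg _) ((abs_nonneg _).trans (hψb 0))) ht
  obtain ⟨-, 𝓕, hA, hM⟩ := hZ
  have hM := hM F hF hFb
  obtain ⟨cF, hcF⟩ := hFb
  simp only [hFH] at hM
  set M : ℝ≥0 → Ω → ℝ := fun (t : ℝ≥0) (ω : Ω) =>
        F (Z t ω) - F (Z 0 ω) - ∫ s in (0 : ℝ)..t, H (Z s.toNNReal ω) with hMdef
  have hM0 : M 0 = 0 := by
    funext ω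
    simp [hMdef]
  have hψm : StronglyMeasurable[𝓕 0] fun ω => ψ (Z 0 ω) :=
    (hψ.comp (hA 0)).stronglyMeasurable
  have hψm' : AEStronglyMeasurable (fun ω => ψ (Z 0 ω)) P :=
    (hψ.comp (hmeas 0)).aestronglyMeasurable
  have hint : Integrable (fun ω => ψ (Z 0 ω) * M t.toNNReal ω) P :=
    (hM.integrable _).bdd_mul hψm' (.of_forall fun ω => hψb _)
  -- The weight ψ(Z₀) is bounded and 𝓕₀-measurable, so it comes out of the conditional expectation,
  -- and E[M_t | 𝓕₀] = M₀ = 0.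
  have hzero : ∫ ω, ψ (Z 0 ω) * M t.toNNReal ω ∂P = 0 := by
    have h1 := condExp_mul_of_stronglyMeasurable_left hψm hint (hM.integrable _)
    have h2 := hM.2 0 t.toNNReal zero_le
    rw [hM0] at h2
    have h3 : P[(fun ω => ψ (Z 0 ω)) * M t.toNNReal | 𝓕 0] =ᵐ[P] fun _ => 0 := by
      filter_upwards [h1, h2] with ω e1 e2
      rw [e1, Pi.mul_apply, e2]
      simp
    have h4 := integral_condExp (μ := P) (f := (fun ω => ψ (Z 0 ω)) * M t.toNNReal) (𝓕.le 0)
    rw [integral_congr_ae h3] at h4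
    simpa using h4.symm
  have hsplit : ∀ ω, ψ (Z 0 ω) * (F (Z t.toNNReal ω) - F (Z 0 ω)) =
      ψ (Z 0 ω) * M t.toNNReal ω + ∫ s in (0 : ℝ)..t, ψ (Z 0 ω) * H (Z s.toNNReal ω) := by
    intro ω
    rw [intervalIntegral.integral_const_mul, hMdef]
    simp only [Real.coe_toNNReal t ht]
    ring
  simp only [hsplit]
  rw [integral_add hint hint2, hzero, zero_add, hswap]

theorem IsSolution.dynkin_torus [IsProbabilityMeasure P] (hZ : IsSolution b σ P Z)
    (hb : Continuous b) (hσ : Continuous σ) {f : Torus d → ℝ} (hf : IsCk 2 f)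
    {ψ : Torus d → ℝ} (hψ : Continuous ψ) {t : ℝ} (ht : 0 ≤ t) :
    ∫ ω, ψ (proj (Z 0 ω)) * (f (proj (Z t.toNNReal ω)) - f (proj (Z 0 ω))) ∂P =
      ∫ s in (0 : ℝ)..t, ∫ ω, ψ (proj (Z 0 ω)) * gen b σ f (proj (Z s.toNNReal ω)) ∂P := by
  have hd1 : IsCk 1 (torusDeriv f) := hf.torusDeriv
  have hd2 : IsCk 0 (torusDeriv (torusDeriv f)) := hd1.torusDeriv
  have hgen : Continuous (gen b σ f) := by
    have c1 := hd1.continuous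
    have c2 := hd2.continuous
    unfold gen
    fun_prop
  obtain ⟨c, -, hc⟩ := exists_bound_of_continuous hgen
  obtain ⟨c', -, hc'⟩ := exists_bound_of_continuous hψ
  obtain ⟨c0, h0, hc0⟩ := exists_bound_of_continuous hf.continuous
  obtain ⟨c1, h1, hc1⟩ := exists_bound_of_continuous hd1.continuous
  obtain ⟨c2, h2, hc2⟩ := exists_bound_of_continuous hd2.continuous
  refine hZ.dynkin (F := fun y => f (proj y)) (H := fun y => gen b σ f (proj y))
    (ψ := fun y => ψ (proj y)) hf ⟨c0 + c1 + c2, fun y => ?_⟩ (fun y => diffOp_comp_proj f y)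
    (hgen.comp continuous_proj) (fun y => hc _) (hψ.comp continuous_proj).measurable
    (fun y => hc' _) ht
  rw [fderiv_comp_proj, fderiv_comp_proj]
  have := hc0 (proj y)
  have := hc1 (proj y)
  have := hc2 (proj y)
  rw [Real.norm_eq_abs] at *
  exact ⟨by linarith, by linarith, by linarith⟩

/-- The `i`-th diagonal coefficient of `σ σᵀ`. -/
def diffusionCoeff (σ : Torus d → Vec n →L[ℝ] Vec d) (i : Fin d) (x : Torus d) : ℝ :=
  ∑ j : Fin n, (σ x (EuclideanSpace.single j 1) i) ^ 2

theorem fderiv_cos_coord (i : Fin d) (l c : ℝ) :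
    fderiv ℝ (fun y : Vec d => Real.cos (l * y i + c)) =
      fun y => (-l * Real.sin (l * y i + c)) • (EuclideanSpace.proj i : Vec d →L[ℝ] ℝ) := by
  funext y
  have h1 : HasFDerivAt (fun y : Vec d => l * y i + c)
      (l • (EuclideanSpace.proj i : Vec d →L[ℝ] ℝ)) y :=
    ((EuclideanSpace.proj (𝕜 := ℝ) i).hasFDerivAt.const_mul l).add_const c
  rw [h1.cos.fderiv, smul_smul]
  congr 1
  ring

theorem fderiv_sin_coord_smul (i : Fin d) (l c : ℝ) (y : Vec d) :
    fderiv ℝ (fun y : Vec d => (-l * Real.sin (l * y i + c)) •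
      (EuclideanSpace.proj i : Vec d →L[ℝ] ℝ)) y =
      ((-l ^ 2 * Real.cos (l * y i + c)) • (EuclideanSpace.proj i : Vec d →L[ℝ] ℝ)).smulRight
        (EuclideanSpace.proj i : Vec d →L[ℝ] ℝ) := by
  have h1 : HasFDerivAt (fun y : Vec d => l * y i + c)
      (l • (EuclideanSpace.proj i : Vec d →L[ℝ] ℝ)) y :=
    ((EuclideanSpace.proj (𝕜 := ℝ) i).hasFDerivAt.const_mul l).add_const c
  have h2 := (h1.sin.const_mul (-l)).smul_const (EuclideanSpace.proj i : Vec d →L[ℝ] ℝ)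
  rw [h2.fderiv, smul_smul, smul_smul]
  congr 2
  ring

theorem norm_proj_coord_le (i : Fin d) : ‖(EuclideanSpace.proj i : Vec d →L[ℝ] ℝ)‖ ≤ 1 :=
  ContinuousLinearMap.opNorm_le_bound _ zero_le_one fun y => by
    simpa using PiLp.norm_apply_le y i

theorem continuous_diffusionCoeff (hσ : Continuous σ) (i : Fin d) :
    Continuous (diffusionCoeff σ i) := by
  unfold diffusionCoeff
  fun_prop

/-- Trigonometric functions of a coordinate with arbitrary frequency need not be periodic, so they
see the path in ℝᵈ, yet they are admissible in the martingale problem. The phase c covers sines as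
well as cosines. -/
theorem IsSolution.dynkin_cos [IsProbabilityMeasure P] (hZ : IsSolution b σ P Z)
    (hb : Continuous b) (hσ : Continuous σ) (i : Fin d) (l c : ℝ)
    {ψ : Vec d → ℝ} (hψ : Measurable ψ) {c' : ℝ} (hψb : ∀ y, |ψ y| ≤ c') {t : ℝ} (ht : 0 ≤ t) :
    ∫ ω, ψ (Z 0 ω) * (Real.cos (l * Z t.toNNReal ω i + c) - Real.cos (l * Z 0 ω i + c)) ∂P =
      ∫ s in (0 : ℝ)..t, ∫ ω, ψ (Z 0 ω) *
        (-(l ^ 2 / 2 * diffusionCoeff σ i (proj (Z s.toNNReal ω)) *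
            Real.cos (l * Z s.toNNReal ω i + c)) -
          l * b (proj (Z s.toNNReal ω)) i * Real.sin (l * Z s.toNNReal ω i + c)) ∂P := by
  have ca := continuous_diffusionCoeff hσ i
  obtain ⟨A, hA0, hA⟩ := exists_bound_of_continuous ca
  have cb : Continuous fun x => b x i := by fun_prop
  obtain ⟨B, hB0, hB⟩ := exists_bound_of_continuous cb
  have cp : Continuous (proj : Vec d → Torus d) := continuous_proj
  refine hZ.dynkin (F := fun y => Real.cos (l * y i + c))
    (H := fun y => -(l ^ 2 / 2 * diffusionCoeff σ i (proj y) * Real.cos (l * y i + c)) -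
      l * b (proj y) i * Real.sin (l * y i + c)) (c := l ^ 2 / 2 * A + |l| * B) ?_
      ⟨1 + |l| + l ^ 2, fun y => ?_⟩ (fun y => ?_) ?_ (fun y => ?_) hψ hψb ht
  · exact Real.contDiff_cos.comp ((contDiff_const.mul (contDiff_piLp_apply 2)).add contDiff_const)
  · have hc := Real.abs_cos_le_one (l * y i + c)
    have hs := Real.abs_sin_le_one (l * y i + c)
    have hp := norm_proj_coord_le i
    have hp0 := norm_nonneg (EuclideanSpace.proj i : Vec d →L[ℝ] ℝ)
    rw [fderiv_cos_coord, fderiv_sin_coord_smul, ContinuousLinearMap.norm_smulRight_apply,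
      norm_smul, norm_smul]
    simp only [norm_mul, norm_neg, Real.norm_eq_abs, abs_pow, sq_abs]
    have e1 : |l| * |Real.sin (l * y i + c)| * ‖(EuclideanSpace.proj i : Vec d →L[ℝ] ℝ)‖ ≤
        |l| * 1 * 1 := by gcongr
    have e2 : l ^ 2 * |Real.cos (l * y i + c)| * ‖(EuclideanSpace.proj i : Vec d →L[ℝ] ℝ)‖ *
        ‖(EuclideanSpace.proj i : Vec d →L[ℝ] ℝ)‖ ≤ l ^ 2 * 1 * 1 * 1 := by gcongr
    have := abs_nonneg l
    have := sq_nonneg l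
    exact ⟨by linarith, by linarith, by linarith⟩
  · simp only [diffOp, hess, fderiv_cos_coord, fderiv_sin_coord_smul]
    simp [diffusionCoeff, Finset.mul_sum, Finset.sum_mul]
    rw [← Finset.sum_neg_distrib, ← Finset.sum_neg_distrib]
    congr 1
    · exact Finset.sum_congr rfl fun j _ => by ring
    · ring
  · fun_prop
  · refine (abs_sub _ _).trans (add_le_add ?_ ?_)
    · rw [abs_neg, abs_mul, abs_mul, abs_of_nonneg (by positivity : 0 ≤ l ^ 2 / 2)]
      calc _ ≤ l ^ 2 / 2 * A * 1 := by
            gcongr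
            · exact hA _
            · exact Real.abs_cos_le_one _
        _ = _ := mul_one _
    · rw [abs_mul, abs_mul]
      calc _ ≤ |l| * B * 1 := by
            gcongr
            · exact hB _
            · exact Real.abs_sin_le_one _
        _ = _ := mul_one _

end Solution

end

/-! ### Grönwall's inequality and trigonometric truncations of powers -/

section

/-- Grönwall's inequality in integral form, with constant coefficients. -/
theorem le_mul_exp_of_le_add_integral {u : ℝ → ℝ} (hu : Continuous u) {A K T : ℝ} (hK : 0 ≤ K)
    (hT : 0 ≤ T) (h : ∀ t ∈ Set.Icc 0 T, u t ≤ A + K * ∫ s in (0 : ℝ)..t, u s) :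
    u T ≤ A * Real.exp (K * T) := by
  set g : ℝ → ℝ := fun t => (A + K * ∫ s in (0 : ℝ)..t, u s) * Real.exp (-K * t) with hg
  have hderiv : ∀ t, HasDerivAt g (K * u t * Real.exp (-K * t) +
      (A + K * ∫ s in (0 : ℝ)..t, u s) * (Real.exp (-K * t) * (-K))) t := by
    intro t
    have h1 : HasDerivAt (fun t => ∫ s in (0 : ℝ)..t, u s) (u t) t :=
      intervalIntegral.integral_hasDerivAt_right (hu.intervalIntegrable _ _)
        hu.aestronglyMeasurable.stronglyMeasurableAtFilter hu.continuousAt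
    have h2 : HasDerivAt (fun t => Real.exp (-K * t)) (Real.exp (-K * t) * (-K)) t := by
      simpa using ((hasDerivAt_id t).const_mul (-K)).exp
    exact ((h1.const_mul K).const_add A).mul h2
  have hanti : AntitoneOn g (Set.Icc 0 T) := by
    refine antitoneOn_of_deriv_nonpos (convex_Icc 0 T)
      (fun t _ => (hderiv t).continuousAt.continuousWithinAt)
      (fun t _ => (hderiv t).differentiableAt.differentiableWithinAt) fun t ht => ?_
    rw [interior_Icc] at ht
    rw [(hderiv t).deriv]
    have := h t ⟨ht.1.le, ht.2.le⟩
    have h3 : K * Real.exp (-K * t) * u t ≤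
        K * Real.exp (-K * t) * (A + K * ∫ s in (0 : ℝ)..t, u s) := by gcongr
    linarith
  have h4 : g T ≤ g 0 := hanti ⟨le_rfl, hT⟩ ⟨hT, le_rfl⟩ hT
  simp only [hg, intervalIntegral.integral_same, mul_zero, add_zero, Real.exp_zero,
    mul_one] at h4
  have h5 := h T ⟨hT, le_rfl⟩
  have h6 : Real.exp (-K * T) * Real.exp (K * T) = 1 := by
    rw [← Real.exp_add]
    simp
  calc u T ≤ (A + K * ∫ s in (0 : ℝ)..T, u s) := h5
    _ = (A + K * ∫ s in (0 : ℝ)..T, u s) * Real.exp (-K * T) * Real.exp (K * T) := by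
      rw [mul_assoc, h6, mul_one]
    _ ≤ A * Real.exp (K * T) := by gcongr

section Trig

/-- The bounded function `2 sin (l x / 2) / l`, which tends to `x` as `l → 0`. -/
def sinQuot (l x : ℝ) : ℝ := 2 * Real.sin (l * x / 2) / l

theorem sinQuot_eq {l : ℝ} (hl : l ≠ 0) (x : ℝ) : sinQuot l x = x * Real.sinc (l * x / 2) := by
  rcases eq_or_ne x 0 with rfl | hx
  · simp [sinQuot]
  · rw [sinQuot, Real.sinc_of_ne_zero (by positivity)]
    field_simp

theorem sinQuot_sq {l : ℝ} (hl : l ≠ 0) (x : ℝ) :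
    sinQuot l x ^ 2 = 2 / l ^ 2 * (1 - Real.cos (l * x)) := by
  have h1 := Real.cos_sq_add_sin_sq (l * x / 2)
  have h2 := Real.cos_two_mul (l * x / 2)
  rw [show 2 * (l * x / 2) = l * x by ring] at h2
  rw [sinQuot, h2]
  field_simp
  linear_combination 2 * h1

theorem sinQuot_pow_four {l : ℝ} (hl : l ≠ 0) (x : ℝ) :
    sinQuot l x ^ 4 =
      -8 / l ^ 4 * (Real.cos (l * x) - 1) + 2 / l ^ 4 * (Real.cos (2 * l * x) - 1) := by
  rw [show sinQuot l x ^ 4 = (sinQuot l x ^ 2) ^ 2 by ring, sinQuot_sq hl,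
    show 2 * l * x = 2 * (l * x) by ring, Real.cos_two_mul]
  field_simp
  ring

theorem two_mul_sin_div {l : ℝ} (x : ℝ) :
    2 / l * Real.sin (l * x) = 2 * sinQuot l x * Real.cos (l * x / 2) := by
  have h2 := Real.sin_two_mul (l * x / 2)
  rw [show 2 * (l * x / 2) = l * x by ring] at h2
  rw [sinQuot, h2]
  ring

/-- The left side is the generator applied to `sinQuot l` squared, an affine function of cos(lx); it
equals a cos(lx) + β (2/l) sin(lx), so no negative power of l survives. The constant is larger than
needed here in order to agree with the one for the fourth power. -/
theorem drift_sinQuot_sq_le {l : ℝ} (hl : l ≠ 0) (x : ℝ) {a β A B : ℝ} (ha : |a| ≤ A)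
    (hβ : |β| ≤ B) :
    -2 / l ^ 2 * (-(l ^ 2 / 2 * a * Real.cos (l * x)) - l * β * Real.sin (l * x)) ≤
      (6 * A + 2 * B) * (1 + sinQuot l x ^ 2) := by
  have e : -2 / l ^ 2 * (-(l ^ 2 / 2 * a * Real.cos (l * x)) - l * β * Real.sin (l * x)) =
      a * Real.cos (l * x) + β * (2 / l * Real.sin (l * x)) := by
    field_simp
    ring
  rw [e, two_mul_sin_div]
  have hA : 0 ≤ A := (abs_nonneg _).trans ha
  have hB : 0 ≤ B := (abs_nonneg _).trans hβ
  have h1 : a * Real.cos (l * x) ≤ A * 1 := by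
    refine (le_abs_self _).trans ?_
    rw [abs_mul]
    gcongr
    exact Real.abs_cos_le_one _
  have h2 : β * (2 * sinQuot l x * Real.cos (l * x / 2)) ≤ B * (2 * |sinQuot l x| * 1) := by
    refine (le_abs_self _).trans ?_
    rw [abs_mul, abs_mul, abs_mul, abs_two]
    gcongr
    exact Real.abs_cos_le_one _
  have h3 : 2 * |sinQuot l x| ≤ 1 + sinQuot l x ^ 2 := by
    nlinarith [sq_nonneg (|sinQuot l x| - 1), sq_abs (sinQuot l x)]
  have h4 : B * (2 * |sinQuot l x|) ≤ B * (1 + sinQuot l x ^ 2) := by gcongr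
  nlinarith [sq_nonneg (sinQuot l x), mul_nonneg hA (sq_nonneg (sinQuot l x)),
    mul_nonneg hB (sq_nonneg (sinQuot l x))]

/-- The generator applied to the fourth power factors through `sinQuot l x ^ 2`, as it does for x⁴.
There is thus no constant term on the right, which is what yields a fourth moment of order t² rather
than t. -/
theorem drift_sinQuot_pow_four_le {l : ℝ} (hl : l ≠ 0) (x : ℝ) {a β A B : ℝ} (ha : |a| ≤ A)
    (hβ : |β| ≤ B) :
    -8 / l ^ 4 * (-(l ^ 2 / 2 * a * Real.cos (l * x)) - l * β * Real.sin (l * x)) +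
      2 / l ^ 4 * (-((2 * l) ^ 2 / 2 * a * Real.cos (2 * l * x)) -
        2 * l * β * Real.sin (2 * l * x)) ≤
      (6 * A + 2 * B) * (sinQuot l x ^ 2 + sinQuot l x ^ 4) := by
  have hA : 0 ≤ A := (abs_nonneg _).trans ha
  have hB : 0 ≤ B := (abs_nonneg _).trans hβ
  have e : -8 / l ^ 4 * (-(l ^ 2 / 2 * a * Real.cos (l * x)) - l * β * Real.sin (l * x)) +
      2 / l ^ 4 * (-((2 * l) ^ 2 / 2 * a * Real.cos (2 * l * x)) -
        2 * l * β * Real.sin (2 * l * x)) =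
      sinQuot l x ^ 2 * (2 * a * (1 + 2 * Real.cos (l * x)) +
        2 * β * (2 / l * Real.sin (l * x))) := by
    rw [sinQuot_sq hl, show 2 * l * x = 2 * (l * x) by ring, Real.cos_two_mul, Real.sin_two_mul]
    field_simp
    ring
  rw [e, two_mul_sin_div]
  have h1 : 2 * a * (1 + 2 * Real.cos (l * x)) ≤ 2 * A * 3 := by
    refine (le_abs_self _).trans ?_
    rw [abs_mul, abs_mul, abs_two]
    gcongr
    have := Real.cos_le_one (l * x)
    have := Real.neg_one_le_cos (l * x)
    rw [abs_le]
    constructor <;> linarith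
  have h2 : 2 * β * (2 * sinQuot l x * Real.cos (l * x / 2)) ≤
      2 * B * (2 * |sinQuot l x| * 1) := by
    refine (le_abs_self _).trans ?_
    rw [abs_mul, abs_mul, abs_mul, abs_mul, abs_two]
    gcongr
    exact Real.abs_cos_le_one _
  have h3 : 2 * |sinQuot l x| ≤ 1 + sinQuot l x ^ 2 := by
    nlinarith [sq_nonneg (|sinQuot l x| - 1), sq_abs (sinQuot l x)]
  have h4 : 2 * B * (2 * |sinQuot l x|) ≤ 2 * B * (1 + sinQuot l x ^ 2) := by gcongr
  calc _ ≤ sinQuot l x ^ 2 * (2 * A * 3 + 2 * B * (1 + sinQuot l x ^ 2)) := by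
        exact mul_le_mul_of_nonneg_left (by linarith) (sq_nonneg _)
    _ = (6 * A + 2 * B) * sinQuot l x ^ 2 + 2 * B * sinQuot l x ^ 4 := by ring
    _ ≤ (6 * A + 2 * B) * sinQuot l x ^ 2 + (6 * A + 2 * B) * sinQuot l x ^ 4 := by
        gcongr
        linarith
    _ = _ := by ring

/-- Quadratic instead of cubic, so that it holds for every u and is integrated with second moments
alone. -/
theorem abs_sin_sub_self_le (u : ℝ) : |Real.sin u - u| ≤ 2 * u ^ 2 := by
  rcases le_total |u| 1 with h | h
  · have h1 := Real.sin_bound h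
    have h2 : |u| ^ 5 ≤ u ^ 2 := by
      rw [← sq_abs u]
      exact pow_le_pow_of_le_one (abs_nonneg u) h (by norm_num)
    have h3 : |u ^ 3 / 6| ≤ u ^ 2 := by
      rw [abs_div, abs_pow, ← sq_abs u, abs_of_pos (by norm_num : (0 : ℝ) < 6)]
      have : |u| ^ 3 ≤ |u| ^ 2 := pow_le_pow_of_le_one (abs_nonneg u) h (by norm_num)
      have : 0 ≤ |u| ^ 3 := by positivity
      linarith
    calc |Real.sin u - u| = |(Real.sin u - (u - u ^ 3 / 6)) - u ^ 3 / 6| := by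
          congr 1
          ring
      _ ≤ |Real.sin u - (u - u ^ 3 / 6)| + |u ^ 3 / 6| := abs_sub _ _
      _ ≤ 2 * u ^ 2 := by
        have : 0 ≤ u ^ 2 := sq_nonneg u
        linarith
  · have h1 : |u| ≤ u ^ 2 := by
      rw [← sq_abs]
      nlinarith
    have h2 := Real.abs_sin_le_one u
    have h3 := abs_sub (Real.sin u) u
    linarith

end Trig

/-! ### Dynkin's formula for functions of the displacement -/

section Displacement

variable {d n : ℕ} {b : Torus d → Vec d} {σ : Torus d → Vec n →L[ℝ] Vec d}
  {Ω : Type*} [mΩ : MeasurableSpace Ω] {P : Measure Ω} {Z : ℝ≥0 → Ω → Vec d}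

theorem IsSolution.continuous_integral [IsProbabilityMeasure P] (hZ : IsSolution b σ P Z)
    {Φ : Vec d → Vec d → ℝ} (hΦ : Measurable (Function.uncurry Φ)) (hΦc : ∀ z, Continuous (Φ z))
    {C : ℝ} (hC : ∀ z y, |Φ z y| ≤ C) :
    Continuous fun s : ℝ => ∫ ω, Φ (Z 0 ω) (Z s.toNNReal ω) ∂P := by
  refine continuous_of_dominated (bound := fun _ => C)
    (fun s => (hZ.integrable_comp hΦ hC _).aestronglyMeasurable)
    (fun s => .of_forall fun ω => hC _ _) (integrable_const _) (.of_forall fun ω => ?_)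
  exact (hΦc _).comp (hZ.continuous_toNNReal ω)

/-- Dynkin's formula for trigonometric functions of a coordinate of the displacement. -/
theorem IsSolution.dynkin_cos_displacement [IsProbabilityMeasure P] (hZ : IsSolution b σ P Z)
    (hb : Continuous b) (hσ : Continuous σ) (i : Fin d) (l c : ℝ)
    {ψ : Vec d → ℝ} (hψ : Measurable ψ) {c' : ℝ} (hψb : ∀ y, |ψ y| ≤ c') {t : ℝ} (ht : 0 ≤ t) :
    ∫ ω, ψ (Z 0 ω) * (Real.cos (l * (Z t.toNNReal ω i - Z 0 ω i) + c) - Real.cos c) ∂P =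
      ∫ s in (0 : ℝ)..t, ∫ ω, ψ (Z 0 ω) *
        (-(l ^ 2 / 2 * diffusionCoeff σ i (proj (Z s.toNNReal ω)) *
            Real.cos (l * (Z s.toNNReal ω i - Z 0 ω i) + c)) -
          l * b (proj (Z s.toNNReal ω)) i *
            Real.sin (l * (Z s.toNNReal ω i - Z 0 ω i) + c)) ∂P := by
  have ca := continuous_diffusionCoeff hσ i
  obtain ⟨A, hA0, hA⟩ := exists_bound_of_continuous ca
  have cb : Continuous fun x => b x i := by fun_prop
  obtain ⟨B, hB0, hB⟩ := exists_bound_of_continuous cb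
  have cp : Continuous (proj : Vec d → Torus d) := continuous_proj
  -- A function of Z_t - Z₀ is not a function of Z_t alone. The addition formulas split it into
  -- cos(l Z₀) and sin(l Z₀), which join the weight ψ, times cosines of Z_t with phases c and c -
  -- π/2.
  have mcos : Measurable fun y : Vec d => ψ y * Real.cos (l * y i) := by fun_prop
  have msin : Measurable fun y : Vec d => ψ y * Real.sin (l * y i) := by fun_prop
  have hc0 : 0 ≤ c' := (abs_nonneg _).trans (hψb 0)
  have bcos : ∀ y : Vec d, |ψ y * Real.cos (l * y i)| ≤ c' := fun y => by
    rw [abs_mul]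
    simpa using mul_le_mul (hψb y) (Real.abs_cos_le_one _) (abs_nonneg _) hc0
  have bsin : ∀ y : Vec d, |ψ y * Real.sin (l * y i)| ≤ c' := fun y => by
    rw [abs_mul]
    simpa using mul_le_mul (hψb y) (Real.abs_sin_le_one _) (abs_nonneg _) hc0
  have h1 := hZ.dynkin_cos hb hσ i l c mcos bcos ht
  have h2 := hZ.dynkin_cos hb hσ i l (c - Real.pi / 2) msin bsin ht
  -- integrability of the pieces
  have key : ∀ (g : Vec d → ℝ), Measurable g → (∀ y, |g y| ≤ c') → ∀ e : ℝ,
      Measurable (Function.uncurry fun (z y : Vec d) => g z *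
        (-(l ^ 2 / 2 * diffusionCoeff σ i (proj y) * Real.cos (l * y i + e)) -
          l * b (proj y) i * Real.sin (l * y i + e))) ∧
      (∀ z, Continuous fun y : Vec d => g z *
        (-(l ^ 2 / 2 * diffusionCoeff σ i (proj y) * Real.cos (l * y i + e)) -
          l * b (proj y) i * Real.sin (l * y i + e))) ∧
      ∀ z y : Vec d, |g z *
        (-(l ^ 2 / 2 * diffusionCoeff σ i (proj y) * Real.cos (l * y i + e)) -
          l * b (proj y) i * Real.sin (l * y i + e))| ≤ c' * (l ^ 2 / 2 * A * 1 + |l| * B * 1) := by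
    intro g hg hgb e
    have hcont : Continuous fun y : Vec d =>
        (-(l ^ 2 / 2 * diffusionCoeff σ i (proj y) * Real.cos (l * y i + e)) -
          l * b (proj y) i * Real.sin (l * y i + e)) := by fun_prop
    refine ⟨(hg.comp measurable_fst).mul (hcont.measurable.comp measurable_snd),
      fun z => continuous_const.mul hcont, fun z y => ?_⟩
    rw [abs_mul]
    refine mul_le_mul (hgb z) ?_ (abs_nonneg _) hc0
    refine (abs_sub _ _).trans (add_le_add ?_ ?_)
    · rw [abs_neg, abs_mul, abs_mul, abs_of_nonneg (by positivity : 0 ≤ l ^ 2 / 2)]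
      gcongr
      · exact hA _
      · exact Real.abs_cos_le_one _
    · rw [abs_mul, abs_mul]
      gcongr
      · exact hB _
      · exact Real.abs_sin_le_one _
  obtain ⟨k1, k1', k1''⟩ := key _ mcos bcos c
  obtain ⟨k2, k2', k2''⟩ := key _ msin bsin (c - Real.pi / 2)
  have key' : ∀ (g : Vec d → ℝ), Measurable g → (∀ y, |g y| ≤ c') → ∀ e : ℝ,
      Integrable (fun ω => g (Z 0 ω) *
        (Real.cos (l * Z t.toNNReal ω i + e) - Real.cos (l * Z 0 ω i + e))) P := by
    intro g hg hgb e
    refine hZ.integrable_comp (Φ := fun z y => g z *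
      (Real.cos (l * y i + e) - Real.cos (l * z i + e))) (by fun_prop) (C := c' * (1 + 1))
      (fun z y => ?_) _
    rw [abs_mul]
    refine mul_le_mul (hgb z) ((abs_sub _ _).trans (add_le_add ?_ ?_)) (abs_nonneg _) hc0
    · exact Real.abs_cos_le_one _
    · exact Real.abs_cos_le_one _
  have hs := congrArg₂ (· + ·) h1 h2
  simp only at hs
  rw [← integral_add (key' _ mcos bcos c) (key' _ msin bsin (c - Real.pi / 2)),
    ← intervalIntegral.integral_add ((hZ.continuous_integral k1 k1' k1'').intervalIntegrable _ _)
      ((hZ.continuous_integral k2 k2' k2'').intervalIntegrable _ _)] at hs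
  have trig : ∀ z y : ℝ, Real.cos (l * (y - z) + c) =
      Real.cos (l * z) * Real.cos (l * y + c) +
        Real.sin (l * z) * Real.cos (l * y + (c - Real.pi / 2)) := by
    intro z y
    rw [show l * (y - z) + c = (l * y + c) - l * z by ring, Real.cos_sub,
      show l * y + (c - Real.pi / 2) = (l * y + c) - Real.pi / 2 by ring, Real.cos_sub_pi_div_two]
    ring
  have trig' : ∀ z y : ℝ, Real.sin (l * (y - z) + c) =
      Real.cos (l * z) * Real.sin (l * y + c) +
        Real.sin (l * z) * Real.sin (l * y + (c - Real.pi / 2)) := by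
    intro z y
    rw [show l * (y - z) + c = (l * y + c) - l * z by ring, Real.sin_sub,
      show l * y + (c - Real.pi / 2) = (l * y + c) - Real.pi / 2 by ring, Real.sin_sub_pi_div_two]
    ring
  have hR : ∀ s : ℝ, ∫ ω, ψ (Z 0 ω) *
        (-(l ^ 2 / 2 * diffusionCoeff σ i (proj (Z s.toNNReal ω)) *
            Real.cos (l * (Z s.toNNReal ω i - Z 0 ω i) + c)) -
          l * b (proj (Z s.toNNReal ω)) i *
            Real.sin (l * (Z s.toNNReal ω i - Z 0 ω i) + c)) ∂P = _ := fun s =>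
    Eq.trans (integral_congr_ae (.of_forall fun ω => by simp only [trig, trig']; ring))
      (integral_add (hZ.integrable_comp k1 k1'' s.toNNReal) (hZ.integrable_comp k2 k2'' s.toNNReal))
  simp only [hR]
  rw [← hs]
  refine integral_congr_ae (.of_forall fun ω => ?_)
  have := trig (Z 0 ω i) (Z 0 ω i)
  simp only [sub_self, mul_zero, zero_add] at this
  simp only [trig, this]
  ring

end Displacement

end

section

/-! ### Fourth moment of the displacement -/

section Moments

variable {d n : ℕ} {b : Torus d → Vec d} {σ : Torus d → Vec n →L[ℝ] Vec d}
  {Ω : Type*} [mΩ : MeasurableSpace Ω] {P : Measure Ω} {Z : ℝ≥0 → Ω → Vec d}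

theorem measurable_sinQuot (l : ℝ) : Measurable (sinQuot l) := by
  unfold sinQuot
  fun_prop

theorem continuous_sinQuot (l : ℝ) : Continuous (sinQuot l) := by
  unfold sinQuot
  fun_prop

theorem abs_sinQuot_le (l x : ℝ) : |sinQuot l x| ≤ 2 / |l| := by
  rw [sinQuot, abs_div, abs_mul, abs_two]
  gcongr
  have := Real.abs_sin_le_one (l * x / 2)
  linarith

theorem IsSolution.integrable_sinQuot_pow [IsProbabilityMeasure P] (hZ : IsSolution b σ P Z)
    (i : Fin d) (l : ℝ) (k : ℕ) (s : ℝ≥0) :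
    Integrable (fun ω => sinQuot l (Z s ω i - Z 0 ω i) ^ k) P := by
  refine hZ.integrable_comp (Φ := fun z y => sinQuot l (y i - z i) ^ k) (C := (2 / |l|) ^ k) ?_
    (fun z y => ?_) s
  · have := measurable_sinQuot l
    fun_prop
  · rw [abs_pow]
    exact pow_le_pow_left₀ (abs_nonneg _) (abs_sinQuot_le _ _) _

theorem IsSolution.continuous_integral_sinQuot_pow [IsProbabilityMeasure P]
    (hZ : IsSolution b σ P Z) (i : Fin d) (l : ℝ) (k : ℕ) :
    Continuous fun s : ℝ => ∫ ω, sinQuot l (Z s.toNNReal ω i - Z 0 ω i) ^ k ∂P := by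
  refine hZ.continuous_integral (Φ := fun z y => sinQuot l (y i - z i) ^ k) (C := (2 / |l|) ^ k) ?_
    (fun z => ?_) (fun z y => ?_)
  · have := measurable_sinQuot l
    fun_prop
  · have := continuous_sinQuot l
    fun_prop
  · rw [abs_pow]
    exact pow_le_pow_left₀ (abs_nonneg _) (abs_sinQuot_le _ _) _

variable {A B : ℝ}

/-- The drift term in Dynkin's formula for `cos (l (Zⁱ - Z₀ⁱ))` is integrable. -/
theorem IsSolution.dynkin_cos_drift [IsProbabilityMeasure P]
    (hZ : IsSolution b σ P Z) (hb : Continuous b) (hσ : Continuous σ)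
    (hA : ∀ i x, |diffusionCoeff σ i x| ≤ A) (hB : ∀ x i, |b x i| ≤ B) (i : Fin d) (l : ℝ) :
    (∀ s : ℝ≥0, Integrable (fun ω =>
        -(l ^ 2 / 2 * diffusionCoeff σ i (proj (Z s ω)) *
            Real.cos (l * (Z s ω i - Z 0 ω i))) -
          l * b (proj (Z s ω)) i * Real.sin (l * (Z s ω i - Z 0 ω i))) P) ∧
    Continuous (fun s : ℝ => ∫ ω,
        (-(l ^ 2 / 2 * diffusionCoeff σ i (proj (Z s.toNNReal ω)) *
            Real.cos (l * (Z s.toNNReal ω i - Z 0 ω i))) -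
          l * b (proj (Z s.toNNReal ω)) i *
            Real.sin (l * (Z s.toNNReal ω i - Z 0 ω i))) ∂P) ∧
    ∀ t : ℝ, 0 ≤ t → ∫ ω, (Real.cos (l * (Z t.toNNReal ω i - Z 0 ω i)) - 1) ∂P =
      ∫ s in (0 : ℝ)..t, ∫ ω,
        (-(l ^ 2 / 2 * diffusionCoeff σ i (proj (Z s.toNNReal ω)) *
            Real.cos (l * (Z s.toNNReal ω i - Z 0 ω i))) -
          l * b (proj (Z s.toNNReal ω)) i *
            Real.sin (l * (Z s.toNNReal ω i - Z 0 ω i))) ∂P := by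
  have ca := continuous_diffusionCoeff hσ i
  have cb : Continuous fun x => b x i := by fun_prop
  have cp : Continuous (proj : Vec d → Torus d) := continuous_proj
  have hcont : Continuous (Function.uncurry fun z y : Vec d =>
        (-(l ^ 2 / 2 * diffusionCoeff σ i (proj y) * Real.cos (l * (y i - z i))) -
          l * b (proj y) i * Real.sin (l * (y i - z i)))) := by fun_prop
  have hbd : ∀ z y : Vec d,
      |(-(l ^ 2 / 2 * diffusionCoeff σ i (proj y) * Real.cos (l * (y i - z i))) -
          l * b (proj y) i * Real.sin (l * (y i - z i)))| ≤ l ^ 2 / 2 * A * 1 + |l| * B * 1 := by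
    intro z y
    have hA0 : 0 ≤ A := (abs_nonneg _).trans (hA i 0)
    have hB0 : 0 ≤ B := (abs_nonneg _).trans (hB 0 i)
    refine (abs_sub _ _).trans (add_le_add ?_ ?_)
    · rw [abs_neg, abs_mul, abs_mul, abs_of_nonneg (by positivity : 0 ≤ l ^ 2 / 2)]
      gcongr
      · exact hA _ _
      · exact Real.abs_cos_le_one _
    · rw [abs_mul, abs_mul]
      gcongr
      · exact hB _ _
      · exact Real.abs_sin_le_one _
  refine ⟨fun s => hZ.integrable_comp hcont.measurable hbd s,
    hZ.continuous_integral hcont.measurable (fun z => hcont.uncurry_left z) hbd, fun t ht => ?_⟩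
  have := hZ.dynkin_cos_displacement hb hσ i l 0 (ψ := fun _ => 1) measurable_const (c' := 1)
    (fun _ => by simp) ht
  simpa using this

/-- If u(t) is the integral on the left, Dynkin's formula and the drift bound give u(t) ≤ K ∫₀ᵗ (1 +
u) with K = 6A + 2B, and Grönwall concludes. The bound is free of l. -/
theorem IsSolution.integral_sinQuot_sq_le [IsProbabilityMeasure P] (hZ : IsSolution b σ P Z)
    (hb : Continuous b) (hσ : Continuous σ) (hA : ∀ i x, |diffusionCoeff σ i x| ≤ A)
    (hB : ∀ x i, |b x i| ≤ B) (i : Fin d) {l : ℝ} (hl : l ≠ 0) {t : ℝ} (ht : 0 ≤ t) :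
    ∫ ω, sinQuot l (Z t.toNNReal ω i - Z 0 ω i) ^ 2 ∂P ≤
      (6 * A + 2 * B) * t * Real.exp ((6 * A + 2 * B) * t) := by
  obtain ⟨h1, h2, h3⟩ := hZ.dynkin_cos_drift hb hσ hA hB i l
  have hA0 : 0 ≤ A := (abs_nonneg _).trans (hA i 0)
  have hB0 : 0 ≤ B := (abs_nonneg _).trans (hB 0 i)
  refine le_mul_exp_of_le_add_integral (hZ.continuous_integral_sinQuot_pow i l 2)
    (by positivity) ht fun s hs => ?_
  have e : ∀ s : ℝ, 0 ≤ s → ∫ ω, sinQuot l (Z s.toNNReal ω i - Z 0 ω i) ^ 2 ∂P =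
      ∫ u in (0 : ℝ)..s, -2 / l ^ 2 * ∫ ω,
        (-(l ^ 2 / 2 * diffusionCoeff σ i (proj (Z u.toNNReal ω)) *
            Real.cos (l * (Z u.toNNReal ω i - Z 0 ω i))) -
          l * b (proj (Z u.toNNReal ω)) i *
            Real.sin (l * (Z u.toNNReal ω i - Z 0 ω i))) ∂P := by
    intro s hs
    rw [intervalIntegral.integral_const_mul, ← h3 s hs, ← integral_const_mul]
    refine integral_congr_ae (.of_forall fun ω => ?_)
    simp only [sinQuot_sq hl]
    ring
  rw [e s hs.1]
  have hc := hZ.continuous_integral_sinQuot_pow i l 2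
  have hle : ∫ u in (0 : ℝ)..s, -2 / l ^ 2 * ∫ ω,
        (-(l ^ 2 / 2 * diffusionCoeff σ i (proj (Z u.toNNReal ω)) *
            Real.cos (l * (Z u.toNNReal ω i - Z 0 ω i))) -
          l * b (proj (Z u.toNNReal ω)) i *
            Real.sin (l * (Z u.toNNReal ω i - Z 0 ω i))) ∂P ≤
      ∫ u in (0 : ℝ)..s, ((6 * A + 2 * B) * 1 + (6 * A + 2 * B) *
        ∫ ω, sinQuot l (Z u.toNNReal ω i - Z 0 ω i) ^ 2 ∂P) := by
    refine intervalIntegral.integral_mono_on hs.1 ((h2.const_mul _).intervalIntegrable _ _)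
      ((continuous_const.add (hc.const_mul _)).intervalIntegrable _ _) fun u _ => ?_
    have hi := hZ.integrable_sinQuot_pow i l 2 u.toNNReal
    have hone := integral_add (integrable_const (μ := P) (1 : ℝ)) hi
    rw [integral_const, probReal_univ, one_smul] at hone
    rw [← integral_const_mul, ← mul_add, ← hone, ← integral_const_mul]
    exact integral_mono ((h1 _).const_mul _) (((integrable_const _).add hi).const_mul _)
      fun ω => drift_sinQuot_sq_le hl _ (hA _ _) (hB _ _)
  refine hle.trans ?_
  rw [intervalIntegral.integral_add (intervalIntegrable_const)
    ((hc.const_mul _).intervalIntegrable _ _), intervalIntegral.integral_const,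
    intervalIntegral.integral_const_mul]
  have : (6 * A + 2 * B) * s ≤ (6 * A + 2 * B) * t := by gcongr; exact hs.2
  simp only [smul_eq_mul]
  linarith

/-- Same scheme, but the source term is K times the truncated second moment, already of order t;
integrated over [0, t] it contributes t². -/
theorem IsSolution.integral_sinQuot_pow_four_le [IsProbabilityMeasure P]
    (hZ : IsSolution b σ P Z)
    (hb : Continuous b) (hσ : Continuous σ) (hA : ∀ i x, |diffusionCoeff σ i x| ≤ A)
    (hB : ∀ x i, |b x i| ≤ B) (i : Fin d) {l : ℝ} (hl : l ≠ 0) {t : ℝ} (ht : 0 ≤ t) :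
    ∫ ω, sinQuot l (Z t.toNNReal ω i - Z 0 ω i) ^ 4 ∂P ≤
      (6 * A + 2 * B) ^ 2 * t ^ 2 * Real.exp ((6 * A + 2 * B) * t) ^ 2 := by
  obtain ⟨h1, h2, h3⟩ := hZ.dynkin_cos_drift hb hσ hA hB i l
  obtain ⟨h1', h2', h3'⟩ := hZ.dynkin_cos_drift hb hσ hA hB i (2 * l)
  have hA0 : 0 ≤ A := (abs_nonneg _).trans (hA i 0)
  have hB0 : 0 ≤ B := (abs_nonneg _).trans (hB 0 i)
  set K := 6 * A + 2 * B with hK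
  have hK0 : 0 ≤ K := by positivity
  have hc := hZ.continuous_integral_sinQuot_pow i l 4
  have hcos : ∀ (l : ℝ) (s : ℝ≥0),
      Integrable (fun ω => Real.cos (l * (Z s ω i - Z 0 ω i)) - 1) P := fun l s =>
    hZ.integrable_comp (Φ := fun z y => Real.cos (l * (y i - z i)) - 1) (by fun_prop)
      (C := 1 + 1) (fun z y => (abs_sub _ _).trans
        (add_le_add (Real.abs_cos_le_one _) (by simp))) s
  have key : ∫ ω, sinQuot l (Z t.toNNReal ω i - Z 0 ω i) ^ 4 ∂P ≤
      (K * (K * t * Real.exp (K * t)) * t) * Real.exp (K * t) := by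
    refine le_mul_exp_of_le_add_integral hc hK0 ht fun s hs => ?_
    have e : ∫ ω, sinQuot l (Z s.toNNReal ω i - Z 0 ω i) ^ 4 ∂P =
        ∫ u in (0 : ℝ)..s, (-8 / l ^ 4 * (∫ ω,
          (-(l ^ 2 / 2 * diffusionCoeff σ i (proj (Z u.toNNReal ω)) *
              Real.cos (l * (Z u.toNNReal ω i - Z 0 ω i))) -
            l * b (proj (Z u.toNNReal ω)) i *
              Real.sin (l * (Z u.toNNReal ω i - Z 0 ω i))) ∂P) +
          2 / l ^ 4 * ∫ ω, (-((2 * l) ^ 2 / 2 * diffusionCoeff σ i (proj (Z u.toNNReal ω)) *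
              Real.cos (2 * l * (Z u.toNNReal ω i - Z 0 ω i))) -
            2 * l * b (proj (Z u.toNNReal ω)) i *
              Real.sin (2 * l * (Z u.toNNReal ω i - Z 0 ω i))) ∂P) := by
      rw [intervalIntegral.integral_add ((h2.const_mul _).intervalIntegrable _ _)
        ((h2'.const_mul _).intervalIntegrable _ _), intervalIntegral.integral_const_mul,
        intervalIntegral.integral_const_mul, ← h3 s hs.1, ← h3' s hs.1, ← integral_const_mul,
        ← integral_const_mul, ← integral_add ((hcos _ _).const_mul _) ((hcos _ _).const_mul _)]
      exact integral_congr_ae (.of_forall fun ω => sinQuot_pow_four hl _)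
    have hle : ∫ ω, sinQuot l (Z s.toNNReal ω i - Z 0 ω i) ^ 4 ∂P ≤
        ∫ u in (0 : ℝ)..s, (K * (K * t * Real.exp (K * t)) + K *
          ∫ ω, sinQuot l (Z u.toNNReal ω i - Z 0 ω i) ^ 4 ∂P) := by
      rw [e]
      refine intervalIntegral.integral_mono_on hs.1
        (((h2.const_mul _).add (h2'.const_mul _)).intervalIntegrable _ _)
        ((continuous_const.add (hc.const_mul _)).intervalIntegrable _ _) fun u hu => ?_
      have hi2 := hZ.integrable_sinQuot_pow i l 2 u.toNNReal
      have hi4 := hZ.integrable_sinQuot_pow i l 4 u.toNNReal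
      have hut : u ≤ t := hu.2.trans hs.2
      have hm2 : ∫ ω, sinQuot l (Z u.toNNReal ω i - Z 0 ω i) ^ 2 ∂P ≤
          K * t * Real.exp (K * t) := by
        refine (hZ.integral_sinQuot_sq_le hb hσ hA hB i hl hu.1).trans ?_
        rw [← hK]
        gcongr
      calc _ ≤ ∫ ω, K * (sinQuot l (Z u.toNNReal ω i - Z 0 ω i) ^ 2 +
            sinQuot l (Z u.toNNReal ω i - Z 0 ω i) ^ 4) ∂P := by
            rw [← integral_const_mul, ← integral_const_mul,
              ← integral_add ((h1 _).const_mul _) ((h1' _).const_mul _)]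
            exact integral_mono (((h1 _).const_mul _).add ((h1' _).const_mul _))
              ((hi2.add hi4).const_mul _)
              fun ω => drift_sinQuot_pow_four_le hl _ (hA _ _) (hB _ _)
        _ = K * (∫ ω, sinQuot l (Z u.toNNReal ω i - Z 0 ω i) ^ 2 ∂P) +
            K * ∫ ω, sinQuot l (Z u.toNNReal ω i - Z 0 ω i) ^ 4 ∂P := by
            rw [integral_const_mul, integral_add hi2 hi4, mul_add]
        _ ≤ _ := by gcongr
    refine hle.trans ?_
    rw [intervalIntegral.integral_add (intervalIntegrable_const)
      ((hc.const_mul _).intervalIntegrable _ _), intervalIntegral.integral_const,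
      intervalIntegral.integral_const_mul]
    have : K * (K * t * Real.exp (K * t)) * s ≤ K * (K * t * Real.exp (K * t)) * t := by
      gcongr
      exact hs.2
    simp only [smul_eq_mul]
    linarith
  exact key.trans (le_of_eq (by ring))

theorem tendsto_sinQuot (x : ℝ) :
    Filter.Tendsto (fun k : ℕ => sinQuot (1 / ((k : ℝ) + 1)) x) Filter.atTop (nhds x) := by
  have h1 : ∀ k : ℕ, sinQuot (1 / ((k : ℝ) + 1)) x =
      x * Real.sinc (1 / ((k : ℝ) + 1) * x / 2) := fun k => sinQuot_eq (by positivity) x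
  simp only [h1]
  have h2 : Filter.Tendsto (fun k : ℕ => 1 / ((k : ℝ) + 1) * x / 2) Filter.atTop (nhds 0) := by
    simpa using (tendsto_one_div_add_atTop_nhds_zero_nat (𝕜 := ℝ)).mul_const (x / 2) |>.congr
      fun k => by ring
  have h3 := (Real.continuous_sinc.tendsto 0).comp h2
  simpa using h3.const_mul x

/-- Fourth moment of a coordinate of the displacement. -/
theorem IsSolution.fourth_moment_coord [IsProbabilityMeasure P] (hZ : IsSolution b σ P Z)
    (hb : Continuous b) (hσ : Continuous σ) (hA : ∀ i x, |diffusionCoeff σ i x| ≤ A)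
    (hB : ∀ x i, |b x i| ≤ B) (i : Fin d) {t : ℝ} (ht : 0 ≤ t) :
    Integrable (fun ω => (Z t.toNNReal ω i - Z 0 ω i) ^ 4) P ∧
    ∫ ω, (Z t.toNNReal ω i - Z 0 ω i) ^ 4 ∂P ≤
      (6 * A + 2 * B) ^ 2 * t ^ 2 * Real.exp ((6 * A + 2 * B) * t) ^ 2 := by
  set C := (6 * A + 2 * B) ^ 2 * t ^ 2 * Real.exp ((6 * A + 2 * B) * t) ^ 2 with hC
  have hC0 : 0 ≤ C := by positivity
  have m0 := hZ.measurable 0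
  have mt := hZ.measurable t.toNNReal
  have hm : Measurable fun ω => (Z t.toNNReal ω i - Z 0 ω i) ^ 4 := by fun_prop
  have hlint : ∫⁻ ω, ENNReal.ofReal ((Z t.toNNReal ω i - Z 0 ω i) ^ 4) ∂P ≤
      ENNReal.ofReal C := by
    have hlim : ∀ ω, ENNReal.ofReal ((Z t.toNNReal ω i - Z 0 ω i) ^ 4) =
        Filter.liminf (fun k : ℕ => ENNReal.ofReal
          (sinQuot (1 / ((k : ℝ) + 1)) (Z t.toNNReal ω i - Z 0 ω i) ^ 4)) Filter.atTop :=
      fun ω => (Filter.Tendsto.liminf_eq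
        (ENNReal.tendsto_ofReal ((tendsto_sinQuot _).pow 4))).symm
    simp only [hlim]
    -- Fatou along l = 1/(k+1) → 0. In terms of lower integrals this gives integrability and the
    -- bound at once.
    refine (lintegral_liminf_le fun k => ?_).trans ?_
    · have := measurable_sinQuot (1 / ((k : ℝ) + 1))
      fun_prop
    · refine Filter.liminf_le_of_frequently_le' (Filter.Frequently.of_forall fun k => ?_)
      rw [← ofReal_integral_eq_lintegral_ofReal (hZ.integrable_sinQuot_pow i _ 4 _)
        (.of_forall fun ω => by positivity)]
      exact ENNReal.ofReal_le_ofReal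
        (hZ.integral_sinQuot_pow_four_le hb hσ hA hB i (by positivity) ht)
  have hint : Integrable (fun ω => (Z t.toNNReal ω i - Z 0 ω i) ^ 4) P := by
    refine ⟨hm.aestronglyMeasurable, ?_⟩
    rw [hasFiniteIntegral_iff_ofReal (.of_forall fun ω => by positivity)]
    exact hlint.trans_lt ENNReal.ofReal_lt_top
  refine ⟨hint, ?_⟩
  rw [← ofReal_integral_eq_lintegral_ofReal hint (.of_forall fun ω => by positivity)] at hlint
  exact (ENNReal.ofReal_le_ofReal_iff hC0).1 hlint

theorem norm_pow_four_le (x : Vec d) : ‖x‖ ^ 4 ≤ d * ∑ i, x i ^ 4 := by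
  rw [show ‖x‖ ^ 4 = (‖x‖ ^ 2) ^ 2 by ring, EuclideanSpace.real_norm_sq_eq]
  refine (sq_sum_le_card_mul_sum_sq (s := Finset.univ) (f := fun i => x i ^ 2)).trans
    (le_of_eq ?_)
  simp only [Finset.card_univ, Fintype.card_fin, ← pow_mul]

/-- Fourth moment of the displacement of a solution. -/
theorem IsSolution.fourth_moment [IsProbabilityMeasure P] (hZ : IsSolution b σ P Z)
    (hb : Continuous b) (hσ : Continuous σ) (hA : ∀ i x, |diffusionCoeff σ i x| ≤ A)
    (hB : ∀ x i, |b x i| ≤ B) {t : ℝ} (ht : 0 ≤ t) :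
    Integrable (fun ω => ‖Z t.toNNReal ω - Z 0 ω‖ ^ 4) P ∧
    ∫ ω, ‖Z t.toNNReal ω - Z 0 ω‖ ^ 4 ∂P ≤
      d * (d * ((6 * A + 2 * B) ^ 2 * t ^ 2 * Real.exp ((6 * A + 2 * B) * t) ^ 2)) := by
  have h := fun i => hZ.fourth_moment_coord hb hσ hA hB i ht
  have hsum : Integrable (fun ω => (d : ℝ) * ∑ i, (Z t.toNNReal ω i - Z 0 ω i) ^ 4) P :=
    (integrable_finsetSum _ fun i _ => (h i).1).const_mul _
  have m0 := hZ.measurable 0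
  have mt := hZ.measurable t.toNNReal
  have hle : ∀ ω, ‖Z t.toNNReal ω - Z 0 ω‖ ^ 4 ≤
      (d : ℝ) * ∑ i, (Z t.toNNReal ω i - Z 0 ω i) ^ 4 := fun ω => norm_pow_four_le _
  have hint : Integrable (fun ω => ‖Z t.toNNReal ω - Z 0 ω‖ ^ 4) P := by
    refine hsum.mono' (by fun_prop) (.of_forall fun ω => ?_)
    rw [Real.norm_of_nonneg (by positivity)]
    exact hle ω
  refine ⟨hint, (integral_mono hint hsum hle).trans ?_⟩
  rw [integral_const_mul, integral_finsetSum _ fun i _ => (h i).1]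
  gcongr
  refine (Finset.sum_le_sum fun i _ => (h i).2).trans ?_
  simp

end Moments

end

/-! ### Short-time weak expansions along a solution -/

section

theorem abs_integral_le_of_abs_le {Ω : Type*} [MeasurableSpace Ω] {P : Measure Ω}
    [IsProbabilityMeasure P] {f : Ω → ℝ} {C : ℝ} (h : ∀ᵐ ω ∂P, |f ω| ≤ C) :
    |∫ ω, f ω ∂P| ≤ C := by
  simpa using norm_integral_le_of_norm_le_const (μ := P) (f := f) (C := C) h

theorem abs_intervalIntegral_sub_le {g : ℝ → ℝ} (hg : Continuous g) {c C t : ℝ} (ht : 0 ≤ t)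
    (h : ∀ s ∈ Set.Icc 0 t, |g s - c| ≤ C * t) :
    |(∫ s in (0 : ℝ)..t, g s) - t * c| ≤ C * t ^ 2 := by
  have h1 : (∫ s in (0 : ℝ)..t, g s) - t * c = ∫ s in (0 : ℝ)..t, (g s - c) := by
    rw [intervalIntegral.integral_sub (hg.intervalIntegrable _ _) intervalIntegrable_const,
      intervalIntegral.integral_const, smul_eq_mul, sub_zero]
  have h2 := intervalIntegral.norm_integral_le_of_norm_le_const (a := 0) (b := t)
    (f := fun s => g s - c) (C := C * t) fun s hs => by
      rw [Set.uIoc_of_le ht] at hs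
      exact h s ⟨hs.1.le, hs.2⟩
  rw [h1, ← Real.norm_eq_abs]
  refine h2.trans (le_of_eq ?_)
  rw [sub_zero, abs_of_nonneg ht]
  ring

/-- Young's inequality y² ≤ t + y⁴/t, with the weight chosen so that both terms have mean of order
t. -/
theorem integral_sq_le_of_integral_pow_four_le {Ω : Type*} [MeasurableSpace Ω] {P : Measure Ω}
    [IsProbabilityMeasure P] {Y : Ω → ℝ} (hY : Measurable Y)
    (hi : Integrable (fun ω => Y ω ^ 4) P) {C t : ℝ} (ht : 0 < t)
    (h : ∫ ω, Y ω ^ 4 ∂P ≤ C * t ^ 2) :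
    Integrable (fun ω => Y ω ^ 2) P ∧ ∫ ω, Y ω ^ 2 ∂P ≤ (1 + C) * t := by
  have hle : ∀ ω, Y ω ^ 2 ≤ t + t⁻¹ * Y ω ^ 4 := fun ω => by
    have h1 : 0 ≤ t⁻¹ * (t - Y ω ^ 2) ^ 2 := by positivity
    have h2 : t⁻¹ * (t - Y ω ^ 2) ^ 2 = t - 2 * Y ω ^ 2 + t⁻¹ * Y ω ^ 4 := by
      field_simp
      ring
    nlinarith [sq_nonneg (Y ω)]
  have hint : Integrable (fun ω => t + t⁻¹ * Y ω ^ 4) P :=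
    (integrable_const _).add (hi.const_mul _)
  have hint2 : Integrable (fun ω => Y ω ^ 2) P := by
    refine hint.mono' (by fun_prop) (.of_forall fun ω => ?_)
    rw [Real.norm_of_nonneg (by positivity)]
    exact hle ω
  refine ⟨hint2, (integral_mono hint2 hint hle).trans ?_⟩
  rw [integral_add (integrable_const _) (hi.const_mul _), integral_const_mul, integral_const,
    probReal_univ, one_smul]
  have : t⁻¹ * ∫ ω, Y ω ^ 4 ∂P ≤ t⁻¹ * (C * t ^ 2) := by gcongr
  refine (add_le_add_right this t).trans (le_of_eq ?_)
  field_simp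

section WeakError

variable {d n : ℕ} {b : Torus d → Vec d} {σ : Torus d → Vec n →L[ℝ] Vec d}
  {Ω : Type*} [mΩ : MeasurableSpace Ω]

theorem IsSolution.integrable_mul_torus {P : Measure Ω} [IsProbabilityMeasure P]
    {Z : ℝ≥0 → Ω → Vec d} (hZ : IsSolution b σ P Z) {ψ f : Torus d → ℝ} (hψ : Continuous ψ)
    (hf : Continuous f) (t : ℝ≥0) :
    Integrable (fun ω => ψ (proj (Z 0 ω)) * f (proj (Z t ω))) P := by
  obtain ⟨c, hc0, hc⟩ := exists_bound_of_continuous hψ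
  obtain ⟨c', hc0', hc'⟩ := exists_bound_of_continuous hf
  have hp : Continuous (proj : Vec d → Torus d) := continuous_proj
  refine hZ.integrable_comp (Φ := fun z y => ψ (proj z) * f (proj y)) (C := c * c')
    (Continuous.measurable (by fun_prop)) (fun z y => ?_) t
  rw [abs_mul]
  exact mul_le_mul (hc _) (hc' _) (abs_nonneg _) hc0

theorem IsSolution.continuous_integral_mul_torus {P : Measure Ω} [IsProbabilityMeasure P]
    {Z : ℝ≥0 → Ω → Vec d} (hZ : IsSolution b σ P Z) {ψ f : Torus d → ℝ} (hψ : Continuous ψ)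
    (hf : Continuous f) :
    Continuous fun s : ℝ => ∫ ω, ψ (proj (Z 0 ω)) * f (proj (Z s.toNNReal ω)) ∂P := by
  obtain ⟨c, hc0, hc⟩ := exists_bound_of_continuous hψ
  obtain ⟨c', hc0', hc'⟩ := exists_bound_of_continuous hf
  have hp : Continuous (proj : Vec d → Torus d) := continuous_proj
  refine hZ.continuous_integral (Φ := fun z y => ψ (proj z) * f (proj y)) (C := c * c')
    (Continuous.measurable (by fun_prop)) (fun z => by fun_prop) (fun z y => ?_)
  rw [abs_mul]
  exact mul_le_mul (hc _) (hc' _) (abs_nonneg _) hc0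

/-- Dynkin's formula with sup |ψ| · sup |gen f| as constant. Here and below the constant is chosen
before the solution: the observations come from different solutions on the same probability space,
and one constant must serve them all. -/
theorem exists_weak_error_le (hb : Continuous b) (hσ : Continuous σ) {f ψ : Torus d → ℝ}
    (hf : IsCk 2 f) (hψ : Continuous ψ) (P : Measure Ω) [IsProbabilityMeasure P] :
    ∃ C : ℝ, 0 ≤ C ∧ ∀ Z, IsSolution b σ P Z → ∀ t : ℝ, 0 ≤ t →
      |(∫ ω, ψ (proj (Z 0 ω)) * f (proj (Z t.toNNReal ω)) ∂P) -
        ∫ ω, ψ (proj (Z 0 ω)) * f (proj (Z 0 ω)) ∂P| ≤ C * t := by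
  have hgen : Continuous (gen b σ f) := by
    have c1 := (IsCk.torusDeriv (p := 1) hf).continuous
    have c2 := (IsCk.torusDeriv (p := 0) (IsCk.torusDeriv (p := 1) hf)).continuous
    unfold gen
    fun_prop
  obtain ⟨c, hc0, hc⟩ := exists_bound_of_continuous hψ
  obtain ⟨c', hc0', hc'⟩ := exists_bound_of_continuous hgen
  refine ⟨c * c', by positivity, fun Z hZ t ht => ?_⟩
  have h := hZ.dynkin_torus hb hσ hf hψ ht
  rw [← integral_sub (hZ.integrable_mul_torus hψ hf.continuous _)
    (hZ.integrable_mul_torus hψ hf.continuous _)]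
  simp only [← mul_sub]
  rw [h, ← Real.norm_eq_abs]
  have h2 := intervalIntegral.norm_integral_le_of_norm_le_const (a := 0) (b := t) (C := c * c')
    (f := fun s : ℝ => ∫ ω, ψ (proj (Z 0 ω)) * gen b σ f (proj (Z s.toNNReal ω)) ∂P)
    fun s _ => abs_integral_le_of_abs_le (.of_forall fun ω => by
      rw [abs_mul]
      exact mul_le_mul (hc _) (hc' _) (abs_nonneg _) hc0)
  rwa [sub_zero, abs_of_nonneg ht] at h2

/-- Dynkin for f, then the first-order weak error for gen f under the time integral. Applying the
generator twice is what requires features of class C⁴ and coefficients of class C². -/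
theorem exists_weak_error_gen_le (hb : IsCk 2 b) (hσ : IsCk 2 σ) {f ψ : Torus d → ℝ}
    (hf : IsCk 4 f) (hψ : Continuous ψ) (P : Measure Ω) [IsProbabilityMeasure P] :
    ∃ C : ℝ, 0 ≤ C ∧ ∀ Z, IsSolution b σ P Z → ∀ t : ℝ, 0 ≤ t →
      |(∫ ω, ψ (proj (Z 0 ω)) * (f (proj (Z t.toNNReal ω)) - f (proj (Z 0 ω))) ∂P) -
        t * ∫ ω, ψ (proj (Z 0 ω)) * gen b σ f (proj (Z 0 ω)) ∂P| ≤ C * t ^ 2 := by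
  have hg : IsCk 2 (gen b σ f) := hf.gen hb hσ
  obtain ⟨C, hC0, hC⟩ := exists_weak_error_le hb.continuous hσ.continuous hg hψ P
  refine ⟨C, hC0, fun Z hZ t ht => ?_⟩
  rw [hZ.dynkin_torus hb.continuous hσ.continuous (hf.of_le (by norm_num)) hψ ht]
  refine abs_intervalIntegral_sub_le (hZ.continuous_integral_mul_torus hψ hg.continuous) ht
    fun s hs => (hC Z hZ s hs.1).trans ?_
  gcongr
  exact hs.2

theorem exists_weak_error_average_le (hb : Continuous b) (hσ : Continuous σ) {f ψ : Torus d → ℝ}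
    (hf : IsCk 2 f) (hψ : Continuous ψ) (P : Measure Ω) [IsProbabilityMeasure P] :
    ∃ C : ℝ, 0 ≤ C ∧ ∀ Z, IsSolution b σ P Z → ∀ t : ℝ, 0 < t →
      |∫ ω, ψ (proj (Z 0 ω)) * ((1 / t) * (∫ s in (0 : ℝ)..t, f (proj (Z s.toNNReal ω))) -
        f (proj (Z 0 ω))) ∂P| ≤ C * t := by
  obtain ⟨C, hC0, hC⟩ := exists_weak_error_le hb hσ hf hψ P
  obtain ⟨c, hc0, hc⟩ := exists_bound_of_continuous hψ
  obtain ⟨c', hc0', hc'⟩ := exists_bound_of_continuous hf.continuous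
  have hp : Continuous (proj : Vec d → Torus d) := continuous_proj
  have hfc := hf.continuous
  refine ⟨C, hC0, fun Z hZ t ht => ?_⟩
  obtain ⟨h1, h2⟩ := hZ.integral_intervalIntegral (Φ := fun z y => ψ (proj z) * f (proj y))
    (C := c * c') (Continuous.measurable (by fun_prop)) (fun z y => by
      rw [abs_mul]
      exact mul_le_mul (hc _) (hc' _) (abs_nonneg _) hc0) ht.le
  have e : ∀ ω, ψ (proj (Z 0 ω)) * ((1 / t) * (∫ s in (0 : ℝ)..t, f (proj (Z s.toNNReal ω))) -
        f (proj (Z 0 ω))) = (1 / t) * (∫ s in (0 : ℝ)..t, ψ (proj (Z 0 ω)) *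
          f (proj (Z s.toNNReal ω))) - ψ (proj (Z 0 ω)) * f (proj (Z 0 ω)) := fun ω => by
    rw [intervalIntegral.integral_const_mul]
    ring
  simp only [e]
  rw [integral_sub (h1.const_mul _) (hZ.integrable_mul_torus hψ hfc _), integral_const_mul, h2]
  have h3 := abs_intervalIntegral_sub_le (hZ.continuous_integral_mul_torus hψ hfc) ht.le
    (c := ∫ ω, ψ (proj (Z 0 ω)) * f (proj (Z 0 ω)) ∂P) (C := C)
    fun s hs => (hC Z hZ s hs.1).trans (by gcongr; exact hs.2)
  set I := ∫ s in (0 : ℝ)..t, ∫ ω, ψ (proj (Z 0 ω)) * f (proj (Z s.toNNReal ω)) ∂P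
  set J := ∫ ω, ψ (proj (Z 0 ω)) * f (proj (Z 0 ω)) ∂P
  have e2 : 1 / t * I - J = (1 / t) * (I - t * J) := by
    field_simp
  rw [e2, abs_mul, abs_of_pos (by positivity)]
  calc 1 / t * |I - t * J| ≤ 1 / t * (C * t ^ 2) := by gcongr
    _ = C * t := by field_simp

/-- Moments of order two and four of the displacement. -/
theorem exists_displacement_moments_le (hb : Continuous b) (hσ : Continuous σ) (P : Measure Ω)
    [IsProbabilityMeasure P] :
    ∃ C : ℝ, 0 ≤ C ∧ ∀ Z, IsSolution b σ P Z → ∀ t : ℝ, 0 < t → t ≤ 1 →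
      Integrable (fun ω => ‖Z t.toNNReal ω - Z 0 ω‖ ^ 4) P ∧
        ∫ ω, ‖Z t.toNNReal ω - Z 0 ω‖ ^ 4 ∂P ≤ C * t ^ 2 := by
  obtain ⟨B, hB0, hB⟩ := exists_bound_of_continuous hb
  have hA : ∃ A : ℝ, 0 ≤ A ∧ ∀ i x, |diffusionCoeff σ i x| ≤ A := by
    choose A hA0 hA using fun i => exists_bound_of_continuous (continuous_diffusionCoeff hσ i)
    exact ⟨∑ i, A i, Finset.sum_nonneg fun i _ => hA0 i, fun i x => (hA i x).trans
      (Finset.single_le_sum (fun i _ => hA0 i) (Finset.mem_univ i))⟩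
  obtain ⟨A, hA0, hA⟩ := hA
  have hB' : ∀ x i, |b x i| ≤ B := fun x i => (PiLp.norm_apply_le (b x) i).trans (hB x)
  refine ⟨d * (d * ((6 * A + 2 * B) ^ 2 * Real.exp (6 * A + 2 * B) ^ 2)), by positivity,
    fun Z hZ t ht ht1 => ?_⟩
  obtain ⟨h1, h2⟩ := hZ.fourth_moment hb hσ hA hB' ht.le
  refine ⟨h1, h2.trans ?_⟩
  have : Real.exp ((6 * A + 2 * B) * t) ≤ Real.exp (6 * A + 2 * B) :=
    Real.exp_le_exp.2 (mul_le_of_le_one_right (by positivity) ht1)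
  calc _ ≤ d * (d * ((6 * A + 2 * B) ^ 2 * t ^ 2 * Real.exp (6 * A + 2 * B) ^ 2)) := by gcongr
    _ = _ := by ring

theorem exists_displacement_sq_coord_le (hb : Continuous b) (hσ : Continuous σ) (P : Measure Ω)
    [IsProbabilityMeasure P] (i : Fin d) :
    ∃ C : ℝ, 0 ≤ C ∧ ∀ Z, IsSolution b σ P Z → ∀ t : ℝ, 0 < t → t ≤ 1 → ∀ s : ℝ, 0 ≤ s → s ≤ t →
      Integrable (fun ω => (Z s.toNNReal ω i - Z 0 ω i) ^ 2) P ∧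
        ∫ ω, (Z s.toNNReal ω i - Z 0 ω i) ^ 2 ∂P ≤ C * t := by
  obtain ⟨M, hM0, hM⟩ := exists_displacement_moments_le hb hσ P
  refine ⟨1 + M, by positivity, fun Z hZ t ht ht1 s hs hst => ?_⟩
  have m0 := hZ.measurable 0
  have mD : ∀ s : ℝ≥0, Measurable fun ω => Z s ω i - Z 0 ω i := fun s => by
    have := hZ.measurable s
    fun_prop
  have h2 : ∀ s : ℝ, 0 < s → s ≤ 1 → Integrable (fun ω => (Z s.toNNReal ω i - Z 0 ω i) ^ 2) P ∧
      ∫ ω, (Z s.toNNReal ω i - Z 0 ω i) ^ 2 ∂P ≤ (1 + M) * s := by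
    intro s hs hs1
    obtain ⟨i4, b4⟩ := hM Z hZ s hs hs1
    have hle : ∀ ω, (Z s.toNNReal ω i - Z 0 ω i) ^ 4 ≤ ‖Z s.toNNReal ω - Z 0 ω‖ ^ 4 := fun ω => by
      rw [← abs_of_nonneg (by positivity : 0 ≤ (Z s.toNNReal ω i - Z 0 ω i) ^ 4), abs_pow]
      exact pow_le_pow_left₀ (abs_nonneg _) (PiLp.norm_apply_le (Z s.toNNReal ω - Z 0 ω) i) _
    have hi : Integrable (fun ω => (Z s.toNNReal ω i - Z 0 ω i) ^ 4) P := by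
      refine i4.mono' ((mD _).pow_const 4).aestronglyMeasurable (.of_forall fun ω => ?_)
      rw [Real.norm_of_nonneg (by positivity)]
      exact hle ω
    exact integral_sq_le_of_integral_pow_four_le (mD _) hi hs ((integral_mono hi i4 hle).trans b4)
  rcases hs.eq_or_lt with rfl | hs
  · simp only [Real.toNNReal_zero, sub_self]
    refine ⟨by simp, ?_⟩
    simp
    positivity
  · refine ⟨(h2 s hs (hst.trans ht1)).1, (h2 s hs (hst.trans ht1)).2.trans ?_⟩
    gcongr

/-- For the test function sin(tx)/t, the second-order part of the generator carries a factor t and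
the first-order part is close to the drift β. -/
theorem abs_drift_sin_sub_le {p a β x t c A B : ℝ} (ht : 0 ≤ t) (hp : |p| ≤ c) (ha : |a| ≤ A)
    (hβ : |β| ≤ B) :
    |p * (-(t / 2 * a * Real.sin (t * x)) + β * Real.cos (t * x)) - p * β| ≤
      c * (t / 2 * A) + c * B * t ^ 2 / 2 * x ^ 2 := by
  have hc0 : 0 ≤ c := (abs_nonneg _).trans hp
  have hA0 : 0 ≤ A := (abs_nonneg _).trans ha
  have hB0 : 0 ≤ B := (abs_nonneg _).trans hβ
  have q1 : |1 - Real.cos (t * x)| ≤ t ^ 2 * x ^ 2 / 2 := by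
    have := Real.one_sub_sq_div_two_le_cos (x := t * x)
    rw [abs_of_nonneg (by linarith [Real.cos_le_one (t * x)])]
    linarith [mul_pow t x 2]
  have q4 := Real.abs_sin_le_one (t * x)
  calc _ = |p| * |-(t / 2 * a * Real.sin (t * x)) - β * (1 - Real.cos (t * x))| := by
        rw [← abs_mul]
        congr 1
        ring
    _ ≤ c * (t / 2 * A * 1 + B * (t ^ 2 * x ^ 2 / 2)) := by
        refine mul_le_mul hp ((abs_sub _ _).trans (add_le_add ?_ ?_)) (abs_nonneg _) hc0
        · rw [abs_neg, abs_mul, abs_mul, abs_of_nonneg (by positivity : 0 ≤ t / 2)]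
          gcongr
        · rw [abs_mul]
          gcongr
    _ = _ := by ring

theorem abs_mul_sub_sin_div_le {p x t c : ℝ} (ht : 0 < t) (hp : |p| ≤ c) :
    |p * x - (1 / t) * (p * Real.sin (t * x))| ≤ c * (2 * t) * x ^ 2 := by
  have hc0 : 0 ≤ c := (abs_nonneg _).trans hp
  calc _ = |p| * ((1 / t) * |Real.sin (t * x) - t * x|) := by
        rw [← abs_of_pos (by positivity : 0 < 1 / t), ← abs_mul, ← abs_mul,
          abs_of_pos (by positivity : 0 < 1 / t), ← abs_neg]
        congr 1
        field_simp
        ring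
    _ ≤ c * ((1 / t) * (2 * (t * x) ^ 2)) := by
        gcongr
        exact abs_sin_sub_self_le _
    _ = _ := by
        field_simp

/-- The unbounded displacement x is replaced by sin(tx)/t, whose frequency is the time step itself.
The replacement costs O(t x²), of mean O(t²). Dynkin's formula for the sine has an integrand within
O(t) of ψ b at time 0, so its integral over [0, t] is t E[ψ b] + O(t²). No passage to the limit is
needed. -/
theorem exists_displacement_mean_coord_le (hb : IsCk 2 b) (hσ : Continuous σ)
    {ψ : Torus d → ℝ} (hψ : Continuous ψ) (P : Measure Ω) [IsProbabilityMeasure P] (i : Fin d) :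
    ∃ C : ℝ, 0 ≤ C ∧ ∀ Z, IsSolution b σ P Z → ∀ t : ℝ, 0 < t → t ≤ 1 →
      |∫ ω, ψ (proj (Z 0 ω)) * (Z t.toNNReal ω i - Z 0 ω i - t * b (proj (Z 0 ω)) i) ∂P| ≤
        C * t ^ 2 := by
  obtain ⟨M, hM0, hM⟩ := exists_displacement_sq_coord_le hb.continuous hσ P i
  have hbi : IsCk 2 fun x => b x i := hb.coord i
  obtain ⟨C, hC0, hC⟩ := exists_weak_error_le hb.continuous hσ hbi hψ P
  obtain ⟨c, hc0, hc⟩ := exists_bound_of_continuous hψ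
  obtain ⟨B, hB0, hB⟩ := exists_bound_of_continuous hbi.continuous
  have ca := continuous_diffusionCoeff hσ i
  obtain ⟨A, hA0, hA⟩ := exists_bound_of_continuous ca
  have hp : Continuous (proj : Vec d → Torus d) := continuous_proj
  refine ⟨c * (A / 2 + B * (M / 2)) + C + c * (2 * M), by positivity,
    fun Z hZ t ht ht1 => ?_⟩
  have m0 := hZ.measurable 0
  have mD : ∀ s : ℝ≥0, Measurable fun ω => Z s ω i - Z 0 ω i := fun s => by
    have := hZ.measurable s
    fun_prop
  -- Frequency l = t; the phase -π/2 turns the cosine into a sine, which vanishes at zero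
  -- displacement.
  have hsin := hZ.dynkin_cos_displacement hb.continuous hσ i t (-(Real.pi / 2))
    (ψ := fun y => ψ (proj y)) (by fun_prop) (fun y => hc _) ht.le
  have ecos : ∀ x : ℝ, Real.cos (x + -(Real.pi / 2)) = Real.sin x := fun x => by
    rw [← sub_eq_add_neg, Real.cos_sub_pi_div_two]
  have esin : ∀ x : ℝ, Real.sin (x + -(Real.pi / 2)) = -Real.cos x := fun x => by
    rw [← sub_eq_add_neg, Real.sin_sub_pi_div_two]
  simp only [ecos, esin, Real.cos_neg, Real.cos_pi_div_two, sub_zero] at hsin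
  set g : ℝ → ℝ := fun s => ∫ ω, ψ (proj (Z 0 ω)) *
    (-(t / 2 * diffusionCoeff σ i (proj (Z s.toNNReal ω)) *
      Real.sin (t * (Z s.toNNReal ω i - Z 0 ω i))) + b (proj (Z s.toNNReal ω)) i *
      Real.cos (t * (Z s.toNNReal ω i - Z 0 ω i))) ∂P with hg
  have hΦ : Continuous (Function.uncurry fun z y : Vec d => ψ (proj z) *
      (-(t / 2 * diffusionCoeff σ i (proj y) * Real.sin (t * (y i - z i))) + b (proj y) i *
      Real.cos (t * (y i - z i)))) := by
    have := hb.continuous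
    fun_prop
  have hΦb : ∀ z y : Vec d, |ψ (proj z) *
      (-(t / 2 * diffusionCoeff σ i (proj y) * Real.sin (t * (y i - z i))) + b (proj y) i *
      Real.cos (t * (y i - z i)))| ≤ c * (t / 2 * A * 1 + B * 1) := by
    intro z y
    rw [abs_mul]
    refine mul_le_mul (hc _) ((abs_add_le _ _).trans (add_le_add ?_ ?_)) (abs_nonneg _) hc0
    · rw [abs_neg, abs_mul, abs_mul, abs_of_nonneg (by positivity : 0 ≤ t / 2)]
      gcongr
      · exact hA _
      · exact Real.abs_sin_le_one _
    · rw [abs_mul]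
      gcongr
      · exact hB _
      · exact Real.abs_cos_le_one _
  have hgc : Continuous g :=
    hZ.continuous_integral hΦ.measurable (fun z => hΦ.uncurry_left z) hΦb
  have hsin' : ∫ ω, ψ (proj (Z 0 ω)) * Real.sin (t * (Z t.toNNReal ω i - Z 0 ω i)) ∂P =
      t * ∫ s in (0 : ℝ)..t, g s := by
    rw [hsin, ← intervalIntegral.integral_const_mul]
    refine intervalIntegral.integral_congr fun s _ => ?_
    simp only [hg]
    rw [← integral_const_mul]
    refine integral_congr_ae (.of_forall fun ω => ?_)
    ring
  have hψb : Integrable (fun ω => ψ (proj (Z 0 ω)) * b (proj (Z 0 ω)) i) P :=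
    hZ.integrable_mul_torus hψ hbi.continuous 0
  have hgs : ∀ s ∈ Set.Icc 0 t, |g s - ∫ ω, ψ (proj (Z 0 ω)) * b (proj (Z 0 ω)) i ∂P| ≤
      (c * (A / 2 + B * (M / 2)) + C) * t := by
    intro s hs
    have hs2 := hM Z hZ t ht ht1 s hs.1 hs.2
    have hw := hC Z hZ s hs.1
    have hint1 := hZ.integrable_comp hΦ.measurable hΦb s.toNNReal
    have hint2 := hZ.integrable_mul_torus hψ hbi.continuous s.toNNReal
    have h5 : |g s - ∫ ω, ψ (proj (Z 0 ω)) * b (proj (Z s.toNNReal ω)) i ∂P| ≤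
        c * (A / 2 + B * (M / 2)) * t := by
      rw [hg]
      simp only
      rw [← integral_sub hint1 hint2]
      have hb2 : Integrable (fun ω => c * (t / 2 * A) + c * B * t ^ 2 / 2 *
          (Z s.toNNReal ω i - Z 0 ω i) ^ 2) P := (integrable_const _).add (hs2.1.const_mul _)
      have := norm_integral_le_of_norm_le hb2 (f := fun ω => ψ (proj (Z 0 ω)) *
        (-(t / 2 * diffusionCoeff σ i (proj (Z s.toNNReal ω)) *
          Real.sin (t * (Z s.toNNReal ω i - Z 0 ω i))) + b (proj (Z s.toNNReal ω)) i *
          Real.cos (t * (Z s.toNNReal ω i - Z 0 ω i))) -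
          ψ (proj (Z 0 ω)) * b (proj (Z s.toNNReal ω)) i) (.of_forall fun ω =>
          abs_drift_sin_sub_le ht.le (hc _) (hA _) (hB _))
      refine this.trans ?_
      rw [integral_add (integrable_const _) (hs2.1.const_mul _), integral_const,
        probReal_univ, one_smul, integral_const_mul]
      have ht2 : t ^ 2 ≤ 1 := pow_le_one₀ ht.le ht1
      calc _ ≤ c * (t / 2 * A) + c * B * 1 / 2 * (M * t) := by
            gcongr
            exact hs2.2
        _ = _ := by ring
    have h6 := abs_sub_le (g s) (∫ ω, ψ (proj (Z 0 ω)) * b (proj (Z s.toNNReal ω)) i ∂P)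
      (∫ ω, ψ (proj (Z 0 ω)) * b (proj (Z 0 ω)) i ∂P)
    have h7 : C * s ≤ C * t := by gcongr; exact hs.2
    linarith
  have hmain := abs_intervalIntegral_sub_le hgc ht.le hgs
  have hsq := hM Z hZ t ht ht1 t ht.le le_rfl
  have hD1 : Integrable (fun ω => Z t.toNNReal ω i - Z 0 ω i) P :=
    ((integrable_const (1 : ℝ)).add hsq.1).mono' (mD _).aestronglyMeasurable
      (.of_forall fun ω => by
        simp only [Real.norm_eq_abs, Pi.add_apply]
        nlinarith [sq_nonneg (|Z t.toNNReal ω i - Z 0 ω i| - 1),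
          sq_abs (Z t.toNNReal ω i - Z 0 ω i)])
  have hψm : AEStronglyMeasurable (fun ω => ψ (proj (Z 0 ω))) P :=
    ((hψ.comp continuous_proj).measurable.comp m0).aestronglyMeasurable
  have hψD : Integrable (fun ω => ψ (proj (Z 0 ω)) * (Z t.toNNReal ω i - Z 0 ω i)) P :=
    hD1.bdd_mul hψm (.of_forall fun ω => hc _)
  have hψs : Integrable (fun ω => ψ (proj (Z 0 ω)) *
      Real.sin (t * (Z t.toNNReal ω i - Z 0 ω i))) P := by
    refine Integrable.bdd_mul (c := c) ?_ hψm (.of_forall fun ω => hc _)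
    exact Integrable.of_bound (C := 1)
      (Real.measurable_sin.comp ((mD t.toNNReal).const_mul t)).aestronglyMeasurable
      (.of_forall fun ω => Real.abs_sin_le_one _)
  have hclose : |(∫ ω, ψ (proj (Z 0 ω)) * (Z t.toNNReal ω i - Z 0 ω i) ∂P) -
      ∫ s in (0 : ℝ)..t, g s| ≤ c * (2 * M) * t ^ 2 := by
    have e1 : ∫ s in (0 : ℝ)..t, g s = ∫ ω, (1 / t) * (ψ (proj (Z 0 ω)) *
        Real.sin (t * (Z t.toNNReal ω i - Z 0 ω i))) ∂P := by
      rw [integral_const_mul, hsin']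
      field_simp
    rw [e1, ← integral_sub hψD (hψs.const_mul _), ← Real.norm_eq_abs]
    refine (norm_integral_le_of_norm_le (hsq.1.const_mul (c * (2 * t)))
      (.of_forall fun ω => abs_mul_sub_sin_div_le ht (hc _))).trans ?_
    · rw [integral_const_mul]
      calc _ ≤ c * (2 * t) * (M * t) := by
            gcongr
            exact hsq.2
        _ = _ := by ring
  have efin : ∫ ω, ψ (proj (Z 0 ω)) * (Z t.toNNReal ω i - Z 0 ω i - t * b (proj (Z 0 ω)) i) ∂P =
      (∫ ω, ψ (proj (Z 0 ω)) * (Z t.toNNReal ω i - Z 0 ω i) ∂P) -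
        t * ∫ ω, ψ (proj (Z 0 ω)) * b (proj (Z 0 ω)) i ∂P := by
    rw [← integral_const_mul, ← integral_sub hψD (hψb.const_mul _)]
    refine integral_congr_ae (.of_forall fun ω => ?_)
    ring
  rw [efin]
  have := abs_sub_le (∫ ω, ψ (proj (Z 0 ω)) * (Z t.toNNReal ω i - Z 0 ω i) ∂P)
    (∫ s in (0 : ℝ)..t, g s) (t * ∫ ω, ψ (proj (Z 0 ω)) * b (proj (Z 0 ω)) i ∂P)
  linarith

end WeakError

end

section

/-! ### Taylor expansions on the torus, plain and symmetrised -/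

section Taylor

variable {d : ℕ} {F : Type*} [NormedAddCommGroup F] [NormedSpace ℝ F]

theorem norm_add_proj_sub_le {f : Torus d → F} (hf : IsCk 1 f) {c : ℝ}
    (hc : ∀ x, ‖torusDeriv f x‖ ≤ c) (x : Torus d) (w : Vec d) :
    ‖f (x + proj w) - f x‖ ≤ c * ‖w‖ := by
  have h := Convex.norm_image_sub_le_of_norm_hasFDerivWithin_le (𝕜 := ℝ)
    (f := fun h : Vec d => f (x + proj h)) (f' := fun h => torusDeriv f (x + proj h))
    (s := Set.univ) (C := c) (x := 0) (y := w)
    (fun h _ => (IsCk.hasFDerivAt (p := 0) hf x h).hasFDerivWithinAt) (fun h _ => hc _)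
    convex_univ trivial trivial
  simpa using h

theorem norm_add_proj_sub_sub_le {f : Torus d → F} (hf : IsCk 2 f) {c : ℝ}
    (hc : ∀ x, ‖torusDeriv (torusDeriv f) x‖ ≤ c) (x : Torus d) (w : Vec d) :
    ‖f (x + proj w) - f x - torusDeriv f x w‖ ≤ c * ‖w‖ ^ 2 := by
  have hc0 : 0 ≤ c := (norm_nonneg _).trans (hc 0)
  have h := Convex.norm_image_sub_le_of_norm_hasFDerivWithin_le' (𝕜 := ℝ)
    (f := fun h : Vec d => f (x + proj h)) (f' := fun h => torusDeriv f (x + proj h))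
    (s := Metric.closedBall 0 ‖w‖) (C := c * ‖w‖) (x := 0) (y := w) (φ := torusDeriv f x)
    (fun h _ => (IsCk.hasFDerivAt (p := 1) hf x h).hasFDerivWithinAt) (fun h hh => by
      refine (norm_add_proj_sub_le (IsCk.torusDeriv (p := 1) hf) hc x h).trans ?_
      gcongr
      simpa using hh) (convex_closedBall _ _) (by simp) (by simp)
  refine le_trans (le_of_eq ?_) (h.trans (le_of_eq ?_))
  · simp
  · simp
    ring

/-- The first-order terms at u and -u cancel. The statement is vector-valued because it is applied
to the second derivative of a function. -/
theorem norm_symm_sub_le {f : Torus d → F} (hf : IsCk 2 f) {c : ℝ}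
    (hc : ∀ x, ‖torusDeriv (torusDeriv f) x‖ ≤ c) (x : Torus d) (u : Vec d) :
    ‖f (x + proj u) + f (x + proj (-u)) - (2 : ℝ) • f x‖ ≤ 2 * c * ‖u‖ ^ 2 := by
  have h1 := norm_add_proj_sub_sub_le hf hc x u
  have h2 := norm_add_proj_sub_sub_le hf hc x (-u)
  rw [norm_neg] at h2
  have e : f (x + proj u) + f (x + proj (-u)) - (2 : ℝ) • f x =
      (f (x + proj u) - f x - torusDeriv f x u) +
        (f (x + proj (-u)) - f x - torusDeriv f x (-u)) := by
    rw [map_neg, two_smul]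
    abel
  rw [e]
  refine (norm_add_le _ _).trans ?_
  linarith

theorem IsCk.hasDerivAt_line {p : ℕ} {f : Torus d → F} (hf : IsCk (p + 1) f) (x : Torus d)
    (u : Vec d) (s t : ℝ) :
    HasDerivAt (fun t : ℝ => f (x + proj ((t * s) • u)))
      (ContTD.torusDeriv f (x + proj ((t * s) • u)) (s • u)) t := by
  have hline : HasDerivAt (fun t : ℝ => (t * s) • u) (s • u) t := by
    simpa using ((hasDerivAt_id t).mul_const s).smul_const u
  have h := (IsCk.hasFDerivAt hf x ((t * s) • u)).comp_hasDerivAt t hline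
  exact h

/-- Symmetrising kills the cubic term, so the remainder is of order four. Along t ↦ tu the remainder
g and its derivative k vanish at 0, and k' is the symmetric second difference of D²f, controlled by
`norm_symm_sub_le`; two mean value inequalities conclude. -/
theorem abs_symm_sub_sub_le {f : Torus d → ℝ} (hf : IsCk 4 f) {c : ℝ}
    (hc : ∀ x, ‖torusDeriv (torusDeriv (torusDeriv (torusDeriv f))) x‖ ≤ c)
    (x : Torus d) (u : Vec d) :
    |f (x + proj u) + f (x + proj (-u)) - 2 * f x - torusDeriv (torusDeriv f) x u u| ≤
      2 * c * ‖u‖ ^ 4 := by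
  have hc0 : 0 ≤ c := (norm_nonneg _).trans (hc 0)
  have hf1 : IsCk 3 (torusDeriv f) := hf.torusDeriv
  have hf2 : IsCk 2 (torusDeriv (torusDeriv f)) := hf1.torusDeriv
  have hg := fun s t : ℝ => IsCk.hasDerivAt_line (p := 3) hf x u s t
  have hk : ∀ s t : ℝ, HasDerivAt (fun t : ℝ => torusDeriv f (x + proj ((t * s) • u)) u)
      (torusDeriv (torusDeriv f) (x + proj ((t * s) • u)) (s • u) u) t := fun s t => by
    have h := (IsCk.hasDerivAt_line (p := 2) hf1 x u s t).clm_apply (hasDerivAt_const t u)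
    exact h.congr_deriv (by simp)
  set Q := torusDeriv (torusDeriv f) x u u with hQ
  set k : ℝ → ℝ := fun t => torusDeriv f (x + proj ((t * 1) • u)) u -
    torusDeriv f (x + proj ((t * (-1)) • u)) u - 2 * t * Q with hkdef
  set g : ℝ → ℝ := fun t => f (x + proj ((t * 1) • u)) + f (x + proj ((t * (-1)) • u)) - 2 * f x -
    t ^ 2 * Q with hgdef
  have hg' : ∀ t, HasDerivAt g (k t) t := by
    intro t
    have h := (((hg 1 t).add (hg (-1) t)).sub_const (2 * f x)).sub
      (((hasDerivAt_id t).pow 2).mul_const Q)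
    refine h.congr_deriv ?_
    simp [hkdef]
    ring
  have hk' : ∀ t, HasDerivAt k ((torusDeriv (torusDeriv f) (x + proj (t • u)) +
      torusDeriv (torusDeriv f) (x + proj (-(t • u))) -
        (2 : ℝ) • torusDeriv (torusDeriv f) x) u u) t := by
    intro t
    have h := ((hk 1 t).sub (hk (-1) t)).sub (((hasDerivAt_id t).const_mul 2).mul_const Q)
    refine h.congr_deriv ?_
    simp [hQ]
  have hkb : ∀ t ∈ Set.Icc (0 : ℝ) 1, |k t| ≤ 2 * c * ‖u‖ ^ 4 := by
    intro t ht
    have h := norm_image_sub_le_of_norm_deriv_le_segment' (f := k) (a := 0) (b := 1)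
      (C := 2 * c * ‖u‖ ^ 4) (fun s _ => (hk' s).hasDerivWithinAt) (fun s hs => by
        have h1 := norm_symm_sub_le hf2 hc x (s • u)
        refine (ContinuousLinearMap.le_opNorm₂ _ _ _).trans ?_
        have h2 : ‖s • u‖ ≤ ‖u‖ := by
          rw [norm_smul, Real.norm_of_nonneg hs.1]
          exact mul_le_of_le_one_left (norm_nonneg _) hs.2.le
        calc _ ≤ 2 * c * ‖s • u‖ ^ 2 * ‖u‖ * ‖u‖ := by gcongr
          _ ≤ 2 * c * ‖u‖ ^ 2 * ‖u‖ * ‖u‖ := by gcongr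
          _ = _ := by ring) t ht
    have h0 : k 0 = 0 := by simp [hkdef]
    rw [h0, sub_zero, sub_zero] at h
    refine h.trans (mul_le_of_le_one_right (by positivity) ht.2)
  have h := norm_image_sub_le_of_norm_deriv_le_segment' (f := g) (a := 0) (b := 1)
      (C := 2 * c * ‖u‖ ^ 4) (fun s _ => (hg' s).hasDerivWithinAt)
      (fun s hs => hkb s ⟨hs.1, hs.2.le⟩) 1 ⟨zero_le_one, le_rfl⟩
  have h0 : g 0 = 0 := by
    simp [hgdef]
    ring
  rw [h0, sub_zero, sub_zero, mul_one] at h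
  simpa [hgdef] using h

/-- Symmetrised second-order expansion, for a deterministic shift `w` and a symmetric one `u`. -/
theorem abs_symm_shift_le {f : Torus d → ℝ} (hf : IsCk 4 f) {c : ℝ}
    (hc2 : ∀ x, ‖torusDeriv (torusDeriv f) x‖ ≤ c)
    (hc3 : ∀ x, ‖torusDeriv (torusDeriv (torusDeriv f)) x‖ ≤ c)
    (hc4 : ∀ x, ‖torusDeriv (torusDeriv (torusDeriv (torusDeriv f))) x‖ ≤ c)
    (x : Torus d) (w u : Vec d) :
    |(f (x + proj (w + u)) + f (x + proj (w - u))) / 2 - f x - torusDeriv f x w -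
      torusDeriv (torusDeriv f) x u u / 2| ≤
      c * (‖u‖ ^ 4 + ‖w‖ ^ 2 + ‖w‖ * ‖u‖ ^ 2) := by
  have hc0 : 0 ≤ c := (norm_nonneg _).trans (hc2 0)
  have hf1 : IsCk 3 (torusDeriv f) := hf.torusDeriv
  have hf2 : IsCk 2 (torusDeriv (torusDeriv f)) := hf1.torusDeriv
  have h1 := abs_symm_sub_sub_le hf hc4 (x + proj w) u
  have h2 := norm_add_proj_sub_sub_le (hf.of_le (by norm_num)) hc2 x w
  have h3 : |torusDeriv (torusDeriv f) (x + proj w) u u - torusDeriv (torusDeriv f) x u u| ≤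
      c * (‖w‖ * ‖u‖ ^ 2) := by
    have := norm_add_proj_sub_le (hf2.of_le (by norm_num)) hc3 x w
    calc _ = ‖(torusDeriv (torusDeriv f) (x + proj w) - torusDeriv (torusDeriv f) x) u u‖ := by
          simp
      _ ≤ ‖torusDeriv (torusDeriv f) (x + proj w) - torusDeriv (torusDeriv f) x‖ * ‖u‖ * ‖u‖ :=
          ContinuousLinearMap.le_opNorm₂ _ _ _
      _ ≤ c * ‖w‖ * ‖u‖ * ‖u‖ := by gcongr
      _ = _ := by ring
  rw [Real.norm_eq_abs] at h2
  rw [proj_add w u, sub_eq_add_neg w u, proj_add w (-u), ← add_assoc, ← add_assoc]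
  have h4 : 0 ≤ c * (‖w‖ * ‖u‖ ^ 2) := by positivity
  rw [abs_le] at *
  constructor <;> nlinarith
end Taylor

/-! ### Moments of the standard Gaussian -/

section Gaussian

variable {n : ℕ}

theorem integrable_norm_pow_stdGaussian (k : ℕ) :
    Integrable (fun z : Vec n => ‖z‖ ^ k) (stdGaussian (Vec n)) := by
  have h : MemLp id k (stdGaussian (Vec n)) := IsGaussian.memLp_id _ _ (by simp)
  exact h.integrable_norm_pow'

theorem integral_neg_stdGaussian (g : Vec n → ℝ) :
    ∫ z, g (-z) ∂(stdGaussian (Vec n)) = ∫ z, g z ∂(stdGaussian (Vec n)) := by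
  have h := stdGaussian_map (LinearIsometryEquiv.neg ℝ (E := Vec n))
  conv_rhs => rw [← h]
  exact ((Homeomorph.neg (Vec n)).measurableEmbedding.integral_map g).symm

theorem integral_coord_mul_stdGaussian (i j : Fin n) :
    ∫ z : Vec n, z i * z j ∂(stdGaussian (Vec n)) = if i = j then 1 else 0 := by
  have h := covarianceBilin_apply_eq_cov (μ := stdGaussian (Vec n)) IsGaussian.memLp_two_id
    (EuclideanSpace.single i (1 : ℝ)) (EuclideanSpace.single j (1 : ℝ))
  rw [covarianceBilin_stdGaussian, covariance] at h
  have h0 : ∀ i : Fin n, ∫ z : Vec n, inner ℝ (EuclideanSpace.single i (1 : ℝ)) z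
      ∂(stdGaussian (Vec n)) = 0 := fun i =>
    integral_strongDual_stdGaussian (innerSL ℝ (EuclideanSpace.single i (1 : ℝ)))
  rw [h0, h0] at h
  rw [innerSL_apply_apply] at h
  simpa [EuclideanSpace.inner_single_left, eq_comm] using h.symm

/-- The identity covariance turns a quadratic form into its trace; this produces the second-order
part of `gen` from an Euler step. -/
theorem integral_bilin_stdGaussian (L : Vec n →L[ℝ] Vec n →L[ℝ] ℝ) :
    ∫ z, L z z ∂(stdGaussian (Vec n)) =
      ∑ j, L (EuclideanSpace.single j 1) (EuclideanSpace.single j 1) := by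
  have e : ∀ z : Vec n, L z z = ∑ i, ∑ j, z i * z j *
      L (EuclideanSpace.single i 1) (EuclideanSpace.single j 1) := by
    intro z
    have hz : z = ∑ i, z i • EuclideanSpace.single i (1 : ℝ) := by
      have := (EuclideanSpace.basisFun (Fin n) ℝ).sum_repr z
      simpa using this.symm
    conv_lhs => rw [hz]
    simp only [map_sum, map_smul, sum_apply, smul_apply, smul_eq_mul]
    rw [Finset.sum_comm]
    simp only [Finset.mul_sum]
    refine Finset.sum_congr rfl fun i _ => Finset.sum_congr rfl fun j _ => ?_
    ring
  have hint : ∀ i j : Fin n, Integrable (fun z : Vec n => z i * z j) (stdGaussian (Vec n)) := by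
    intro i j
    refine (integrable_norm_pow_stdGaussian 2).mono' (by fun_prop) (.of_forall fun z => ?_)
    rw [norm_mul, pow_two]
    gcongr <;> exact PiLp.norm_apply_le z _
  simp only [e]
  rw [integral_finsetSum _ fun i _ => integrable_finsetSum _ fun j _ => (hint i j).mul_const _]
  refine Finset.sum_congr rfl fun i _ => ?_
  rw [integral_finsetSum _ fun j _ => (hint i j).mul_const _]
  simp only [integral_mul_const, integral_coord_mul_stdGaussian]
  simp

end Gaussian

end

/-! ### One step of the Euler-Maruyama scheme -/

section

theorem integral_sub_const_prob {Ω : Type*} [MeasurableSpace Ω] {P : Measure Ω}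
    [IsProbabilityMeasure P] {f : Ω → ℝ} (hf : Integrable f P) (c : ℝ) :
    ∫ ω, (f ω - c) ∂P = (∫ ω, f ω ∂P) - c := by
  rw [integral_sub hf (integrable_const c)]
  simp

theorem integral_add_const_prob {Ω : Type*} [MeasurableSpace Ω] {P : Measure Ω}
    [IsProbabilityMeasure P] {f : Ω → ℝ} (hf : Integrable f P) (c : ℝ) :
    ∫ ω, (f ω + c) ∂P = (∫ ω, f ω ∂P) + c := by
  rw [integral_add hf (integrable_const c)]
  simp

section Simulator

variable {d n : ℕ}

/-- The law is invariant under z ↦ -z, so f may be replaced by its average over ± the noise, to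
which `abs_symm_shift_le` applies. With S of order √t and w of order t, every error term is O(t²).
-/
theorem abs_integral_gaussian_shift_le {f : Torus d → ℝ} (hf : IsCk 4 f) {c : ℝ}
    (hc2 : ∀ x, ‖torusDeriv (torusDeriv f) x‖ ≤ c)
    (hc3 : ∀ x, ‖torusDeriv (torusDeriv (torusDeriv f)) x‖ ≤ c)
    (hc4 : ∀ x, ‖torusDeriv (torusDeriv (torusDeriv (torusDeriv f))) x‖ ≤ c)
    (x : Torus d) (w : Vec d) (S : Vec n →L[ℝ] Vec d) :
    |(∫ z, f (x + proj (w + S z)) ∂(stdGaussian (Vec n))) - f x - torusDeriv f x w -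
      (1 / 2) * ∑ j, torusDeriv (torusDeriv f) x (S (EuclideanSpace.single j 1))
        (S (EuclideanSpace.single j 1))| ≤
      c * (‖S‖ ^ 4 * (∫ z, ‖z‖ ^ 4 ∂(stdGaussian (Vec n))) + ‖w‖ ^ 2 +
        ‖w‖ * (‖S‖ ^ 2 * ∫ z, ‖z‖ ^ 2 ∂(stdGaussian (Vec n)))) := by
  have hc0 : 0 ≤ c := (norm_nonneg _).trans (hc2 0)
  set γ := stdGaussian (Vec n)
  obtain ⟨M, hM0, hM⟩ := exists_bound_of_continuous hf.continuous
  have hp : Continuous (proj : Vec d → Torus d) := continuous_proj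
  have hfc := hf.continuous
  have i1 : Integrable (fun z => f (x + proj (w + S z))) γ :=
    Integrable.of_bound (C := M) (Continuous.aestronglyMeasurable (by fun_prop))
      (.of_forall fun z => hM _)
  have i2 : Integrable (fun z => f (x + proj (w - S z))) γ :=
    Integrable.of_bound (C := M) (Continuous.aestronglyMeasurable (by fun_prop))
      (.of_forall fun z => hM _)
  have hneg : ∫ z, f (x + proj (w - S z)) ∂γ = ∫ z, f (x + proj (w + S z)) ∂γ := by
    rw [← integral_neg_stdGaussian fun z => f (x + proj (w + S z))]
    simp only [map_neg, sub_eq_add_neg, γ]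
  have hquad := integral_bilin_stdGaussian ((torusDeriv (torusDeriv f) x).bilinearComp S S)
  simp only [ContinuousLinearMap.bilinearComp_apply] at hquad
  have i4 := integrable_norm_pow_stdGaussian (n := n) 4
  have i2' := integrable_norm_pow_stdGaussian (n := n) 2
  have iq : Integrable (fun z => torusDeriv (torusDeriv f) x (S z) (S z)) γ := by
    refine (i2'.const_mul (‖torusDeriv (torusDeriv f) x‖ * ‖S‖ ^ 2)).mono'
      (Continuous.aestronglyMeasurable (by fun_prop)) (.of_forall fun z => ?_)
    calc _ ≤ ‖torusDeriv (torusDeriv f) x‖ * ‖S z‖ * ‖S z‖ :=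
          ContinuousLinearMap.le_opNorm₂ _ _ _
      _ ≤ ‖torusDeriv (torusDeriv f) x‖ * (‖S‖ * ‖z‖) * (‖S‖ * ‖z‖) := by
          gcongr <;> exact S.le_opNorm z
      _ = _ := by ring
  have is : Integrable (fun z => (f (x + proj (w + S z)) + f (x + proj (w - S z))) / 2) γ :=
    (i1.add i2).div_const 2
  have is1 : Integrable (fun z => (f (x + proj (w + S z)) + f (x + proj (w - S z))) / 2 - f x) γ :=
    is.sub (integrable_const _)
  have is2 : Integrable (fun z => (f (x + proj (w + S z)) + f (x + proj (w - S z))) / 2 - f x -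
      torusDeriv f x w) γ := is1.sub (integrable_const _)
  have e : (∫ z, f (x + proj (w + S z)) ∂γ) - f x - torusDeriv f x w -
      (1 / 2) * ∑ j, torusDeriv (torusDeriv f) x (S (EuclideanSpace.single j 1))
        (S (EuclideanSpace.single j 1)) =
      ∫ z, ((f (x + proj (w + S z)) + f (x + proj (w - S z))) / 2 - f x - torusDeriv f x w -
        torusDeriv (torusDeriv f) x (S z) (S z) / 2) ∂γ := by
    rw [integral_sub is2 (iq.div_const 2), integral_sub_const_prob is1,
      integral_sub_const_prob is, integral_div, integral_add i1 i2, hneg, integral_div, hquad]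
    ring
  rw [e, ← Real.norm_eq_abs]
  have ib0 : Integrable (fun z : Vec n => ‖S‖ ^ 4 * ‖z‖ ^ 4 + ‖w‖ ^ 2) γ :=
    (i4.const_mul _).add (integrable_const _)
  have ib1 : Integrable (fun z : Vec n => ‖w‖ * (‖S‖ ^ 2 * ‖z‖ ^ 2)) γ :=
    (i2'.const_mul _).const_mul _
  have ib : Integrable (fun z : Vec n => c * (‖S‖ ^ 4 * ‖z‖ ^ 4 + ‖w‖ ^ 2 +
      ‖w‖ * (‖S‖ ^ 2 * ‖z‖ ^ 2))) γ :=
    (ib0.add ib1).const_mul _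
  refine (norm_integral_le_of_norm_le ib (.of_forall fun z => ?_)).trans (le_of_eq ?_)
  · refine (abs_symm_shift_le hf hc2 hc3 hc4 x w (S z)).trans ?_
    have h := S.le_opNorm z
    rw [← mul_pow, ← mul_pow]
    gcongr
  · rw [integral_const_mul, integral_add ib0 ib1, integral_add_const_prob (i4.const_mul _),
      integral_const_mul, integral_const_mul, integral_const_mul]

variable {b : Torus d → Vec d} {σ : Torus d → Vec n →L[ℝ] Vec d}
  {Ω : Type*} [mΩ : MeasurableSpace Ω] {P : Measure Ω} [IsProbabilityMeasure P]

theorem integral_indep_stdGaussian {X : Ω → Torus d} {ξ : Ω → Vec n} (hX : Measurable X)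
    (hξ : Measurable ξ) (hlaw : P.map ξ = stdGaussian (Vec n)) (hind : IndepFun ξ X P)
    {Φ : Torus d → Vec n → ℝ} (hΦ : Measurable (Function.uncurry Φ))
    (hi : Integrable (fun ω => Φ (X ω) (ξ ω)) P) :
    ∫ ω, Φ (X ω) (ξ ω) ∂P = ∫ x, ∫ z, Φ x z ∂(stdGaussian (Vec n)) ∂(P.map X) := by
  have hprod := hind.symm.map_prod_eq_prod_map_map hX.aemeasurable hξ.aemeasurable
  rw [hlaw] at hprod
  have h1 : ∫ ω, Φ (X ω) (ξ ω) ∂P =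
      ∫ y, Function.uncurry Φ y ∂((P.map X).prod (stdGaussian (Vec n))) := by
    rw [← hprod, integral_map (hX.prodMk hξ).aemeasurable hΦ.aestronglyMeasurable]
    rfl
  have : IsProbabilityMeasure (P.map X) := Measure.isProbabilityMeasure_map hX.aemeasurable
  rw [h1, integral_prod]
  · rfl
  · rw [← hprod, integrable_map_measure hΦ.aestronglyMeasurable (hX.prodMk hξ).aemeasurable]
    exact hi

/-- Weak error of the Euler-Maruyama scheme over one step. -/
theorem exists_euler_weak_error_le (hb : Continuous b) (hσ : Continuous σ) {f ψ : Torus d → ℝ}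
    (hf : IsCk 4 f) (hψ : Continuous ψ) (P : Measure Ω) [IsProbabilityMeasure P] :
    ∃ C : ℝ, 0 ≤ C ∧ ∀ (t : ℝ) (X : Ω → Torus d) (ξ : Ω → Vec n), 0 < t → Measurable X →
      Measurable ξ → P.map ξ = stdGaussian (Vec n) → IndepFun ξ X P →
      |∫ ω, ψ (X ω) * (f (X ω + proj (t • b (X ω) + √t • σ (X ω) (ξ ω))) - f (X ω) -
        t * gen b σ f (X ω)) ∂P| ≤ C * t ^ 2 := by
  have hf1 : IsCk 3 (torusDeriv f) := hf.torusDeriv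
  have hf2 : IsCk 2 (torusDeriv (torusDeriv f)) := hf1.torusDeriv
  have hf3 : IsCk 1 (torusDeriv (torusDeriv (torusDeriv f))) := hf2.torusDeriv
  have hf4 : IsCk 0 (torusDeriv (torusDeriv (torusDeriv (torusDeriv f)))) := hf3.torusDeriv
  obtain ⟨c2, hc2, h2⟩ := exists_bound_of_continuous hf2.continuous
  obtain ⟨c3, hc3, h3⟩ := exists_bound_of_continuous hf3.continuous
  obtain ⟨c4, hc4, h4⟩ := exists_bound_of_continuous hf4.continuous
  obtain ⟨B, hB0, hB⟩ := exists_bound_of_continuous hb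
  obtain ⟨S, hS0, hS⟩ := exists_bound_of_continuous hσ
  obtain ⟨cψ, hcψ0, hcψ⟩ := exists_bound_of_continuous hψ
  obtain ⟨cf, hcf0, hcf⟩ := exists_bound_of_continuous hf.continuous
  have hgen : Continuous (gen b σ f) := by
    have c1 := hf1.continuous
    have c2 := hf2.continuous
    unfold gen
    fun_prop
  obtain ⟨cg, hcg0, hcg⟩ := exists_bound_of_continuous hgen
  set m4 := ∫ z, ‖z‖ ^ 4 ∂(stdGaussian (Vec n)) with hm4
  set m2 := ∫ z, ‖z‖ ^ 2 ∂(stdGaussian (Vec n)) with hm2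
  have hm40 : 0 ≤ m4 := integral_nonneg fun z => by positivity
  have hm20 : 0 ≤ m2 := integral_nonneg fun z => by positivity
  set c := c2 + c3 + c4
  refine ⟨cψ * (c * (S ^ 4 * m4 + B ^ 2 + B * (S ^ 2 * m2))), by positivity,
    fun t X ξ ht hX hξ hlaw hind => ?_⟩
  have hp : Continuous (proj : Vec d → Torus d) := continuous_proj
  have hfc := hf.continuous
  have hinner : ∀ x, |(∫ z, f (x + proj (t • b x + √t • σ x z)) ∂(stdGaussian (Vec n))) - f x -
      t * gen b σ f x| ≤ c * (S ^ 4 * m4 + B ^ 2 + B * (S ^ 2 * m2)) * t ^ 2 := by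
    intro x
    have h := abs_integral_gaussian_shift_le (c := c) hf
      (fun x => (h2 x).trans (by simp only [c]; linarith))
      (fun x => (h3 x).trans (by simp only [c]; linarith))
      (fun x => (h4 x).trans (by simp only [c]; linarith)) x (t • b x) (√t • σ x)
    have hsq : √t * √t = t := Real.mul_self_sqrt ht.le
    -- The two factors √t recombine into t, so the expansion reproduces t · gen f exactly.
    have e1 : torusDeriv f x (t • b x) + (1 / 2) * ∑ j, torusDeriv (torusDeriv f) x
        ((√t • σ x) (EuclideanSpace.single j 1)) ((√t • σ x) (EuclideanSpace.single j 1)) =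
        t * gen b σ f x := by
      simp only [smul_apply, map_smul, smul_eq_mul, ← mul_assoc, hsq, gen]
      rw [← Finset.mul_sum]
      ring
    have n1 : ‖t • b x‖ ≤ t * B := by
      rw [norm_smul, Real.norm_of_nonneg ht.le]
      gcongr
      exact hB x
    have n2 : ‖√t • σ x‖ ^ 2 ≤ t * S ^ 2 := by
      rw [norm_smul, mul_pow, Real.norm_of_nonneg (Real.sqrt_nonneg t), Real.sq_sqrt ht.le]
      gcongr
      exact hS x
    have n3 : ‖√t • σ x‖ ^ 4 ≤ (t * S ^ 2) ^ 2 := by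
      rw [show ‖√t • σ x‖ ^ 4 = (‖√t • σ x‖ ^ 2) ^ 2 by ring]
      gcongr
    rw [sub_sub, e1] at h
    refine h.trans ?_
    rw [← hm4, ← hm2]
    have : 0 ≤ c := by positivity
    calc _ ≤ c * ((t * S ^ 2) ^ 2 * m4 + (t * B) ^ 2 + t * B * (t * S ^ 2 * m2)) := by gcongr
      _ = _ := by ring
  set Φ : Torus d → Vec n → ℝ := fun x z =>
    ψ x * (f (x + proj (t • b x + √t • σ x z)) - f x - t * gen b σ f x) with hΦ
  have hΦm : Measurable (Function.uncurry Φ) := by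
    refine Continuous.measurable ?_
    simp only [hΦ, Function.uncurry_def]
    fun_prop
  have hi : Integrable (fun ω => Φ (X ω) (ξ ω)) P := by
    refine Integrable.of_bound (C := cψ * (cf + cf + t * cg))
      (hΦm.comp (hX.prodMk hξ)).aestronglyMeasurable (.of_forall fun ω => ?_)
    simp only [hΦ]
    rw [norm_mul]
    gcongr
    · exact hcψ _
    · refine (norm_sub_le _ _).trans (add_le_add ((norm_sub_le _ _).trans
        (add_le_add (hcf _) (hcf _))) ?_)
      rw [norm_mul, Real.norm_of_nonneg ht.le]
      gcongr
      exact hcg _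
  have hmain := integral_indep_stdGaussian hX hξ hlaw hind hΦm hi
  simp only [hΦ] at hmain
  rw [hmain]
  have : IsProbabilityMeasure (P.map X) := Measure.isProbabilityMeasure_map hX.aemeasurable
  refine abs_integral_le_of_abs_le (.of_forall fun x => ?_)
  have hfi : Integrable (fun z => f (x + proj (t • b x + √t • σ x z))) (stdGaussian (Vec n)) :=
    Integrable.of_bound (C := cf) (Continuous.aestronglyMeasurable (by fun_prop))
      (.of_forall fun z => hcf _)
  have hfi' : Integrable (fun z => f (x + proj (t • b x + √t • σ x z)) - f x)
      (stdGaussian (Vec n)) := hfi.sub (integrable_const _)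
  rw [integral_const_mul, integral_sub_const_prob hfi', integral_sub_const_prob hfi, abs_mul]
  rw [mul_assoc]
  exact mul_le_mul (hcψ x) (hinner x) (abs_nonneg _) hcψ0

/-- Given X, this is a linear functional of a centred Gaussian. The stochastic correction is
therefore exactly unbiased for a simulator. -/
theorem integral_mul_gaussian_increment_eq_zero (hσ : Continuous σ)
    {G : Torus d → Vec d →L[ℝ] ℝ} (hG : Continuous G) {X : Ω → Torus d} {ξ : Ω → Vec n}
    (hX : Measurable X) (hξ : Measurable ξ) (hlaw : P.map ξ = stdGaussian (Vec n))
    (hind : IndepFun ξ X P) :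
    ∫ ω, G (X ω) (σ (X ω) (ξ ω)) ∂P = 0 := by
  have hc : Continuous (Function.uncurry fun (x : Torus d) (z : Vec n) => G x (σ x z)) := by
    simp only [Function.uncurry_def]
    fun_prop
  obtain ⟨c, hc0, hcG⟩ := exists_bound_of_continuous hG
  obtain ⟨S, hS0, hS⟩ := exists_bound_of_continuous hσ
  have hξi : Integrable (fun ω => ‖ξ ω‖) P := by
    have h := integrable_norm_pow_stdGaussian (n := n) 1
    rw [← hlaw, integrable_map_measure (by fun_prop) hξ.aemeasurable] at h
    simpa [Function.comp_def] using h
  have hi : Integrable (fun ω => G (X ω) (σ (X ω) (ξ ω))) P := by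
    refine (hξi.const_mul (c * S)).mono'
      (hc.measurable.comp (hX.prodMk hξ)).aestronglyMeasurable (.of_forall fun ω => ?_)
    calc _ ≤ ‖G (X ω)‖ * ‖σ (X ω) (ξ ω)‖ := ContinuousLinearMap.le_opNorm _ _
      _ ≤ ‖G (X ω)‖ * (‖σ (X ω)‖ * ‖ξ ω‖) := by
          gcongr
          exact ContinuousLinearMap.le_opNorm _ _
      _ ≤ c * (S * ‖ξ ω‖) := by
          gcongr
          · exact hcG _
          · exact hS _
      _ = _ := by ring
  rw [integral_indep_stdGaussian (Φ := fun x z => G x (σ x z)) hX hξ hlaw hind hc.measurable hi]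
  have h0 : ∀ x, ∫ z, G x (σ x z) ∂(stdGaussian (Vec n)) = 0 := fun x =>
    integral_strongDual_stdGaussian ((G x).comp (σ x))
  simp [h0]

theorem exists_euler_moment_le (hb : Continuous b) (hσ : Continuous σ) (P : Measure Ω)
    [IsProbabilityMeasure P] :
    ∃ C : ℝ, 0 ≤ C ∧ ∀ (t : ℝ) (X : Ω → Torus d) (ξ : Ω → Vec n), 0 < t → t ≤ 1 →
      Measurable X → Measurable ξ → P.map ξ = stdGaussian (Vec n) →
      Integrable (fun ω => ‖t • b (X ω) + √t • σ (X ω) (ξ ω)‖ ^ 4) P ∧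
      ∫ ω, ‖t • b (X ω) + √t • σ (X ω) (ξ ω)‖ ^ 4 ∂P ≤ C * t ^ 2 := by
  obtain ⟨B, hB0, hB⟩ := exists_bound_of_continuous hb
  obtain ⟨S, hS0, hS⟩ := exists_bound_of_continuous hσ
  have hm40 : 0 ≤ ∫ z, ‖z‖ ^ 4 ∂(stdGaussian (Vec n)) := integral_nonneg fun z => by positivity
  refine ⟨8 * (B ^ 4 + S ^ 4 * ∫ z, ‖z‖ ^ 4 ∂(stdGaussian (Vec n))), by positivity,
    fun t X ξ ht ht1 hX hξ hlaw => ?_⟩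
  have h4 := integrable_norm_pow_stdGaussian (n := n) 4
  have e4 : ∫ ω, ‖ξ ω‖ ^ 4 ∂P = ∫ z, ‖z‖ ^ 4 ∂(stdGaussian (Vec n)) := by
    rw [← hlaw, integral_map hξ.aemeasurable (by fun_prop)]
  rw [← hlaw, integrable_map_measure (by fun_prop) hξ.aemeasurable] at h4
  have hξi : Integrable (fun ω => ‖ξ ω‖ ^ 4) P := h4
  have hle : ∀ ω, ‖t • b (X ω) + √t • σ (X ω) (ξ ω)‖ ^ 4 ≤
      8 * (B ^ 4 * t ^ 2 + S ^ 4 * t ^ 2 * ‖ξ ω‖ ^ 4) := by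
    intro ω
    have n1 : ‖t • b (X ω)‖ ≤ t * B := by
      rw [norm_smul, Real.norm_of_nonneg ht.le]
      gcongr
      exact hB _
    have n2 : ‖√t • σ (X ω) (ξ ω)‖ ≤ √t * (S * ‖ξ ω‖) := by
      rw [norm_smul, Real.norm_of_nonneg (Real.sqrt_nonneg t)]
      gcongr
      refine (ContinuousLinearMap.le_opNorm _ _).trans ?_
      gcongr
      exact hS _
    have hs4 : √t ^ 4 = t ^ 2 := by
      rw [show √t ^ 4 = (√t ^ 2) ^ 2 by ring, Real.sq_sqrt ht.le]
    have ht4 : t ^ 4 ≤ t ^ 2 := pow_le_pow_of_le_one ht.le ht1 (by norm_num)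
    calc _ ≤ (t * B + √t * (S * ‖ξ ω‖)) ^ 4 := by
          gcongr
          exact (norm_add_le _ _).trans (add_le_add n1 n2)
      _ ≤ 2 ^ (4 - 1) * ((t * B) ^ 4 + (√t * (S * ‖ξ ω‖)) ^ 4) :=
          add_pow_le (by positivity) (by positivity) 4
      _ = 8 * (B ^ 4 * t ^ 4 + S ^ 4 * √t ^ 4 * ‖ξ ω‖ ^ 4) := by ring
      _ ≤ _ := by
          rw [hs4]
          gcongr
  have hib : Integrable (fun ω => 8 * (B ^ 4 * t ^ 2 + S ^ 4 * t ^ 2 * ‖ξ ω‖ ^ 4)) P :=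
    ((integrable_const _).add (hξi.const_mul _)).const_mul _
  have hint : Integrable (fun ω => ‖t • b (X ω) + √t • σ (X ω) (ξ ω)‖ ^ 4) P := by
    refine hib.mono' ?_ (.of_forall fun ω => ?_)
    · have hc : Continuous fun y : Torus d × Vec n => ‖t • b y.1 + √t • σ y.1 y.2‖ ^ 4 := by
        fun_prop
      exact (hc.measurable.comp (hX.prodMk hξ)).aestronglyMeasurable
    · rw [Real.norm_of_nonneg (by positivity)]
      exact hle ω
  refine ⟨hint, (integral_mono hint hib hle).trans (le_of_eq ?_)⟩
  rw [integral_const_mul, integral_add (integrable_const _) (hξi.const_mul _), integral_const,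
    probReal_univ, one_smul, integral_const_mul, e4]
  ring

end Simulator

end

/-! ### Consistency of both kinds of observations -/

section

variable {d n q : ℕ} {b : Torus d → Vec d} {σ : Torus d → Vec n →L[ℝ] Vec d}
  {Ω : Type*} [mΩ : MeasurableSpace Ω] {P : Measure Ω}

/-- First-order consistency of an observation `(X, D, R)` with time step `Δ`, for the features `φ`,
with constant `C`. -/
structure Consistent (b : Torus d → Vec d) (σ : Torus d → Vec n →L[ℝ] Vec d) (r : Torus d → ℝ)
    (φ : Torus d → Vec q) (P : Measure Ω) (Δ : ℝ) (X : Ω → Torus d) (D : Ω → Vec d) (R : Ω → ℝ)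
    (C : ℝ) : Prop where
  nonneg : 0 ≤ C
  abs_reward_le : ∀ᵐ ω ∂P, |R ω| ≤ C
  integrable_displacement : Integrable (fun ω => ‖D ω‖ ^ 4) P
  displacement_le : ∫ ω, ‖D ω‖ ^ 4 ∂P ≤ C * Δ ^ 2
  reward_le : ∀ i, |∫ ω, φ (X ω) i * (R ω - r (X ω)) ∂P| ≤ C * Δ
  weak_le : ∀ i j, |∫ ω, φ (X ω) i * (φ (X ω + proj (D ω)) j - φ (X ω) j -
    Δ * gen b σ (fun y => φ y j) (X ω)) ∂P| ≤ C * Δ ^ 2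
  drift_le : ∀ i j, |∫ ω, φ (X ω) i * torusDeriv (fun y => φ y j) (X ω) (D ω - Δ • b (X ω)) ∂P| ≤
    C * Δ ^ 2

theorem Consistent.mono {r : Torus d → ℝ} {φ : Torus d → Vec q} {Δ : ℝ} {X : Ω → Torus d}
    {D : Ω → Vec d} {R : Ω → ℝ} {C C' : ℝ} (h : Consistent b σ r φ P Δ X D R C) (hΔ : 0 ≤ Δ)
    (hC : C ≤ C') : Consistent b σ r φ P Δ X D R C' where
  nonneg := h.nonneg.trans hC
  abs_reward_le := h.abs_reward_le.mono fun _ hω => hω.trans hC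
  integrable_displacement := h.integrable_displacement
  displacement_le := h.displacement_le.trans (by gcongr)
  reward_le i := (h.reward_le i).trans (by gcongr)
  weak_le i j := (h.weak_le i j).trans (by gcongr)
  drift_le i j := (h.drift_le i j).trans (by gcongr)

/-- For a simulator the reward and drift biases vanish; only the displacement moment and the Euler
weak error contribute to the constant. -/
theorem exists_consistent_of_isSimObs [IsProbabilityMeasure P] (hb : Continuous b)
    (hσ : Continuous σ) {r : Torus d → ℝ} (hr : Continuous r) {φ : Torus d → Vec q}
    (hφ : IsCk 4 φ) :
    ∃ C : ℝ, ∀ (Δ : ℝ) (X : Ω → Torus d) (D : Ω → Vec d) (R : Ω → ℝ), 0 < Δ → Δ ≤ 1 →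
      Measurable X → IsSimObs b σ r P Δ X D R → Consistent b σ r φ P Δ X D R C := by
  have hφc := hφ.continuous
  obtain ⟨Cr, hCr0, hCr⟩ := exists_bound_of_continuous hr
  obtain ⟨Cm, hCm0, hCm⟩ := exists_euler_moment_le hb hσ P
  choose Cw hCw0 hCw using fun i j : Fin q =>
    exists_euler_weak_error_le (ψ := fun x => φ x i) hb hσ (hφ.coord j) (by fun_prop) P
  have hCw1 : ∀ i j, Cw i j ≤ ∑ i, ∑ j, Cw i j := fun i j =>
    (Finset.single_le_sum (fun j _ => hCw0 i j) (Finset.mem_univ j)).trans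
      (Finset.single_le_sum (f := fun i => ∑ j, Cw i j)
        (fun i _ => Finset.sum_nonneg fun j _ => hCw0 i j) (Finset.mem_univ i))
  have hCs : 0 ≤ ∑ i, ∑ j, Cw i j :=
    Finset.sum_nonneg fun i _ => Finset.sum_nonneg fun j _ => hCw0 i j
  refine ⟨Cr + Cm + ∑ i, ∑ j, Cw i j, fun Δ X D R hΔ hΔ1 hX hobs => ?_⟩
  obtain ⟨ξ, hξ, hlaw, hind, hae⟩ := hobs
  obtain ⟨m1, m2⟩ := hCm Δ X ξ hΔ hΔ1 hX hξ hlaw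
  have hD : D =ᵐ[P] fun ω => Δ • b (X ω) + √Δ • σ (X ω) (ξ ω) := hae.mono fun _ h => h.1
  have hR : R =ᵐ[P] fun ω => r (X ω) := hae.mono fun _ h => h.2
  have hD4 : (fun ω => ‖D ω‖ ^ 4) =ᵐ[P]
      fun ω => ‖Δ • b (X ω) + √Δ • σ (X ω) (ξ ω)‖ ^ 4 := hD.mono fun ω h => by simp only [h]
  constructor
  · positivity
  · filter_upwards [hR] with ω h
    rw [h]
    exact (hCr _).trans (by linarith)
  · exact m1.congr hD4.symm
  · rw [integral_congr_ae hD4]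
    refine m2.trans ?_
    gcongr
    linarith
  · intro i
    have : (fun ω => φ (X ω) i * (R ω - r (X ω))) =ᵐ[P] fun _ => 0 := hR.mono fun ω h => by
      simp only [h, sub_self, mul_zero]
    rw [integral_congr_ae this]
    simp
    positivity
  · intro i j
    have : (fun ω => φ (X ω) i * (φ (X ω + proj (D ω)) j - φ (X ω) j -
        Δ * gen b σ (fun y => φ y j) (X ω))) =ᵐ[P] fun ω => φ (X ω) i *
        (φ (X ω + proj (Δ • b (X ω) + √Δ • σ (X ω) (ξ ω))) j - φ (X ω) j -
        Δ * gen b σ (fun y => φ y j) (X ω)) := hD.mono fun ω h => by simp only [h]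
    rw [integral_congr_ae this]
    refine (hCw i j Δ X ξ hΔ hX hξ hlaw hind).trans ?_
    gcongr
    exact (hCw1 i j).trans (by linarith)
  · intro i j
    have hGc : Continuous (torusDeriv fun y => φ y j) :=
      (IsCk.torusDeriv (p := 3) (hφ.coord j)).continuous
    have hG : Continuous fun x => φ x i • torusDeriv (fun y => φ y j) x := by fun_prop
    have h0 := integral_mul_gaussian_increment_eq_zero hσ hG hX hξ hlaw hind
    have : (fun ω => φ (X ω) i * torusDeriv (fun y => φ y j) (X ω) (D ω - Δ • b (X ω))) =ᵐ[P]
        fun ω => √Δ * (φ (X ω) i • torusDeriv (fun y => φ y j) (X ω)) (σ (X ω) (ξ ω)) :=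
      hD.mono fun ω h => by
        simp only [h, add_sub_cancel_left, map_smul, smul_apply, smul_eq_mul]
        ring
    rw [integral_congr_ae this, integral_const_mul, h0]
    simp
    positivity

/-- Coordinate by coordinate: each G(·)(eᵢ) serves as the weight ψ of
`exists_displacement_mean_coord_le`. -/
theorem exists_displacement_mean_le (hb : IsCk 2 b) (hσ : Continuous σ)
    {G : Torus d → Vec d →L[ℝ] ℝ} (hG : Continuous G) (P : Measure Ω) [IsProbabilityMeasure P] :
    ∃ C : ℝ, 0 ≤ C ∧ ∀ Z, IsSolution b σ P Z → ∀ t : ℝ, 0 < t → t ≤ 1 →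
      |∫ ω, G (proj (Z 0 ω)) (Z t.toNNReal ω - Z 0 ω - t • b (proj (Z 0 ω))) ∂P| ≤ C * t ^ 2 := by
  have hGi : ∀ i : Fin d, Continuous fun x => G x (EuclideanSpace.single i 1) := fun i => by
    fun_prop
  choose C hC0 hC using fun i : Fin d => exists_displacement_mean_coord_le hb hσ (hGi i) P i
  choose M hM0 hM using fun i : Fin d =>
    exists_displacement_sq_coord_le (σ := σ) hb.continuous hσ P i
  refine ⟨∑ i, C i, Finset.sum_nonneg fun i _ => hC0 i, fun Z hZ t ht ht1 => ?_⟩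
  have e : ∀ ω, G (proj (Z 0 ω)) (Z t.toNNReal ω - Z 0 ω - t • b (proj (Z 0 ω))) =
      ∑ i, G (proj (Z 0 ω)) (EuclideanSpace.single i 1) *
        (Z t.toNNReal ω i - Z 0 ω i - t * b (proj (Z 0 ω)) i) := by
    intro ω
    set y := Z t.toNNReal ω - Z 0 ω - t • b (proj (Z 0 ω)) with hy
    have hz : y = ∑ i, y i • EuclideanSpace.single i (1 : ℝ) := by
      have := (EuclideanSpace.basisFun (Fin d) ℝ).sum_repr y
      simpa using this.symm
    conv_lhs => rw [hz]
    simp only [map_sum, map_smul, smul_eq_mul]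
    refine Finset.sum_congr rfl fun i _ => ?_
    rw [mul_comm]
    simp [hy]
  have hint : ∀ i, Integrable (fun ω => G (proj (Z 0 ω)) (EuclideanSpace.single i 1) *
        (Z t.toNNReal ω i - Z 0 ω i - t * b (proj (Z 0 ω)) i)) P := by
    intro i
    obtain ⟨c, hc0, hc⟩ := exists_bound_of_continuous (hGi i)
    have m0 := hZ.measurable 0
    have mt := hZ.measurable t.toNNReal
    have mp : Measurable fun ω => proj (Z 0 ω) := continuous_proj.measurable.comp m0
    have hsq := (hM i Z hZ t ht ht1 t ht.le le_rfl).1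
    have hD1 : Integrable (fun ω => Z t.toNNReal ω i - Z 0 ω i) P :=
      ((integrable_const (1 : ℝ)).add hsq).mono'
        (Measurable.aestronglyMeasurable (by fun_prop)) (.of_forall fun ω => by
        simp only [Real.norm_eq_abs, Pi.add_apply]
        nlinarith [sq_nonneg (|Z t.toNNReal ω i - Z 0 ω i| - 1),
          sq_abs (Z t.toNNReal ω i - Z 0 ω i)])
    have hb1 : Integrable (fun ω => t * b (proj (Z 0 ω)) i) P := by
      have := hZ.integrable_mul_torus (continuous_const (y := t)) (hb.coord i).continuous 0
      simpa using this
    exact (hD1.sub hb1).bdd_mul ((hGi i).measurable.comp mp).aestronglyMeasurable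
      (.of_forall fun ω => hc _)
  simp only [e]
  rw [integral_finsetSum _ fun i _ => hint i, Finset.sum_mul]
  refine (Finset.abs_sum_le_sum_abs _ _).trans (Finset.sum_le_sum fun i _ => ?_)
  exact hC i Z hZ t ht ht1

/-- The five summands of the constant bound the reward, the fourth moment, the averaged reward, the
weak error and the drift. The observation agrees with the solution almost surely, so each quantity
is first transferred to Z. -/
theorem exists_consistent_of_isRealObs [IsProbabilityMeasure P] (hb : IsCk 2 b)
    (hσ : IsCk 2 σ) {r : Torus d → ℝ} (hr : IsCk 2 r) {φ : Torus d → Vec q}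
    (hφ : IsCk 4 φ) :
    ∃ C : ℝ, ∀ (Δ : ℝ) (X : Ω → Torus d) (D : Ω → Vec d) (R : Ω → ℝ), 0 < Δ → Δ ≤ 1 →
      IsRealObs b σ r P Δ X D R → Consistent b σ r φ P Δ X D R C := by
  have hφc := hφ.continuous
  have hφi : ∀ i, Continuous fun x => φ x i := fun i => by fun_prop
  obtain ⟨Cr, hCr0, hCr⟩ := exists_bound_of_continuous hr.continuous
  obtain ⟨Cm, hCm0, hCm⟩ := exists_displacement_moments_le hb.continuous hσ.continuous P
  choose Ca hCa0 hCa using fun i : Fin q =>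
    exists_weak_error_average_le hb.continuous hσ.continuous hr (hφi i) P
  choose Cw hCw0 hCw using fun i j : Fin q =>
    exists_weak_error_gen_le (f := fun y => φ y j) hb hσ (hφ.coord j) (hφi i) P
  have hGc : ∀ j, Continuous (torusDeriv fun y => φ y j) := fun j =>
    (IsCk.torusDeriv (p := 3) (hφ.coord j)).continuous
  have hG : ∀ i j, Continuous fun x => φ x i • torusDeriv (fun y => φ y j) x := fun i j =>
    (hφi i).smul (hGc j)
  choose Cd hCd0 hCd using fun i j : Fin q =>
    exists_displacement_mean_le hb hσ.continuous (hG i j) P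
  have hle : ∀ (K : Fin q → Fin q → ℝ), (∀ i j, 0 ≤ K i j) → ∀ i j, K i j ≤ ∑ i, ∑ j, K i j :=
    fun K hK i j =>
    (Finset.single_le_sum (fun j _ => hK i j) (Finset.mem_univ j)).trans
      (Finset.single_le_sum (f := fun i => ∑ j, K i j)
        (fun i _ => Finset.sum_nonneg fun j _ => hK i j) (Finset.mem_univ i))
  have hs1 : 0 ≤ ∑ i, ∑ j, Cw i j :=
    Finset.sum_nonneg fun i _ => Finset.sum_nonneg fun j _ => hCw0 i j
  have hs2 : 0 ≤ ∑ i, ∑ j, Cd i j :=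
    Finset.sum_nonneg fun i _ => Finset.sum_nonneg fun j _ => hCd0 i j
  have hs3 : 0 ≤ ∑ i, Ca i := Finset.sum_nonneg fun i _ => hCa0 i
  refine ⟨Cr + Cm + ∑ i, Ca i + ∑ i, ∑ j, Cw i j + ∑ i, ∑ j, Cd i j,
    fun Δ X D R hΔ hΔ1 hobs => ?_⟩
  obtain ⟨Z, hZ, hae⟩ := hobs
  obtain ⟨m1, m2⟩ := hCm Z hZ Δ hΔ hΔ1
  have hX : X =ᵐ[P] fun ω => proj (Z 0 ω) := hae.mono fun _ h => h.1
  have hD : D =ᵐ[P] fun ω => Z Δ.toNNReal ω - Z 0 ω := hae.mono fun _ h => h.2.1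
  have hR : R =ᵐ[P] fun ω => (1 / Δ) * ∫ s in (0 : ℝ)..Δ, r (proj (Z s.toNNReal ω)) :=
    hae.mono fun _ h => h.2.2
  have hD4 : (fun ω => ‖D ω‖ ^ 4) =ᵐ[P] fun ω => ‖Z Δ.toNNReal ω - Z 0 ω‖ ^ 4 :=
    hD.mono fun ω h => by simp only [h]
  constructor
  · positivity
  · filter_upwards [hR] with ω h
    have h1 := intervalIntegral.norm_integral_le_of_norm_le_const (a := 0) (b := Δ) (C := Cr)
      (f := fun s : ℝ => r (proj (Z s.toNNReal ω))) fun s _ => hCr _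
    rw [sub_zero, abs_of_pos hΔ, Real.norm_eq_abs] at h1
    rw [h, abs_mul, abs_of_pos (by positivity)]
    calc _ ≤ 1 / Δ * (Cr * Δ) := by gcongr
      _ = Cr := by field_simp
      _ ≤ _ := by linarith
  · exact m1.congr hD4.symm
  · rw [integral_congr_ae hD4]
    refine m2.trans ?_
    gcongr
    linarith
  · intro i
    have : (fun ω => φ (X ω) i * (R ω - r (X ω))) =ᵐ[P] fun ω => φ (proj (Z 0 ω)) i *
        ((1 / Δ) * (∫ s in (0 : ℝ)..Δ, r (proj (Z s.toNNReal ω))) - r (proj (Z 0 ω))) := by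
      filter_upwards [hX, hR] with ω h1 h2
      rw [h1, h2]
    rw [integral_congr_ae this]
    refine (hCa i Z hZ Δ hΔ).trans ?_
    gcongr
    have := Finset.single_le_sum (fun i _ => hCa0 i) (Finset.mem_univ i)
    linarith
  · intro i j
    have hgen : Continuous (gen b σ fun y => φ y j) :=
      (IsCk.gen (p := 2) (hφ.coord j) hb hσ).continuous
    have : (fun ω => φ (X ω) i * (φ (X ω + proj (D ω)) j - φ (X ω) j -
        Δ * gen b σ (fun y => φ y j) (X ω))) =ᵐ[P] fun ω =>
        φ (proj (Z 0 ω)) i * (φ (proj (Z Δ.toNNReal ω)) j - φ (proj (Z 0 ω)) j) -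
        Δ * (φ (proj (Z 0 ω)) i * gen b σ (fun y => φ y j) (proj (Z 0 ω))) := by
      filter_upwards [hX, hD] with ω h1 h2
      rw [h1, h2, ← proj_add, add_sub_cancel]
      ring
    have i1 : Integrable (fun ω => φ (proj (Z 0 ω)) i *
        (φ (proj (Z Δ.toNNReal ω)) j - φ (proj (Z 0 ω)) j)) P := by
      have := (hZ.integrable_mul_torus (hφi i) (hφi j) Δ.toNNReal).sub
        (hZ.integrable_mul_torus (hφi i) (hφi j) 0)
      refine this.congr (.of_forall fun ω => ?_)
      simp only [Pi.sub_apply]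
      ring
    rw [integral_congr_ae this, integral_sub i1
      ((hZ.integrable_mul_torus (hφi i) hgen 0).const_mul _), integral_const_mul]
    refine (hCw i j Z hZ Δ hΔ.le).trans ?_
    gcongr
    have := hle Cw hCw0 i j
    linarith
  · intro i j
    have : (fun ω => φ (X ω) i * torusDeriv (fun y => φ y j) (X ω) (D ω - Δ • b (X ω))) =ᵐ[P]
        fun ω => (φ (proj (Z 0 ω)) i • torusDeriv (fun y => φ y j) (proj (Z 0 ω)))
          (Z Δ.toNNReal ω - Z 0 ω - Δ • b (proj (Z 0 ω))) := by
      filter_upwards [hX, hD] with ω h1 h2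
      rw [h1, h2]
      rfl
    rw [integral_congr_ae this]
    refine (hCd i j Z hZ Δ hΔ hΔ1).trans ?_
    gcongr
    have := hle Cd hCd0 i j
    linarith

end

/-! ### Temporal differences: bias and size -/

section

variable {d n q : ℕ}

/-- The vector `u` with `tdError = ⟨θ, u⟩ - R`. -/
def tdVec (ρ : ℝ) (φ : Torus d → Vec q) (Δ : ℝ) (X : Torus d) (D : Vec d) : Vec q :=
  (1 / Δ) • (φ X - Real.exp (-ρ * Δ) • φ (X + proj D))

/-- The vector `u` with `stochTdError = ⟨θ, u⟩ - R`. -/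
def stochTdVec (ρ : ℝ) (b : Torus d → Vec d) (φ : Torus d → Vec q) (Δ : ℝ) (X : Torus d)
    (D : Vec d) : Vec q :=
  tdVec ρ φ Δ X D + (1 / Δ) • torusDeriv φ X (D - Δ • b X)

theorem tdError_eq (ρ : ℝ) (φ : Torus d → Vec q) {Δ : ℝ} (hΔ : Δ ≠ 0) (X : Torus d) (D : Vec d)
    (R : ℝ) (θ : Vec q) : tdError ρ φ Δ X D R θ = inner ℝ θ (tdVec ρ φ Δ X D) - R := by
  simp only [tdError, value, tdVec, inner_smul_right, inner_sub_right]
  field_simp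

theorem stochTdError_eq (ρ : ℝ) (b : Torus d → Vec d) {φ : Torus d → Vec q} (hφ : IsCk 1 φ)
    {Δ : ℝ} (hΔ : Δ ≠ 0) (X : Torus d) (D : Vec d) (R : ℝ) (θ : Vec q) :
    stochTdError ρ b φ Δ X D R θ = inner ℝ θ (stochTdVec ρ b φ Δ X D) - R := by
  have h : HasFDerivAt (fun h : Vec d => value φ (X + proj h) θ)
      ((innerSL ℝ θ).comp (torusDeriv φ X)) 0 := by
    have := (innerSL ℝ θ).hasFDerivAt.comp (0 : Vec d) (IsCk.hasFDerivAt (p := 0) hφ X 0)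
    simp only [proj_zero, add_zero] at this
    exact this
  rw [stochTdError, tdError_eq ρ φ hΔ, h.fderiv, stochTdVec, inner_add_right, inner_smul_right]
  simp
  ring

theorem torusDeriv_coord {φ : Torus d → Vec q} (hφ : IsCk 1 φ) (j : Fin q) (x : Torus d)
    (u : Vec d) : torusDeriv (fun y => φ y j) x u = torusDeriv φ x u j := by
  have h2 : HasFDerivAt (fun h : Vec d => φ (x + proj h) j)
      ((EuclideanSpace.proj (𝕜 := ℝ) j).comp (torusDeriv φ x)) 0 := by
    have := (EuclideanSpace.proj (𝕜 := ℝ) j).hasFDerivAt.comp (0 : Vec d)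
      (IsCk.hasFDerivAt (p := 0) hφ x 0)
    simp only [proj_zero, add_zero] at this
    exact this
  rw [torusDeriv, h2.fderiv]
  simp

theorem one_sub_exp_neg_bounds {x : ℝ} (hx : 0 ≤ x) :
    0 ≤ 1 - Real.exp (-x) ∧ 1 - Real.exp (-x) ≤ x ∧ x - x ^ 2 ≤ 1 - Real.exp (-x) := by
  refine ⟨?_, ?_, ?_⟩
  · have : Real.exp (-x) ≤ 1 := Real.exp_le_one_iff.2 (by linarith)
    linarith
  · have := Real.add_one_le_exp (-x)
    linarith
  · have h1 := Real.add_one_le_exp x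
    have h2 : Real.exp (-x) * Real.exp x = 1 := by
      rw [← Real.exp_add]
      simp
    have h3 : 0 < Real.exp (-x) := Real.exp_pos _
    have h4 : Real.exp (-x) * (x + 1) ≤ 1 :=
      (mul_le_mul_of_nonneg_left h1 h3.le).trans h2.le
    nlinarith [pow_nonneg hx 3]

/-- Moment conditions on the random coefficients `(Φ, U, R)` of an update of the parameter: the
means of `Φ Uᵀ` and `R Φ` are `A` and `c` up to `β`, and `U` has second moment at most `V`. -/
structure UpdateBound {Ω : Type*} [MeasurableSpace Ω] (P : Measure Ω) (A : Fin q → Fin q → ℝ)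
    (c : Fin q → ℝ) (Φ U : Ω → Vec q) (R : Ω → ℝ) (B β V : ℝ) : Prop where
  measurable_feature : Measurable Φ
  measurable_vec : Measurable U
  measurable_reward : Measurable R
  norm_feature_le : ∀ ω, ‖Φ ω‖ ≤ B
  abs_reward_le : ∀ᵐ ω ∂P, |R ω| ≤ B
  integrable_vec : Integrable (fun ω => ‖U ω‖ ^ 2) P
  vec_le : ∫ ω, ‖U ω‖ ^ 2 ∂P ≤ V
  mean_mul_le : ∀ i j, |(∫ ω, Φ ω i * U ω j ∂P) - A i j| ≤ β
  mean_reward_le : ∀ i, |(∫ ω, R ω * Φ ω i ∂P) - c i| ≤ β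

section Mean

variable {b : Torus d → Vec d} {σ : Torus d → Vec n →L[ℝ] Vec d}
  {Ω : Type*} [mΩ : MeasurableSpace Ω] {P : Measure Ω}

/-- With e = exp(-ρΔ), the vector is ((1-e)/Δ) φ(X) - (e/Δ)(φ(X') - φ(X)), to be compared with ρφ -
gen φ. The three terms of the constant are the errors in (1-e)/Δ ≈ ρ, in the weak expansion, and in
e ≈ 1. -/
theorem abs_mean_tdVec_sub_le [IsProbabilityMeasure P] {ρ : ℝ} (hρ : 0 ≤ ρ) {r : Torus d → ℝ}
    {φ : Torus d → Vec q}
    (hφ : Continuous φ) {B G : ℝ} (hB : ∀ x, ‖φ x‖ ≤ B)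
    (hgc : ∀ j, Continuous (gen b σ fun y => φ y j))
    (hG : ∀ j x, |gen b σ (fun y => φ y j) x| ≤ G)
    {Δ C : ℝ} {X : Ω → Torus d} {D : Ω → Vec d} {R : Ω → ℝ}
    (hX : Measurable X) (hD : Measurable D)
    (h : Consistent b σ r φ P Δ X D R C) (hΔ : 0 < Δ) (i j : Fin q) :
    |(∫ ω, φ (X ω) i * tdVec ρ φ Δ (X ω) (D ω) j ∂P) -
      ∫ ω, φ (X ω) i * opL ρ b σ (fun y => φ y j) (X ω) ∂P| ≤
      (ρ ^ 2 * B ^ 2 + C + ρ * B * G) * Δ := by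
  have hφi : ∀ i, Measurable fun x => φ x i := fun i => Continuous.measurable (by fun_prop)
  have hB0 : 0 ≤ B := (norm_nonneg _).trans (hB 0)
  have hG0 : 0 ≤ G := (abs_nonneg _).trans (hG j 0)
  have hφb : ∀ i x, |φ x i| ≤ B := fun i x => (PiLp.norm_apply_le (φ x) i).trans (hB x)
  have mX : ∀ i, Measurable fun ω => φ (X ω) i := fun i => (hφi i).comp hX
  have mX' : Measurable fun ω => φ (X ω + proj (D ω)) j :=
    (hφi j).comp (hX.add (continuous_proj.measurable.comp hD))
  have mg : Measurable fun ω => gen b σ (fun y => φ y j) (X ω) := (hgc j).measurable.comp hX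
  set e := Real.exp (-(ρ * Δ)) with he
  obtain ⟨k1, k2, k3⟩ := one_sub_exp_neg_bounds (mul_nonneg hρ hΔ.le)
  rw [← he] at k1 k2 k3
  have he0 : 0 < e := Real.exp_pos _
  have i1 : Integrable (fun ω => φ (X ω) i * φ (X ω) j) P :=
    Integrable.of_bound (C := B * B) ((mX i).mul (mX j)).aestronglyMeasurable
      (.of_forall fun ω => by
        rw [norm_mul]
        exact mul_le_mul (hφb _ _) (hφb _ _) (norm_nonneg _) hB0)
  have i2 : Integrable (fun ω => φ (X ω) i * gen b σ (fun y => φ y j) (X ω)) P :=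
    Integrable.of_bound (C := B * G) ((mX i).mul mg).aestronglyMeasurable
      (.of_forall fun ω => by
        rw [norm_mul]
        exact mul_le_mul (hφb _ _) (hG _ _) (norm_nonneg _) hB0)
  have i3 : Integrable (fun ω => φ (X ω) i * φ (X ω + proj (D ω)) j) P :=
    Integrable.of_bound (C := B * B) ((mX i).mul mX').aestronglyMeasurable
      (.of_forall fun ω => by
        rw [norm_mul]
        exact mul_le_mul (hφb _ _) (hφb _ _) (norm_nonneg _) hB0)
  have i4 : Integrable (fun ω => φ (X ω) i * (φ (X ω + proj (D ω)) j - φ (X ω) j -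
    Δ * gen b σ (fun y => φ y j) (X ω))) P := by
    refine ((i3.sub i1).sub (i2.const_mul Δ)).congr (.of_forall fun ω => ?_)
    simp only [Pi.sub_apply]
    ring
  set W := ∫ ω, φ (X ω) i * (φ (X ω + proj (D ω)) j - φ (X ω) j -
    Δ * gen b σ (fun y => φ y j) (X ω)) ∂P with hW
  have hWle := h.weak_le i j
  rw [← hW] at hWle
  set I1 := ∫ ω, φ (X ω) i * φ (X ω) j ∂P with hI1
  set I2 := ∫ ω, φ (X ω) i * gen b σ (fun y => φ y j) (X ω) ∂P with hI2
  have e1 : ∫ ω, φ (X ω) i * tdVec ρ φ Δ (X ω) (D ω) j ∂P =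
      (1 - e) / Δ * I1 - e / Δ * W - e * I2 := by
    have i5 : Integrable (fun ω => (1 - e) / Δ * (φ (X ω) i * φ (X ω) j) - e / Δ *
        (φ (X ω) i * (φ (X ω + proj (D ω)) j - φ (X ω) j -
          Δ * gen b σ (fun y => φ y j) (X ω)))) P := (i1.const_mul _).sub (i4.const_mul _)
    rw [hI1, hI2, hW, ← integral_const_mul, ← integral_const_mul, ← integral_const_mul,
      ← integral_sub (i1.const_mul _) (i4.const_mul _),
      ← integral_sub i5 (i2.const_mul _)]
    refine integral_congr_ae (.of_forall fun ω => ?_)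
    simp only [tdVec, PiLp.smul_apply, PiLp.sub_apply, smul_eq_mul, neg_mul, ← he]
    field_simp
    ring
  have e2 : ∫ ω, φ (X ω) i * opL ρ b σ (fun y => φ y j) (X ω) ∂P = ρ * I1 - I2 := by
    rw [hI1, hI2, ← integral_const_mul, ← integral_sub (i1.const_mul _) i2]
    refine integral_congr_ae (.of_forall fun ω => ?_)
    simp only [opL_eq]
    ring
  have hI1le : |I1| ≤ B * B := abs_integral_le_of_abs_le (.of_forall fun ω => by
    rw [abs_mul]
    exact mul_le_mul (hφb _ _) (hφb _ _) (abs_nonneg _) hB0)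
  have hI2le : |I2| ≤ B * G := abs_integral_le_of_abs_le (.of_forall fun ω => by
    rw [abs_mul]
    exact mul_le_mul (hφb _ _) (hG _ _) (abs_nonneg _) hB0)
  have e3 : (1 - e) / Δ * I1 - e / Δ * W - e * I2 - (ρ * I1 - I2) =
      ((1 - e) / Δ - ρ) * I1 - e * (W / Δ) + (1 - e) * I2 := by ring
  have b1 : |(1 - e) / Δ - ρ| ≤ ρ ^ 2 * Δ := by
    have : (1 - e) / Δ - ρ = (1 - e - ρ * Δ) / Δ := by field_simp
    rw [this, abs_div, abs_of_pos hΔ, div_le_iff₀ hΔ, abs_le]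
    constructor <;> nlinarith
  have b2 : |W / Δ| ≤ C * Δ := by
    rw [abs_div, abs_of_pos hΔ, div_le_iff₀ hΔ]
    linarith
  have b3 : |1 - e| ≤ ρ * Δ := by rwa [abs_of_nonneg k1]
  have b4 : |e| ≤ 1 := by
    rw [abs_of_pos he0]
    linarith
  rw [e1, e2, e3]
  calc _ ≤ |((1 - e) / Δ - ρ) * I1| + |e * (W / Δ)| + |(1 - e) * I2| :=
        (abs_add_le _ _).trans (add_le_add_left (abs_sub _ _) _)
    _ ≤ ρ ^ 2 * Δ * (B * B) + 1 * (C * Δ) + ρ * Δ * (B * G) := by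
        rw [abs_mul, abs_mul, abs_mul]
        gcongr
    _ = _ := by ring

theorem integrable_norm_sq_displacement [IsProbabilityMeasure P] {r : Torus d → ℝ}
    {φ : Torus d → Vec q} {Δ C : ℝ} {X : Ω → Torus d} {D : Ω → Vec d} {R : Ω → ℝ}
    (hD : Measurable D) (h : Consistent b σ r φ P Δ X D R C) (hΔ : 0 < Δ) :
    Integrable (fun ω => ‖D ω‖ ^ 2) P ∧ ∫ ω, ‖D ω‖ ^ 2 ∂P ≤ (1 + C) * Δ :=
  integral_sq_le_of_integral_pow_four_le (Y := fun ω => ‖D ω‖) hD.norm h.integrable_displacement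
    hΔ h.displacement_le

theorem measurable_tdVec {ρ : ℝ} {φ : Torus d → Vec q} (hφ : Continuous φ) (Δ : ℝ) :
    Measurable fun y : Torus d × Vec d => tdVec ρ φ Δ y.1 y.2 := by
  have : Continuous (proj : Vec d → Torus d) := continuous_proj
  refine Continuous.measurable ?_
  unfold tdVec
  fun_prop

theorem measurable_stochTdVec {ρ : ℝ} (hb : Continuous b) {φ : Torus d → Vec q} (hφ : IsCk 1 φ)
    (Δ : ℝ) : Measurable fun y : Torus d × Vec d => stochTdVec ρ b φ Δ y.1 y.2 := by
  have hp : Continuous (proj : Vec d → Torus d) := continuous_proj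
  have h1 := hφ.continuous
  have h2 : Continuous (torusDeriv φ) := (IsCk.torusDeriv (p := 0) hφ).continuous
  refine Continuous.measurable ?_
  unfold stochTdVec tdVec
  fun_prop

/-- The term |D|/Δ has mean square O(1/Δ): this is the variance of the standard difference. -/
theorem norm_tdVec_le {ρ : ℝ} (hρ : 0 ≤ ρ) {φ : Torus d → Vec q} (hφ : IsCk 1 φ) {B L : ℝ}
    (hB : ∀ x, ‖φ x‖ ≤ B) (hL : ∀ x, ‖torusDeriv φ x‖ ≤ L) {Δ : ℝ} (hΔ : 0 < Δ) (X : Torus d)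
    (D : Vec d) : ‖tdVec ρ φ Δ X D‖ ≤ ρ * B + L * ‖D‖ / Δ := by
  obtain ⟨k1, k2, k3⟩ := one_sub_exp_neg_bounds (mul_nonneg hρ hΔ.le)
  have he0 : 0 < Real.exp (-(ρ * Δ)) := Real.exp_pos _
  have hB0 : 0 ≤ B := (norm_nonneg _).trans (hB 0)
  have h1 := norm_add_proj_sub_le hφ hL X D
  have e1 : tdVec ρ φ Δ X D = (1 / Δ) • ((1 - Real.exp (-(ρ * Δ))) • φ X -
      Real.exp (-(ρ * Δ)) • (φ (X + proj D) - φ X)) := by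
    rw [tdVec, neg_mul]
    module
  rw [e1, norm_smul, Real.norm_of_nonneg (by positivity)]
  calc _ ≤ 1 / Δ * ((ρ * Δ) * B + 1 * (L * ‖D‖)) := by
        gcongr
        refine (norm_sub_le _ _).trans (add_le_add ?_ ?_)
        · rw [norm_smul, Real.norm_of_nonneg k1]
          gcongr
          exact hB X
        · rw [norm_smul, Real.norm_of_nonneg he0.le]
          gcongr
          linarith
    _ = _ := by field_simp

/-- The correction cancels the linear Taylor term of φ(X') - φ(X), leaving |D|²/Δ, whose mean square
is bounded as Δ → 0. -/
theorem norm_stochTdVec_le {ρ : ℝ} (hρ : 0 ≤ ρ) {φ : Torus d → Vec q} (hφ : IsCk 2 φ)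
    {B L H β : ℝ} (hB : ∀ x, ‖φ x‖ ≤ B) (hL : ∀ x, ‖torusDeriv φ x‖ ≤ L)
    (hH : ∀ x, ‖torusDeriv (torusDeriv φ) x‖ ≤ H) (hβ : ∀ x, ‖b x‖ ≤ β) {Δ : ℝ} (hΔ : 0 < Δ)
    (X : Torus d) (D : Vec d) :
    ‖stochTdVec ρ b φ Δ X D‖ ≤ ρ * B + L * β + H * ‖D‖ ^ 2 / Δ := by
  obtain ⟨k1, k2, k3⟩ := one_sub_exp_neg_bounds (mul_nonneg hρ hΔ.le)
  have hL0 : 0 ≤ L := (norm_nonneg _).trans (hL 0)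
  have h1 := norm_add_proj_sub_sub_le hφ hH X D
  -- The discount is attached to φ(X'), so that the increment has coefficient one and the
  -- cancellation with the undiscounted gradient is exact.
  have e1 : stochTdVec ρ b φ Δ X D = (1 / Δ) • ((1 - Real.exp (-(ρ * Δ))) • φ (X + proj D) -
      (φ (X + proj D) - φ X - torusDeriv φ X D) - Δ • torusDeriv φ X (b X)) := by
    rw [stochTdVec, tdVec, neg_mul, sub_smul, one_smul, ← smul_add, map_sub, map_smul]
    congr 1
    abel
  rw [e1, norm_smul, Real.norm_of_nonneg (by positivity)]
  calc _ ≤ 1 / Δ * ((ρ * Δ) * B + H * ‖D‖ ^ 2 + Δ * (L * β)) := by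
        gcongr
        refine (norm_sub_le _ _).trans (add_le_add ((norm_sub_le _ _).trans
          (add_le_add ?_ h1)) ?_)
        · rw [norm_smul, Real.norm_of_nonneg k1]
          gcongr
          exact hB _
        · rw [norm_smul, Real.norm_of_nonneg hΔ.le]
          gcongr
          refine (ContinuousLinearMap.le_opNorm _ _).trans ?_
          gcongr
          · exact hL X
          · exact hβ X
    _ = _ := by
        field_simp
        ring

end Mean

end

/-! ### Moment bounds for the two kinds of updates -/

section

variable {d n q : ℕ} {b : Torus d → Vec d} {σ : Torus d → Vec n →L[ℝ] Vec d}
  {Ω : Type*} [mΩ : MeasurableSpace Ω] {P : Measure Ω}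

theorem abs_mean_reward_sub_le [IsProbabilityMeasure P] {r : Torus d → ℝ} (hr : Continuous r)
    {φ : Torus d → Vec q} (hφ : Continuous φ) {Δ C : ℝ} {X : Ω → Torus d} {D : Ω → Vec d}
    {R : Ω → ℝ} (hX : Measurable X) (hR : Measurable R) (h : Consistent b σ r φ P Δ X D R C)
    (i : Fin q) :
    |(∫ ω, R ω * φ (X ω) i ∂P) - ∫ ω, r (X ω) * φ (X ω) i ∂P| ≤ C * Δ := by
  obtain ⟨B, hB0, hB⟩ := exists_bound_of_continuous hφ
  obtain ⟨Br, hBr0, hBr⟩ := exists_bound_of_continuous hr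
  have hφi : Measurable fun x => φ x i := Continuous.measurable (by fun_prop)
  have i1 : Integrable (fun ω => R ω * φ (X ω) i) P := by
    refine Integrable.of_bound (C := C * B) (hR.mul (hφi.comp hX)).aestronglyMeasurable ?_
    filter_upwards [h.abs_reward_le] with ω hω
    rw [norm_mul]
    exact mul_le_mul hω ((PiLp.norm_apply_le (φ (X ω)) i).trans (hB _)) (norm_nonneg _) h.nonneg
  have i2 : Integrable (fun ω => r (X ω) * φ (X ω) i) P := by
    refine Integrable.of_bound (C := Br * B)
      ((hr.measurable.comp hX).mul (hφi.comp hX)).aestronglyMeasurable (.of_forall fun ω => ?_)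
    rw [norm_mul]
    exact mul_le_mul (hBr _) ((PiLp.norm_apply_le (φ (X ω)) i).trans (hB _)) (norm_nonneg _) hBr0
  rw [← integral_sub i1 i2]
  refine le_trans (le_of_eq ?_) (h.reward_le i)
  congr 1
  refine integral_congr_ae (.of_forall fun ω => ?_)
  ring

theorem add_sq_le_two_mul (x y : ℝ) : (x + y) ^ 2 ≤ 2 * x ^ 2 + 2 * y ^ 2 := by
  nlinarith [sq_nonneg (x - y)]

/-- The updates of TD(0) with standard temporal differences. -/
theorem exists_updateBound_tdVec [IsProbabilityMeasure P] {ρ : ℝ} (hρ : 0 ≤ ρ)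
    {r : Torus d → ℝ} (hr : Continuous r) {φ : Torus d → Vec q} (hφ : IsCk 1 φ)
    (hgc : ∀ j, Continuous (gen b σ fun y => φ y j)) (A : Fin q → Fin q → ℝ) (c : Fin q → ℝ)
    {C : ℝ} (hC : 0 ≤ C) :
    ∃ K : ℝ, 0 ≤ K ∧ ∀ (Δ : ℝ) (X : Ω → Torus d) (D : Ω → Vec d) (R : Ω → ℝ), 0 < Δ → Δ ≤ 1 →
      Measurable X → Measurable D → Measurable R → Consistent b σ r φ P Δ X D R C →
      (∀ i j, |(∫ ω, φ (X ω) i * opL ρ b σ (fun y => φ y j) (X ω) ∂P) - A i j| ≤ C * Δ) →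
      (∀ i, |(∫ ω, r (X ω) * φ (X ω) i ∂P) - c i| ≤ C * Δ) →
      UpdateBound P A c (fun ω => φ (X ω)) (fun ω => tdVec ρ φ Δ (X ω) (D ω)) R K (K * Δ)
        (K / Δ) := by
  have hφc := hφ.continuous
  obtain ⟨B, hB0, hB⟩ := exists_bound_of_continuous hφc
  obtain ⟨L, hL0, hL⟩ := exists_bound_of_continuous (IsCk.torusDeriv (p := 0) hφ).continuous
  choose G' hG0' hG' using fun j => exists_bound_of_continuous (hgc j)
  set G := ∑ j, G' j with hGdef
  have hG0 : 0 ≤ G := Finset.sum_nonneg fun j _ => hG0' j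
  have hG : ∀ j x, |gen b σ (fun y => φ y j) x| ≤ G := fun j x => (hG' j x).trans
    (Finset.single_le_sum (fun j _ => hG0' j) (Finset.mem_univ j))
  -- One constant for all fields. Two copies of C cover the bias: consistency of the observation,
  -- and the law of X against its limit. The last bracket is the second moment, where Δ ≤ 1 lets a
  -- constant be divided by Δ.
  refine ⟨B + 2 * C + (ρ ^ 2 * B ^ 2 + ρ * B * G) + (2 * (ρ * B) ^ 2 + 2 * L ^ 2 * (1 + C)),
    by positivity, fun Δ X D R hΔ hΔ1 hX hD hR h hA hc => ?_⟩
  set K := B + 2 * C + (ρ ^ 2 * B ^ 2 + ρ * B * G) + (2 * (ρ * B) ^ 2 + 2 * L ^ 2 * (1 + C))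
  have p1 : 0 ≤ ρ ^ 2 * B ^ 2 + ρ * B * G := by positivity
  have p2 : 0 ≤ 2 * (ρ * B) ^ 2 + 2 * L ^ 2 * (1 + C) := by positivity
  have mU : Measurable fun ω => tdVec ρ φ Δ (X ω) (D ω) :=
    (measurable_tdVec hφc Δ).comp (hX.prodMk hD)
  obtain ⟨hD2, hD2le⟩ := integrable_norm_sq_displacement hD h hΔ
  have hle : ∀ ω, ‖tdVec ρ φ Δ (X ω) (D ω)‖ ^ 2 ≤
      2 * L ^ 2 / Δ ^ 2 * ‖D ω‖ ^ 2 + 2 * (ρ * B) ^ 2 := fun ω => by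
    calc _ ≤ (ρ * B + L * ‖D ω‖ / Δ) ^ 2 := by
          gcongr
          exact norm_tdVec_le hρ hφ hB hL hΔ _ _
      _ ≤ 2 * (ρ * B) ^ 2 + 2 * (L * ‖D ω‖ / Δ) ^ 2 := add_sq_le_two_mul _ _
      _ = _ := by ring
  have hbd : Integrable (fun ω => 2 * L ^ 2 / Δ ^ 2 * ‖D ω‖ ^ 2 + 2 * (ρ * B) ^ 2) P :=
    (hD2.const_mul _).add (integrable_const _)
  have hint : Integrable (fun ω => ‖tdVec ρ φ Δ (X ω) (D ω)‖ ^ 2) P :=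
    hbd.mono' (mU.norm.pow_const 2).aestronglyMeasurable (.of_forall fun ω => by
      rw [Real.norm_of_nonneg (by positivity)]
      exact hle ω)
  refine ⟨hφc.measurable.comp hX, mU, hR, fun ω => (hB _).trans ?_, ?_, hint, ?_, ?_, ?_⟩
  · simp only [K]
    linarith
  · refine h.abs_reward_le.mono fun ω hω => hω.trans ?_
    simp only [K]
    linarith
  · refine (integral_mono hint hbd hle).trans ?_
    rw [integral_add_const_prob (hD2.const_mul _), integral_const_mul]
    calc _ ≤ 2 * L ^ 2 / Δ ^ 2 * ((1 + C) * Δ) + 2 * (ρ * B) ^ 2 / Δ := by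
          gcongr
          exact le_div_self (by positivity) hΔ hΔ1
      _ = (2 * (ρ * B) ^ 2 + 2 * L ^ 2 * (1 + C)) / Δ := by
          field_simp
          ring
      _ ≤ K / Δ := by
          gcongr
          simp only [K]
          linarith
  · intro i j
    have h1 := abs_mean_tdVec_sub_le hρ hφc hB hgc hG hX hD h hΔ i j
    refine (abs_sub_le _ _ _).trans ((add_le_add h1 (hA i j)).trans ?_)
    rw [← add_mul]
    gcongr
    simp only [K]
    linarith
  · intro i
    have h1 := abs_mean_reward_sub_le hr hφc hX hR h i
    refine (abs_sub_le _ _ _).trans ((add_le_add h1 (hc i)).trans ?_)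
    rw [← add_mul]
    gcongr
    simp only [K]
    linarith

/-- The means differ by 1/Δ times the weighted mean of ∇φ · (D - Δ b), which consistency makes
O(Δ²). -/
theorem abs_mean_stochTdVec_sub_le [IsProbabilityMeasure P] {ρ : ℝ} (hρ : 0 ≤ ρ)
    (hb : Continuous b) {r : Torus d → ℝ} {φ : Torus d → Vec q} (hφ1 : IsCk 1 φ) {Δ C : ℝ}
    {X : Ω → Torus d} {D : Ω → Vec d} {R : Ω → ℝ} (hX : Measurable X) (hD : Measurable D)
    (h : Consistent b σ r φ P Δ X D R C) (hΔ : 0 < Δ) (i j : Fin q) :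
    |(∫ ω, φ (X ω) i * stochTdVec ρ b φ Δ (X ω) (D ω) j ∂P) -
      ∫ ω, φ (X ω) i * tdVec ρ φ Δ (X ω) (D ω) j ∂P| ≤ C * Δ := by
  have hφc := hφ1.continuous
  obtain ⟨B, hB0, hB⟩ := exists_bound_of_continuous hφc
  obtain ⟨β, hβ0, hβ⟩ := exists_bound_of_continuous hb
  obtain ⟨L, hL0, hL⟩ := exists_bound_of_continuous (IsCk.torusDeriv (p := 0) hφ1).continuous
  obtain ⟨hD2, -⟩ := integrable_norm_sq_displacement hD h hΔ
  have mi : Measurable fun ω => φ (X ω) i :=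
    (Continuous.measurable (by fun_prop : Continuous fun x => φ x i)).comp hX
  have hφb : ∀ ω, |φ (X ω) i| ≤ B := fun ω => (PiLp.norm_apply_le (φ (X ω)) i).trans (hB _)
  have hD1 : Integrable (fun ω => ‖D ω‖) P :=
    ((integrable_const (1 : ℝ)).add hD2).mono' hD.norm.aestronglyMeasurable
      (.of_forall fun ω => by
      simp only [norm_norm, Pi.add_apply]
      nlinarith [sq_nonneg (‖D ω‖ - 1)])
  have i1 : Integrable (fun ω => φ (X ω) i * tdVec ρ φ Δ (X ω) (D ω) j) P := by
    have m1 : Measurable fun ω => tdVec ρ φ Δ (X ω) (D ω) j := by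
      have := (measurable_tdVec (ρ := ρ) hφc Δ).comp (hX.prodMk hD)
      exact (Continuous.measurable (by fun_prop : Continuous fun y : Vec q => y j)).comp this
    have m2 : Integrable (fun ω => tdVec ρ φ Δ (X ω) (D ω) j) P := by
      refine (((hD1.const_mul L).div_const Δ).add (integrable_const (ρ * B))).mono'
        m1.aestronglyMeasurable (.of_forall fun ω => ?_)
      refine (PiLp.norm_apply_le (tdVec ρ φ Δ (X ω) (D ω)) j).trans
        ((norm_tdVec_le hρ hφ1 hB hL hΔ (X ω) (D ω)).trans (le_of_eq ?_))
      simp only [Pi.add_apply]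
      ring
    exact m2.bdd_mul mi.aestronglyMeasurable (.of_forall hφb)
  have i2 : Integrable (fun ω => φ (X ω) i *
      torusDeriv (fun y => φ y j) (X ω) (D ω - Δ • b (X ω))) P := by
    have hdj : Continuous (torusDeriv fun y => φ y j) :=
      (IsCk.torusDeriv (p := 0) (hφ1.coord j)).continuous
    obtain ⟨Lj, hLj0, hLj⟩ := exists_bound_of_continuous hdj
    have m1 : Measurable fun ω => torusDeriv (fun y => φ y j) (X ω) (D ω - Δ • b (X ω)) := by
      have hc : Continuous fun y : Torus d × Vec d =>
        torusDeriv (fun z => φ z j) y.1 (y.2 - Δ • b y.1) := by fun_prop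
      exact hc.measurable.comp (hX.prodMk hD)
    have m2 : Integrable (fun ω => torusDeriv (fun y => φ y j) (X ω) (D ω - Δ • b (X ω))) P := by
      refine ((hD1.add (integrable_const (Δ * β))).const_mul Lj).mono'
        m1.aestronglyMeasurable (.of_forall fun ω => ?_)
      refine (ContinuousLinearMap.le_opNorm _ _).trans ?_
      refine mul_le_mul (hLj _) ?_ (norm_nonneg _) hLj0
      refine (norm_sub_le _ _).trans (add_le_add le_rfl ?_)
      rw [norm_smul, Real.norm_of_nonneg hΔ.le]
      exact mul_le_mul_of_nonneg_left (hβ _) hΔ.le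
    exact m2.bdd_mul mi.aestronglyMeasurable (.of_forall hφb)
  have e : ∫ ω, φ (X ω) i * stochTdVec ρ b φ Δ (X ω) (D ω) j ∂P =
      (∫ ω, φ (X ω) i * tdVec ρ φ Δ (X ω) (D ω) j ∂P) + 1 / Δ * ∫ ω, φ (X ω) i *
        torusDeriv (fun y => φ y j) (X ω) (D ω - Δ • b (X ω)) ∂P := by
    rw [← integral_const_mul, ← integral_add i1 (i2.const_mul _)]
    refine integral_congr_ae (.of_forall fun ω => ?_)
    simp only [stochTdVec, PiLp.add_apply, PiLp.smul_apply, smul_eq_mul, torusDeriv_coord hφ1]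
    ring
  have h2 := h.drift_le i j
  have h3 : |1 / Δ * ∫ ω, φ (X ω) i *
        torusDeriv (fun y => φ y j) (X ω) (D ω - Δ • b (X ω)) ∂P| ≤ C * Δ := by
    rw [abs_mul, abs_of_pos (by positivity)]
    calc _ ≤ 1 / Δ * (C * Δ ^ 2) := by gcongr
      _ = _ := by field_simp
  rw [e, add_sub_cancel_left]
  exact h3

theorem measurable_stochTdVec_comp {ρ : ℝ} (hb : Continuous b) {φ : Torus d → Vec q}
    (hφ : IsCk 1 φ) (Δ : ℝ) {X : Ω → Torus d} {D : Ω → Vec d} (hX : Measurable X)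
    (hD : Measurable D) : Measurable fun ω => stochTdVec ρ b φ Δ (X ω) (D ω) := by
  have h := (measurable_stochTdVec (ρ := ρ) hb hφ Δ).comp (hX.prodMk hD)
  simp only [Function.comp_def] at h
  exact h

/-- The updates of TD(0) with stochastic temporal differences. -/
theorem exists_updateBound_stochTdVec [IsProbabilityMeasure P] {ρ : ℝ} (hρ : 0 ≤ ρ)
    (hb : Continuous b)
    {r : Torus d → ℝ} (hr : Continuous r) {φ : Torus d → Vec q} (hφ : IsCk 2 φ)
    (hgc : ∀ j, Continuous (gen b σ fun y => φ y j)) (A : Fin q → Fin q → ℝ) (c : Fin q → ℝ)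
    {C : ℝ} (hC : 0 ≤ C) :
    ∃ K : ℝ, 0 ≤ K ∧ ∀ (Δ : ℝ) (X : Ω → Torus d) (D : Ω → Vec d) (R : Ω → ℝ), 0 < Δ → Δ ≤ 1 →
      Measurable X → Measurable D → Measurable R → Consistent b σ r φ P Δ X D R C →
      (∀ i j, |(∫ ω, φ (X ω) i * opL ρ b σ (fun y => φ y j) (X ω) ∂P) - A i j| ≤ C * Δ) →
      (∀ i, |(∫ ω, r (X ω) * φ (X ω) i ∂P) - c i| ≤ C * Δ) →
      UpdateBound P A c (fun ω => φ (X ω)) (fun ω => stochTdVec ρ b φ Δ (X ω) (D ω)) R K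
        (K * Δ) K := by
  have hφ1 : IsCk 1 φ := hφ.of_le (by norm_num)
  have hφc := hφ.continuous
  have hdc : Continuous (torusDeriv φ) := (IsCk.torusDeriv (p := 1) hφ).continuous
  obtain ⟨B, hB0, hB⟩ := exists_bound_of_continuous hφc
  obtain ⟨β, hβ0, hβ⟩ := exists_bound_of_continuous hb
  obtain ⟨L, hL0, hL⟩ := exists_bound_of_continuous hdc
  obtain ⟨H, hH0, hH⟩ := exists_bound_of_continuous
    (IsCk.torusDeriv (p := 0) (IsCk.torusDeriv (p := 1) hφ)).continuous
  choose G' hG0' hG' using fun j => exists_bound_of_continuous (hgc j)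
  set G := ∑ j, G' j with hGdef
  have hG0 : 0 ≤ G := Finset.sum_nonneg fun j _ => hG0' j
  have hG : ∀ j x, |gen b σ (fun y => φ y j) x| ≤ G := fun j x => (hG' j x).trans
    (Finset.single_le_sum (fun j _ => hG0' j) (Finset.mem_univ j))
  -- A third copy of C pays for the bias of the correction; the last bracket, from the fourth moment
  -- of D, carries no 1/Δ.
  refine ⟨B + 3 * C + (ρ ^ 2 * B ^ 2 + ρ * B * G) + (2 * (ρ * B + L * β) ^ 2 + 2 * H ^ 2 * C),
    by positivity, fun Δ X D R hΔ hΔ1 hX hD hR h hA hc => ?_⟩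
  set K := B + 3 * C + (ρ ^ 2 * B ^ 2 + ρ * B * G) + (2 * (ρ * B + L * β) ^ 2 + 2 * H ^ 2 * C)
  have p1 : 0 ≤ ρ ^ 2 * B ^ 2 + ρ * B * G := by positivity
  have p2 : 0 ≤ 2 * (ρ * B + L * β) ^ 2 + 2 * H ^ 2 * C := by positivity
  have mU : Measurable fun ω => stochTdVec ρ b φ Δ (X ω) (D ω) :=
    measurable_stochTdVec_comp hb hφ1 Δ hX hD
  have hD4 := h.integrable_displacement
  obtain ⟨hD2, hD2le⟩ := integrable_norm_sq_displacement hD h hΔ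
  have hle : ∀ ω, ‖stochTdVec ρ b φ Δ (X ω) (D ω)‖ ^ 2 ≤
      2 * H ^ 2 / Δ ^ 2 * ‖D ω‖ ^ 4 + 2 * (ρ * B + L * β) ^ 2 := fun ω => by
    calc _ ≤ (ρ * B + L * β + H * ‖D ω‖ ^ 2 / Δ) ^ 2 := by
          gcongr
          exact norm_stochTdVec_le hρ hφ hB hL hH hβ hΔ _ _
      _ ≤ 2 * (ρ * B + L * β) ^ 2 + 2 * (H * ‖D ω‖ ^ 2 / Δ) ^ 2 := add_sq_le_two_mul _ _
      _ = _ := by ring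
  have hbd : Integrable (fun ω => 2 * H ^ 2 / Δ ^ 2 * ‖D ω‖ ^ 4 + 2 * (ρ * B + L * β) ^ 2) P :=
    (hD4.const_mul _).add (integrable_const _)
  have hint : Integrable (fun ω => ‖stochTdVec ρ b φ Δ (X ω) (D ω)‖ ^ 2) P :=
    hbd.mono' (mU.norm.pow_const 2).aestronglyMeasurable (.of_forall fun ω => by
      rw [Real.norm_of_nonneg (by positivity)]
      exact hle ω)
  refine ⟨hφc.measurable.comp hX, mU, hR, fun ω => (hB _).trans ?_, ?_, hint, ?_, ?_, ?_⟩
  · simp only [K]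
    linarith
  · refine h.abs_reward_le.mono fun ω hω => hω.trans ?_
    simp only [K]
    linarith
  · refine (integral_mono hint hbd hle).trans ?_
    rw [integral_add_const_prob (hD4.const_mul _), integral_const_mul]
    calc _ ≤ 2 * H ^ 2 / Δ ^ 2 * (C * Δ ^ 2) + 2 * (ρ * B + L * β) ^ 2 := by
          gcongr
          exact h.displacement_le
      _ = 2 * (ρ * B + L * β) ^ 2 + 2 * H ^ 2 * C := by
          field_simp
          ring
      _ ≤ K := by
          simp only [K]
          linarith
  · intro i j
    have h1 := abs_mean_tdVec_sub_le hρ hφc hB hgc hG hX hD h hΔ i j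
    have h2 := abs_mean_stochTdVec_sub_le hρ hb hφ1 hX hD h hΔ i j
    refine (abs_sub_le _ _ _).trans ((add_le_add h2 ((abs_sub_le _ _ _).trans
      (add_le_add h1 (hA i j)))).trans ?_)
    rw [← add_mul, ← add_mul]
    gcongr
    simp only [K]
    linarith
  · intro i
    have h1 := abs_mean_reward_sub_le hr hφc hX hR h i
    refine (abs_sub_le _ _ _).trans ((add_le_add h1 (hc i)).trans ?_)
    rw [← add_mul]
    gcongr
    simp only [K]
    linarith

end

/-! ### The scalar recursion and the one-step inequality -/

section

section Recursion

/-- A numerical recursion: contraction with rate `(l + 2 μ) α_k`, `α_k = 2 / (μ (k + 1))`, and noise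
`α_k (μ² + μ⁻¹ (k + 1)^{-s})`. -/
theorem recursion_le {e : ℕ → ℝ} {l μ s E H : ℝ} (hl : 0 < l) (hμ : 0 < μ) (hμ1 : μ ≤ 1)
    (hs : 0 ≤ s) (hs1 : s ≤ 1) (hE : 0 ≤ E) (hH : 0 ≤ H)
    (heE : ∀ k, 1 ≤ k → e k ≤ E)
    (hrec : ∀ k, 1 ≤ k → e (k + 1) ≤ (1 - rate μ k * (l + 2 * μ)) * e k +
      H * rate μ k * (μ ^ 2 + μ⁻¹ * ((k : ℝ) + 1) ^ (-s))) :
    ∀ k, 1 ≤ k → e k ≤ (E * (2 * l + 4) + H / l + E) * (μ ^ 2 + μ⁻¹ * (k : ℝ) ^ (-s)) := by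
  set C := E * (2 * l + 4) + H / l + E with hC
  have hC0 : 0 ≤ C := by positivity
  have hCE : E * (2 * l + 4) ≤ C := by
    have : 0 ≤ H / l := by positivity
    linarith
  intro k hk
  induction k, hk using Nat.le_induction with
  | base =>
    have h1 : 1 ≤ μ⁻¹ := (one_le_inv₀ hμ).2 hμ1
    have h2 : E ≤ C := by
      have : 0 ≤ H / l := by positivity
      have : 0 ≤ E * (2 * l + 4) := by positivity
      linarith
    simp only [Nat.cast_one, Real.one_rpow, mul_one]
    calc e 1 ≤ E := heE 1 le_rfl
      _ ≤ C * 1 := by linarith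
      _ ≤ C * (μ ^ 2 + μ⁻¹) := by
        gcongr
        nlinarith [sq_nonneg μ]
  | succ k hk ih =>
    have hk0 : (0 : ℝ) < k := by exact_mod_cast hk
    have hk1 : (0 : ℝ) < (k : ℝ) + 1 := by positivity
    set α := rate μ k with hα
    have hα' : α = 2 / (μ * ((k : ℝ) + 1)) := rfl
    have hα0 : 0 < α := by
      rw [hα']
      positivity
    have hμα : 2 * μ * α = 4 / ((k : ℝ) + 1) := by
      rw [hα']
      field_simp
      ring
    set p := μ⁻¹ * (k : ℝ) ^ (-s) with hp
    set p' := μ⁻¹ * ((k : ℝ) + 1) ^ (-s) with hp'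
    have hp0 : 0 < p := by positivity
    have hp0' : 0 < p' := by positivity
    push_cast
    rw [← hp']
    -- For early k the factor 1 - α(l + 2μ) may be negative and the recursion is useless. But then
    -- μ(k+1) ≤ 2l + 4, so p' ≥ 1/(2l + 4) and the a priori bound E is enough; hence the term E(2l +
    -- 4) in C.
    by_cases hcase : 1 ≤ α * (l + 2 * μ)
    · have h1 : (k : ℝ) + 1 ≤ (2 * l + 4) / μ := by
        rw [hα', div_mul_eq_mul_div, le_div_iff₀ (by positivity)] at hcase
        rw [le_div_iff₀ hμ]
        nlinarith
      have h2 : ((k : ℝ) + 1) ^ s ≤ (k : ℝ) + 1 := by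
        calc _ ≤ ((k : ℝ) + 1) ^ (1 : ℝ) := Real.rpow_le_rpow_of_exponent_le (by linarith) hs1
          _ = _ := Real.rpow_one _
      have h3 : 1 ≤ (2 * l + 4) * p' := by
        rw [hp', Real.rpow_neg hk1.le, ← mul_inv]
        have h4 : μ * ((k : ℝ) + 1) ^ s ≤ 2 * l + 4 := by
          calc _ ≤ μ * ((2 * l + 4) / μ) := by
                gcongr
                exact h2.trans h1
            _ = _ := by field_simp
        rw [← div_eq_mul_inv, le_div_iff₀ (by positivity), one_mul]
        exact h4
      calc e (k + 1) ≤ E := heE _ (by omega)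
        _ ≤ E * ((2 * l + 4) * p') := le_mul_of_one_le_right hE h3
        _ = E * (2 * l + 4) * p' := by ring
        _ ≤ C * (μ ^ 2 + p') := by
          gcongr
          nlinarith [sq_nonneg μ]
    · push Not at hcase
      -- Equivalent to the monotonicity of k^{1-s}, which is where s ≤ 1 enters.
      have hpp : (1 - 1 / ((k : ℝ) + 1)) * p ≤ p' := by
        have h1 : (k : ℝ) ^ (1 - s) ≤ ((k : ℝ) + 1) ^ (1 - s) :=
          Real.rpow_le_rpow hk0.le (by linarith) (by linarith)
        have h2 : (k : ℝ) ^ (1 - s) = k * (k : ℝ) ^ (-s) := by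
          rw [sub_eq_add_neg, Real.rpow_add hk0, Real.rpow_one]
        have h3 : ((k : ℝ) + 1) ^ (1 - s) = ((k : ℝ) + 1) * ((k : ℝ) + 1) ^ (-s) := by
          rw [sub_eq_add_neg, Real.rpow_add hk1, Real.rpow_one]
        rw [h2, h3] at h1
        have h4 : 1 - 1 / ((k : ℝ) + 1) = k / ((k : ℝ) + 1) := by
          field_simp
          ring
        rw [h4, hp, hp', div_mul_eq_mul_div, div_le_iff₀ hk1]
        calc (k : ℝ) * (μ⁻¹ * (k : ℝ) ^ (-s)) = μ⁻¹ * (k * (k : ℝ) ^ (-s)) := by ring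
          _ ≤ μ⁻¹ * (((k : ℝ) + 1) * ((k : ℝ) + 1) ^ (-s)) := by gcongr
          _ = _ := by ring
      have hp_anti : p' ≤ p := by
        rw [hp, hp']
        gcongr ?_ * ?_
        exact Real.rpow_le_rpow_of_nonpos hk0 (by linarith) (by linarith)
      have hdiv : 1 / ((k : ℝ) + 1) * p ≤ 4 / ((k : ℝ) + 1) * p := by
        gcongr
        norm_num
      -- The part 2μα = 4/(k+1) of the contraction is spent on passing from p to p'. The part αl
      -- remains, and absorbs the noise since H ≤ C l.
      have hcontr : (1 - α * (l + 2 * μ)) * (μ ^ 2 + p) ≤ (1 - α * l) * (μ ^ 2 + p') := by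
        have e1 : α * (l + 2 * μ) = α * l + 4 / ((k : ℝ) + 1) := by
          rw [← hμα]
          ring
        rw [e1]
        have h5 : 0 ≤ 4 / ((k : ℝ) + 1) * μ ^ 2 := by positivity
        have h6 : α * l * p' ≤ α * l * p := by gcongr
        nlinarith
      have hHC : H ≤ C * l := by
        rw [hC, add_mul, add_mul, div_mul_cancel₀ _ hl.ne']
        have h7 : 0 ≤ E * (2 * l + 4) * l := by positivity
        have h8 : 0 ≤ E * l := by positivity
        linarith
      calc e (k + 1) ≤ (1 - α * (l + 2 * μ)) * e k + H * α * (μ ^ 2 + p') := hrec k hk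
        _ ≤ (1 - α * (l + 2 * μ)) * (C * (μ ^ 2 + p)) + H * α * (μ ^ 2 + p') := by
          have : 0 ≤ 1 - α * (l + 2 * μ) := by linarith
          gcongr
        _ = C * ((1 - α * (l + 2 * μ)) * (μ ^ 2 + p)) + H * α * (μ ^ 2 + p') := by ring
        _ ≤ C * ((1 - α * l) * (μ ^ 2 + p')) + (C * l) * α * (μ ^ 2 + p') := by gcongr
        _ = _ := by ring

end Recursion

section OneStep

variable {q : ℕ} {Ω : Type*} [MeasurableSpace Ω] {P : Measure Ω}

theorem abs_coord_le_norm (x : Vec q) (i : Fin q) : |x i| ≤ ‖x‖ := PiLp.norm_apply_le x i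

/-- One step of the iteration, before projection and from a deterministic parameter. -/
theorem UpdateBound.integral_step_le [IsProbabilityMeasure P] {A : Fin q → Fin q → ℝ}
    {c : Fin q → ℝ} {Φ U : Ω → Vec q} {R : Ω → ℝ} {B β V : ℝ} (h : UpdateBound P A c Φ U R B β V)
    (hB : 0 ≤ B) {l : ℝ} (hl : 0 < l)
    (hA : ∀ η : Vec q, l * ‖η‖ ^ 2 ≤ ∑ i, ∑ j, η i * A i j * η j) {θs : Vec q}
    (hθs : ∀ i, ∑ j, A i j * θs j = c i) {θ : Vec q} {N μ α : ℝ} (hN : ‖θ‖ ≤ N) (hNs : ‖θs‖ ≤ N)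
    (hμ : 0 ≤ μ) (hα : 0 ≤ α) :
    Integrable (fun ω => ‖θ - α • ((inner ℝ θ (U ω) - R ω) • Φ ω + μ • θ) - θs‖ ^ 2) P ∧
    ∫ ω, ‖θ - α • ((inner ℝ θ (U ω) - R ω) • Φ ω + μ • θ) - θs‖ ^ 2 ∂P ≤
      (1 - α * (l + 2 * μ)) * ‖θ - θs‖ ^ 2 + α * ((β * q * (1 + q * N) + μ * N) ^ 2 / l) +
        α ^ 2 * (4 * B ^ 2 * N ^ 2 * V + 4 * B ^ 4 + 2 * μ ^ 2 * N ^ 2) := by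
  set η := θ - θs with hη
  have hN0 : 0 ≤ N := (norm_nonneg _).trans hN
  have mΦ := h.measurable_feature
  have mU := h.measurable_vec
  have mR := h.measurable_reward
  have iU2 := h.integrable_vec
  have iU1 : Integrable (fun ω => ‖U ω‖) P :=
    ((integrable_const (1 : ℝ)).add iU2).mono' mU.norm.aestronglyMeasurable
      (.of_forall fun ω => by
      simp only [norm_norm, Pi.add_apply]
      nlinarith [sq_nonneg (‖U ω‖ - 1)])
  have mco : ∀ i : Fin q, Measurable fun y : Vec q => y i := fun i =>
    Continuous.measurable (by fun_prop)
  have iΦU : ∀ i j, Integrable (fun ω => Φ ω i * U ω j) P := fun i j => by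
    refine Integrable.bdd_mul (c := B) ?_ ((mco i).comp mΦ).aestronglyMeasurable
      (.of_forall fun ω => (PiLp.norm_apply_le (Φ ω) i).trans (h.norm_feature_le ω))
    exact iU1.mono' ((mco j).comp mU).aestronglyMeasurable
      (.of_forall fun ω => PiLp.norm_apply_le (U ω) j)
  have iR : Integrable R P := Integrable.of_bound (C := B) mR.aestronglyMeasurable h.abs_reward_le
  have iRΦ : ∀ i, Integrable (fun ω => R ω * Φ ω i) P := fun i =>
    (iR.bdd_mul ((mco i).comp mΦ).aestronglyMeasurable (c := B)
      (.of_forall fun ω => (PiLp.norm_apply_le (Φ ω) i).trans (h.norm_feature_le ω))).congr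
      (.of_forall fun ω => mul_comm _ _)
  set g : Ω → Vec q := fun ω => (inner ℝ θ (U ω) - R ω) • Φ ω + μ • θ with hg
  have mg : Measurable g := by fun_prop
  -- the linear term
  have hlin : ∀ ω, inner ℝ η (g ω) = (∑ i, ∑ j, η i * θ j * (Φ ω i * U ω j)) -
      (∑ i, η i * (R ω * Φ ω i)) + μ * inner ℝ η θ := by
    intro ω
    simp only [hg, inner_add_right, inner_smul_right]
    congr 1
    have e1 : inner ℝ θ (U ω) = ∑ j, θ j * U ω j := by
      simp [PiLp.inner_apply, mul_comm]
    have e2 : inner ℝ η (Φ ω) = ∑ i, η i * Φ ω i := by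
      simp [PiLp.inner_apply, mul_comm]
    rw [e1, e2, sub_mul, Finset.mul_sum, Finset.mul_sum]
    congr 1
    · refine Finset.sum_congr rfl fun i _ => ?_
      rw [Finset.sum_mul]
      exact Finset.sum_congr rfl fun j _ => by ring
    · exact Finset.sum_congr rfl fun i _ => by ring
  have iS1 : Integrable (fun ω => ∑ i, ∑ j, η i * θ j * (Φ ω i * U ω j)) P :=
    integrable_finsetSum _ fun i _ => integrable_finsetSum _ fun j _ => (iΦU i j).const_mul _
  have iS2 : Integrable (fun ω => ∑ i, η i * (R ω * Φ ω i)) P :=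
    integrable_finsetSum _ fun i _ => (iRΦ i).const_mul _
  have iS12 : Integrable (fun ω => (∑ i, ∑ j, η i * θ j * (Φ ω i * U ω j)) -
      ∑ i, η i * (R ω * Φ ω i)) P := iS1.sub iS2
  have ilin : Integrable (fun ω => inner ℝ η (g ω)) P := by
    simp only [hlin]
    exact iS12.add (integrable_const _)
  have hmean : ∫ ω, inner ℝ η (g ω) ∂P =
      (∑ i, ∑ j, η i * θ j * ∫ ω, Φ ω i * U ω j ∂P) - (∑ i, η i * ∫ ω, R ω * Φ ω i ∂P) +
        μ * inner ℝ η θ := by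
    simp only [hlin]
    rw [integral_add_const_prob iS12, integral_sub iS1 iS2,
      integral_finsetSum _ fun i _ => integrable_finsetSum _ fun j _ => (iΦU i j).const_mul _,
      integral_finsetSum _ fun i _ => (iRΦ i).const_mul _]
    congr 2
    · refine Finset.sum_congr rfl fun i _ => ?_
      rw [integral_finsetSum _ fun j _ => (iΦU i j).const_mul _]
      exact Finset.sum_congr rfl fun j _ => integral_const_mul _ _
    · exact Finset.sum_congr rfl fun i _ => integral_const_mul _ _
  have hηi : ∀ i, |η i| ≤ ‖η‖ := abs_coord_le_norm η
  have hθi : ∀ i, |θ i| ≤ N := fun i => (abs_coord_le_norm θ i).trans hN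
  -- Since Aθ* = c, the unbiased part of the mean update, tested against η = θ - θ*, is ηᵀAη.
  have hmeanA : (∑ i, ∑ j, η i * θ j * A i j) - (∑ i, η i * c i) =
      ∑ i, ∑ j, η i * A i j * η j := by
    rw [← Finset.sum_sub_distrib]
    refine Finset.sum_congr rfl fun i _ => ?_
    rw [← hθs i, Finset.mul_sum, ← Finset.sum_sub_distrib]
    refine Finset.sum_congr rfl fun j _ => ?_
    simp only [hη, PiLp.sub_apply]
    ring
  have herr1 : |(∑ i, ∑ j, η i * θ j * ∫ ω, Φ ω i * U ω j ∂P) - ∑ i, ∑ j, η i * θ j * A i j| ≤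
      q * (q * (‖η‖ * N * β)) := by
    rw [← Finset.sum_sub_distrib]
    refine (Finset.abs_sum_le_sum_abs _ _).trans ?_
    refine (Finset.sum_le_card_nsmul _ _ (q * (‖η‖ * N * β)) fun i _ => ?_).trans (by simp)
    rw [← Finset.sum_sub_distrib]
    refine (Finset.abs_sum_le_sum_abs _ _).trans ?_
    refine (Finset.sum_le_card_nsmul _ _ (‖η‖ * N * β) fun j _ => ?_).trans (by simp)
    rw [← mul_sub, abs_mul, abs_mul]
    gcongr
    · exact hηi i
    · exact hθi j
    · exact h.mean_mul_le i j
  have herr2 : |(∑ i, η i * ∫ ω, R ω * Φ ω i ∂P) - ∑ i, η i * c i| ≤ q * (‖η‖ * β) := by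
    rw [← Finset.sum_sub_distrib]
    refine (Finset.abs_sum_le_sum_abs _ _).trans ?_
    refine (Finset.sum_le_card_nsmul _ _ (‖η‖ * β) fun i _ => ?_).trans (by simp)
    rw [← mul_sub, abs_mul]
    gcongr
    · exact hηi i
    · exact h.mean_reward_le i
  -- The regularisation pulls towards 0, not θ*; the discrepancy is of size |θ*| ≤ N and becomes the
  -- μN in the bias.
  have hinner : ‖η‖ ^ 2 - N * ‖η‖ ≤ inner ℝ η θ := by
    have e1 : inner ℝ η θ = ‖η‖ ^ 2 + inner ℝ η θs := by
      rw [← real_inner_self_eq_norm_sq, ← inner_add_right]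
      congr 1
      simp [hη]
    have e2 := abs_real_inner_le_norm η θs
    have e3 : ‖η‖ * ‖θs‖ ≤ ‖η‖ * N := by gcongr
    have e4 := neg_abs_le (inner ℝ η θs)
    rw [e1]
    linarith
  have hmean_ge : l * ‖η‖ ^ 2 + μ * ‖η‖ ^ 2 - (β * q * (1 + q * N) + μ * N) * ‖η‖ ≤
      ∫ ω, inner ℝ η (g ω) ∂P := by
    rw [hmean]
    have h1 := hA η
    have h2 : μ * (‖η‖ ^ 2 - N * ‖η‖) ≤ μ * inner ℝ η θ := by gcongr
    have h3 := neg_abs_le ((∑ i, ∑ j, η i * θ j * ∫ ω, Φ ω i * U ω j ∂P) -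
      ∑ i, ∑ j, η i * θ j * A i j)
    have h4 := le_abs_self ((∑ i, η i * ∫ ω, R ω * Φ ω i ∂P) - ∑ i, η i * c i)
    linarith
  -- the quadratic term
  have hgsq : ∀ᵐ ω ∂P, ‖g ω‖ ^ 2 ≤ 4 * B ^ 2 * N ^ 2 * ‖U ω‖ ^ 2 +
      (4 * B ^ 4 + 2 * μ ^ 2 * N ^ 2) := by
    filter_upwards [h.abs_reward_le] with ω hω
    have h1 : |inner ℝ θ (U ω) - R ω| ≤ N * ‖U ω‖ + B := by
      refine (abs_sub _ _).trans (add_le_add ((abs_real_inner_le_norm _ _).trans ?_) hω)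
      gcongr
    calc ‖g ω‖ ^ 2 ≤ ((N * ‖U ω‖ + B) * B + μ * N) ^ 2 := by
          gcongr
          refine (norm_add_le _ _).trans (add_le_add ?_ ?_)
          · rw [norm_smul]
            exact mul_le_mul h1 (h.norm_feature_le ω) (norm_nonneg _) (by positivity)
          · rw [norm_smul, Real.norm_of_nonneg hμ]
            gcongr
      _ ≤ 2 * ((N * ‖U ω‖ + B) * B) ^ 2 + 2 * (μ * N) ^ 2 := add_sq_le_two_mul _ _
      _ = 2 * B ^ 2 * (N * ‖U ω‖ + B) ^ 2 + 2 * (μ * N) ^ 2 := by ring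
      _ ≤ 2 * B ^ 2 * (2 * (N * ‖U ω‖) ^ 2 + 2 * B ^ 2) + 2 * (μ * N) ^ 2 := by
          gcongr
          exact add_sq_le_two_mul _ _
      _ = _ := by ring
  have ibd : Integrable (fun ω => 4 * B ^ 2 * N ^ 2 * ‖U ω‖ ^ 2 +
      (4 * B ^ 4 + 2 * μ ^ 2 * N ^ 2)) P := (iU2.const_mul _).add (integrable_const _)
  have igsq : Integrable (fun ω => ‖g ω‖ ^ 2) P :=
    ibd.mono' (mg.norm.pow_const 2).aestronglyMeasurable (hgsq.mono fun ω hω => by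
      rwa [Real.norm_of_nonneg (by positivity)])
  have hgsq_le : ∫ ω, ‖g ω‖ ^ 2 ∂P ≤ 4 * B ^ 2 * N ^ 2 * V + 4 * B ^ 4 + 2 * μ ^ 2 * N ^ 2 := by
    refine (integral_mono_ae igsq ibd hgsq).trans ?_
    rw [integral_add_const_prob (iU2.const_mul _), integral_const_mul, add_assoc]
    gcongr
    exact h.vec_le
  have hexp : ∀ ω, ‖θ - α • g ω - θs‖ ^ 2 =
      ‖η‖ ^ 2 - 2 * α * inner ℝ η (g ω) + α ^ 2 * ‖g ω‖ ^ 2 := by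
    intro ω
    have : θ - α • g ω - θs = η - α • g ω := by
      rw [hη]
      abel
    rw [this, norm_sub_sq_real, inner_smul_right, norm_smul, mul_pow, Real.norm_eq_abs, sq_abs]
    ring
  have i1 : Integrable (fun ω => ‖η‖ ^ 2 - 2 * α * inner ℝ η (g ω)) P :=
    (integrable_const _).sub (ilin.const_mul _)
  have itot : Integrable (fun ω => ‖θ - α • g ω - θs‖ ^ 2) P := by
    simp only [hexp]
    exact i1.add (igsq.const_mul _)
  refine ⟨itot, ?_⟩
  change ∫ ω, ‖θ - α • g ω - θs‖ ^ 2 ∂P ≤ _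
  simp only [hexp]
  rw [integral_add i1 (igsq.const_mul _), integral_sub (integrable_const _) (ilin.const_mul _),
    integral_const, probReal_univ, one_smul, integral_const_mul, integral_const_mul]
  set bb := β * q * (1 + q * N) + μ * N with hbb
  have h1 : α ^ 2 * ∫ ω, ‖g ω‖ ^ 2 ∂P ≤
      α ^ 2 * (4 * B ^ 2 * N ^ 2 * V + 4 * B ^ 4 + 2 * μ ^ 2 * N ^ 2) := by gcongr
  -- Coercivity supplies 2l; half of it is spent on the bias, so the contraction keeps l.
  have h2 : 2 * bb * ‖η‖ ≤ l * ‖η‖ ^ 2 + bb ^ 2 / l := by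
    have h3 : 0 ≤ (l * ‖η‖ - bb) ^ 2 / l := by positivity
    have h4 : (l * ‖η‖ - bb) ^ 2 / l = l * ‖η‖ ^ 2 - 2 * bb * ‖η‖ + bb ^ 2 / l := by
      field_simp
      ring
    linarith
  have h3 : 2 * α * (l * ‖η‖ ^ 2 + μ * ‖η‖ ^ 2 - bb * ‖η‖) ≤ 2 * α * ∫ ω, inner ℝ η (g ω) ∂P := by
    gcongr
  have h4 : α * (2 * bb * ‖η‖) ≤ α * (l * ‖η‖ ^ 2 + bb ^ 2 / l) := by gcongr
  linarith

end OneStep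

end

/-! ### Coercivity and the limit parameter -/

section

variable {d n q : ℕ} {b : Torus d → Vec d} {σ : Torus d → Vec n →L[ℝ] Vec d}

theorem integrable_of_continuous_torus {m : Measure (Torus d)} [IsFiniteMeasure m]
    {f : Torus d → ℝ} (hf : Continuous f) : Integrable f m := by
  obtain ⟨C, -, hC⟩ := exists_bound_of_continuous hf
  exact Integrable.of_bound hf.aestronglyMeasurable C (.of_forall hC)

/-- The generator has mean zero under a stationary measure. -/
theorem IsStationary.integral_gen {m : Measure (Torus d)} (hm : IsStationary b σ m)
    (hb : IsCk 0 b) (hσ : IsCk 0 σ) {f : Torus d → ℝ} (hf : IsCk 2 f) :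
    ∫ x, gen b σ f x ∂m = 0 := by
  obtain ⟨Ω, _, P, Z, hP, hZ, hlaw⟩ := hm
  have hg : Continuous (gen b σ f) := (IsCk.gen (p := 0) hf hb hσ).continuous
  have hmeas : ∀ t, Measurable fun ω => proj (Z t ω) := fun t =>
    continuous_proj.measurable.comp (hZ.measurable t)
  have hint : ∀ {g : Torus d → ℝ}, Continuous g → ∀ t, ∫ ω, g (proj (Z t ω)) ∂P = ∫ x, g x ∂m := by
    intro g hgc t
    rw [← hlaw t, integral_map (hmeas t).aemeasurable hgc.aestronglyMeasurable]
  -- Dynkin on [0, 1] with weight 1: as the law is constant in time, the increment has mean zero and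
  -- the time integral is ∫ gen f dm.
  have h := hZ.dynkin_torus hb.continuous hσ.continuous hf (ψ := fun _ => 1) continuous_const
    zero_le_one
  have hi : ∀ t, Integrable (fun ω => f (proj (Z t ω))) P := fun t => by
    have : IsFiniteMeasure m := by
      rw [← hlaw t]
      infer_instance
    have h1 : Integrable f (P.map fun ω => proj (Z t ω)) := by
      rw [hlaw t]
      exact integrable_of_continuous_torus hf.continuous
    exact h1.comp_measurable (hmeas t)
  simp only [one_mul, hint hg] at h
  rw [integral_sub (hi _) (hi _), hint hf.continuous, hint hf.continuous] at h
  simpa using h.symm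

/-- If the quadratic form vanishes at θ, then θᵀφ is zero almost everywhere, hence everywhere by
continuity and full support, and θ = 0 by independence. Compactness of the unit sphere gives a
uniform constant. -/
theorem exists_integral_sq_ge {φ : Torus d → Vec q} (hφ : Continuous φ)
    (hφ_indep : LinearIndependent ℝ fun (i : Fin q) (x : Torus d) => φ x i)
    {m : Measure (Torus d)} [IsFiniteMeasure m] [m.IsOpenPosMeasure] :
    ∃ l : ℝ, 0 < l ∧ ∀ θ : Vec q, l * ‖θ‖ ^ 2 ≤ ∫ x, (∑ i, θ i * φ x i) ^ 2 ∂m := by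
  have hφi : ∀ i, Continuous fun x => φ x i := fun i => by fun_prop
  set Q : Vec q → ℝ := fun θ => ∫ x, (∑ i, θ i * φ x i) ^ 2 ∂m with hQ
  have hQeq : ∀ θ : Vec q, Q θ = ∑ i, ∑ j, θ i * θ j * ∫ x, φ x i * φ x j ∂m := by
    intro θ
    have hij : ∀ i j, Integrable (fun x => θ i * θ j * (φ x i * φ x j)) m := fun i j =>
      (integrable_of_continuous_torus ((hφi i).mul (hφi j))).const_mul _
    simp only [hQ, sq, Finset.sum_mul_sum]
    calc _ = ∫ x, ∑ i, ∑ j, θ i * θ j * (φ x i * φ x j) ∂m := by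
          refine integral_congr_ae (.of_forall fun x => ?_)
          exact Finset.sum_congr rfl fun i _ => Finset.sum_congr rfl fun j _ => by ring
      _ = _ := by
          rw [integral_finsetSum _ fun i _ => integrable_finsetSum _ fun j _ => hij i j]
          refine Finset.sum_congr rfl fun i _ => ?_
          rw [integral_finsetSum _ fun j _ => hij i j]
          exact Finset.sum_congr rfl fun j _ => integral_const_mul _ _
  have hQc : Continuous Q := by
    rw [funext hQeq]
    fun_prop
  have hQpos : ∀ θ : Vec q, θ ≠ 0 → 0 < Q θ := by
    intro θ hθ
    have hvc : Continuous fun x => ∑ i, θ i * φ x i := by fun_prop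
    have h0 : 0 ≤ Q θ := integral_nonneg fun x => sq_nonneg _
    refine lt_of_le_of_ne h0 fun h => hθ ?_
    have h1 : (fun x => (∑ i, θ i * φ x i) ^ 2) =ᵐ[m] 0 :=
      (integral_eq_zero_iff_of_nonneg (fun x => sq_nonneg _)
        (integrable_of_continuous_torus (hvc.pow 2))).1 h.symm
    have h2 : (fun x => (∑ i, θ i * φ x i) ^ 2) = 0 :=
      Measure.eq_of_ae_eq h1 (hvc.pow 2) continuous_const
    have h3 : ∑ i, θ i • (fun x => φ x i) = 0 := by
      funext x
      have := congrFun h2 x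
      simpa using this
    ext i
    exact Fintype.linearIndependent_iff.1 hφ_indep (fun i => θ i) h3 i
  have hscale : ∀ (t : ℝ) (θ : Vec q), Q (t • θ) = t ^ 2 * Q θ := by
    intro t θ
    simp only [hQ]
    rw [← integral_const_mul]
    refine integral_congr_ae (.of_forall fun x => ?_)
    simp only [PiLp.smul_apply, smul_eq_mul, mul_assoc, ← Finset.mul_sum]
    ring
  by_cases hne : (Metric.sphere (0 : Vec q) 1).Nonempty
  · obtain ⟨θ₀, hθ₀, hmin⟩ := (isCompact_sphere (0 : Vec q) 1).exists_isMinOn hne hQc.continuousOn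
    refine ⟨Q θ₀, hQpos θ₀ ?_, fun θ => ?_⟩
    · rintro rfl
      simp at hθ₀
    · by_cases hθ : θ = 0
      · simp [hθ]
      · have hn : ‖θ‖ ≠ 0 := norm_ne_zero_iff.2 hθ
        have h1 : ‖θ‖⁻¹ • θ ∈ Metric.sphere (0 : Vec q) 1 := by
          simp [norm_smul, hn]
        have h2 : Q θ₀ ≤ Q (‖θ‖⁻¹ • θ) := hmin h1
        rw [hscale] at h2
        calc Q θ₀ * ‖θ‖ ^ 2 ≤ (‖θ‖⁻¹ ^ 2 * Q θ) * ‖θ‖ ^ 2 := by gcongr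
          _ = Q θ := by field_simp
  -- An empty sphere means q = 0, where any constant works.
  · refine ⟨1, one_pos, fun θ => ?_⟩
    have hθ : θ = 0 := by
      by_contra hθ
      exact hne ⟨‖θ‖⁻¹ • θ, by simp [norm_smul, hθ]⟩
    simp [hθ]

/-- Coercivity of the bilinear form `E_m[φ(X) 𝓛φ(X)ᵀ]`. -/
theorem IsStationary.exists_coercive {ρ : ℝ} (hρ : 0 < ρ) (hb : IsCk 0 b) (hσ : IsCk 0 σ)
    {φ : Torus d → Vec q} (hφ : IsCk 2 φ)
    (hφ_indep : LinearIndependent ℝ fun (i : Fin q) (x : Torus d) => φ x i)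
    {m : Measure (Torus d)} [IsFiniteMeasure m] (hm : IsStationary b σ m)
    (hm_supp : m.IsOpenPosMeasure) :
    ∃ l : ℝ, 0 < l ∧ ∀ θ : Vec q, l * ‖θ‖ ^ 2 ≤
      ∑ i, ∑ j, θ i * (∫ x, φ x i * opL ρ b σ (fun y => φ y j) x ∂m) * θ j := by
  obtain ⟨l, hl, hQ⟩ := exists_integral_sq_ge hφ.continuous hφ_indep (m := m)
  refine ⟨ρ * l, by positivity, fun θ => ?_⟩
  have hφi : ∀ i, Continuous fun x => φ x i := fun i => (hφ.coord i).continuous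
  have hgi : ∀ j, Continuous (gen b σ fun y => φ y j) := fun j =>
    (IsCk.gen (p := 0) (hφ.coord j) hb hσ).continuous
  have hLi : ∀ j, Continuous (opL ρ b σ fun y => φ y j) := fun j => by
    simp only [funext (opL_eq ρ (b := b) (σ := σ) fun y => φ y j)]
    exact ((hφi j).const_mul ρ).sub (hgi j)
  set v : Torus d → ℝ := fun x => ∑ i, θ i * φ x i with hv
  have hv2 : IsCk 2 v := IsCk.sum fun i _ => (isCk_const (θ i)).mul (hφ.coord i)
  have hgv : ∀ x, gen b σ v x = ∑ i, θ i * gen b σ (fun y => φ y i) x := fun x =>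
    gen_sum_smul (fun i => hφ.coord i) (fun i => θ i) x
  have hgvc : Continuous (gen b σ v) := (IsCk.gen (p := 0) hv2 hb hσ).continuous
  have hij : ∀ i j, Integrable (fun x => θ i * (φ x i * opL ρ b σ (fun y => φ y j) x) * θ j) m :=
    fun i j => ((integrable_of_continuous_torus ((hφi i).mul (hLi j))).const_mul _).mul_const _
  have e1 : ∑ i, ∑ j, θ i * (∫ x, φ x i * opL ρ b σ (fun y => φ y j) x ∂m) * θ j =
      ∫ x, v x * (ρ * v x - gen b σ v x) ∂m := by
    calc _ = ∫ x, ∑ i, ∑ j, θ i * (φ x i * opL ρ b σ (fun y => φ y j) x) * θ j ∂m := by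
          rw [integral_finsetSum _ fun i _ => integrable_finsetSum _ fun j _ => hij i j]
          refine Finset.sum_congr rfl fun i _ => ?_
          rw [integral_finsetSum _ fun j _ => hij i j]
          refine Finset.sum_congr rfl fun j _ => ?_
          rw [integral_mul_const, integral_const_mul]
      _ = _ := by
          refine integral_congr_ae (.of_forall fun x => ?_)
          simp only [hgv x, opL_eq]
          simp only [hv]
          rw [Finset.mul_sum, ← Finset.sum_sub_distrib, Finset.sum_mul_sum]
          exact Finset.sum_congr rfl fun i _ => Finset.sum_congr rfl fun j _ => by ring
  have h0 := hm.integral_gen hb hσ (hv2.mul hv2)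
  have hvg : Integrable (fun x => v x * gen b σ v x) m :=
    integrable_of_continuous_torus (hv2.continuous.mul hgvc)
  have hvv : Integrable (fun x => v x ^ 2) m :=
    integrable_of_continuous_torus (hv2.continuous.pow 2)
  -- From 2 v gen v ≤ gen(v²), the difference being a sum of squares, and the zero mean of gen(v²).
  -- No reversibility of m is used.
  have h2 : ∫ x, v x * gen b σ v x ∂m ≤ 0 := by
    have h3 : ∫ x, 2 * (v x * gen b σ v x) ∂m ≤ ∫ x, gen b σ (fun x => v x * v x) x ∂m := by
      refine integral_mono (hvg.const_mul 2) (integrable_of_continuous_torus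
        (IsCk.gen (p := 0) (hv2.mul hv2) hb hσ).continuous) fun x => ?_
      rw [gen_mul_self hv2]
      exact le_add_of_nonneg_right (Finset.sum_nonneg fun j _ => sq_nonneg _)
    rw [h0, integral_const_mul] at h3
    linarith
  rw [e1]
  calc ρ * l * ‖θ‖ ^ 2 = ρ * (l * ‖θ‖ ^ 2) := by ring
    _ ≤ ρ * ∫ x, v x ^ 2 ∂m := by
        gcongr
        exact hQ θ
    _ ≤ ρ * (∫ x, v x ^ 2 ∂m) - ∫ x, v x * gen b σ v x ∂m := by linarith
    _ = _ := by
        rw [← integral_const_mul, ← integral_sub (hvv.const_mul _) hvg]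
        refine integral_congr_ae (.of_forall fun x => ?_)
        ring

/-- Coercivity makes the square system injective, hence bijective by dimension. -/
theorem existsUnique_of_coercive {A : Fin q → Fin q → ℝ} {l : ℝ} (hl : 0 < l)
    (hA : ∀ η : Vec q, l * ‖η‖ ^ 2 ≤ ∑ i, ∑ j, η i * A i j * η j) (c : Fin q → ℝ) :
    ∃! θ : Vec q, ∀ i, ∑ j, A i j * θ j = c i := by
  set T : Vec q →ₗ[ℝ] (Fin q → ℝ) :=
    (Matrix.toLin' (Matrix.of A)).comp (WithLp.linearEquiv 2 ℝ (Fin q → ℝ)).toLinearMap with hT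
  have hTa : ∀ θ i, T θ i = ∑ j, A i j * θ j := fun θ i => by
    simp [hT, Matrix.mulVec, dotProduct]
  have hinj : Function.Injective T := by
    rw [injective_iff_map_eq_zero]
    intro θ hθ
    have h1 := hA θ
    have h2 : ∑ i, ∑ j, θ i * A i j * θ j = 0 := by
      refine Finset.sum_eq_zero fun i _ => ?_
      have h3 : ∑ j, A i j * θ j = 0 := by
        rw [← hTa, hθ]
        rfl
      simp only [mul_assoc, ← Finset.mul_sum, h3, mul_zero]
    rw [h2] at h1
    have h4 : ‖θ‖ ^ 2 ≤ 0 := by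
      by_contra h
      push Not at h
      have := mul_pos hl h
      linarith
    exact norm_eq_zero.1 (pow_eq_zero_iff two_ne_zero |>.1 (le_antisymm h4 (sq_nonneg _)))
  have hsurj : Function.Surjective T :=
    (LinearMap.injective_iff_surjective_of_finrank_eq_finrank (by simp)).1 hinj
  obtain ⟨θ, hθ⟩ := hsurj c
  refine ⟨θ, fun i => by rw [← hTa, hθ], fun θ' hθ' => hinj ?_⟩
  funext i
  rw [hTa, hθ' i, hθ]

end

/-! ### Projection onto the ball, and independence along the recursion -/

section

section Projection

variable {q : ℕ}

theorem norm_ballProj_le {M : ℝ} (hM : 0 ≤ M) (x : Vec q) : ‖ballProj M x‖ ≤ M := by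
  unfold ballProj
  split_ifs with h
  · exact h
  · rw [norm_smul, Real.norm_of_nonneg (by positivity)]
    have : ‖x‖ ≠ 0 := fun h0 => h (by rw [h0]; exact hM)
    rw [div_mul_cancel₀ _ this]

/-- Projecting cannot increase the distance to a point of the ball; applied with y = θ*, it removes
the projection from the one-step estimate. -/
theorem norm_ballProj_sub_le {M : ℝ} {y : Vec q} (hy : ‖y‖ ≤ M) (x : Vec q) :
    ‖ballProj M x - y‖ ≤ ‖x - y‖ := by
  unfold ballProj
  split_ifs with h
  · exact le_rfl
  · push Not at h
    have hM : 0 ≤ M := (norm_nonneg y).trans hy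
    have hx : 0 < ‖x‖ := hM.trans_lt h
    set t := M / ‖x‖ with ht
    have ht0 : 0 ≤ t := by positivity
    have ht1 : t ≤ 1 := (div_le_one hx).2 h.le
    have htx : t * ‖x‖ = M := div_mul_cancel₀ _ hx.ne'
    have hin : inner ℝ x y ≤ ‖x‖ * M := (real_inner_le_norm x y).trans (by gcongr)
    refine le_of_sq_le_sq ?_ (norm_nonneg _)
    rw [norm_sub_sq_real, norm_sub_sq_real, norm_smul, Real.norm_of_nonneg ht0, htx,
      real_inner_smul_left]
    have h1 : (1 - t) * inner ℝ x y ≤ (1 - t) * (‖x‖ * M) :=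
      mul_le_mul_of_nonneg_left hin (by linarith)
    have h2 : (1 - t) * (‖x‖ * M) = ‖x‖ * M - M * M := by
      rw [← htx]
      ring
    nlinarith [sq_nonneg (‖x‖ - M)]

theorem measurable_ballProj (M : ℝ) : Measurable (ballProj M : Vec q → Vec q) := by
  unfold ballProj
  refine Measurable.ite (measurableSet_le measurable_norm measurable_const) measurable_id ?_
  fun_prop

end Projection

section Independence

variable {Ω E O : Type*} [MeasurableSpace Ω] [MeasurableSpace E] [MeasurableSpace O]
  {P : Measure Ω}

/-- A random recursion driven by independent variables is independent of the next variable. -/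
theorem measurable_and_indepFun_of_recursion [IsProbabilityMeasure P] {obs : ℕ → Ω → O}
    (hobs : ∀ k, Measurable (obs k)) (hind : iIndepFun obs P) {F : ℕ → E × O → E}
    (hF : ∀ k, Measurable (F k)) {θ : ℕ → Ω → E} {e₀ : E} (h0 : ∀ ω, θ 0 ω = e₀)
    (hθ : ∀ k ω, θ (k + 1) ω = F k (θ k ω, obs k ω)) (k : ℕ) :
    Measurable (θ k) ∧ IndepFun (θ k) (obs k) P := by
  -- The k-th iterate depends on the observations of index strictly below k, hence is independent of
  -- the one of index k.
  have key : ∀ k, ∃ G : ((i : Finset.range k) → O) → E, Measurable G ∧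
      ∀ ω, θ k ω = G fun i => obs i ω := by
    intro k
    induction k with
    | zero => exact ⟨fun _ => e₀, measurable_const, h0⟩
    | succ k ih =>
      obtain ⟨G, hG, hGθ⟩ := ih
      refine ⟨fun y => F k (G fun i => y ⟨i, Finset.mem_range.2
        ((Finset.mem_range.1 i.2).trans k.lt_succ_self)⟩, y ⟨k, Finset.self_mem_range_succ k⟩),
        ?_, fun ω => ?_⟩
      · exact (hF k).comp ((hG.comp (measurable_pi_lambda _ fun i => measurable_pi_apply _)).prodMk
          (measurable_pi_apply _))
      · rw [hθ, hGθ]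
  obtain ⟨G, hG, hGθ⟩ := key k
  have e : θ k = G ∘ fun ω (i : Finset.range k) => obs i ω := funext hGθ
  refine ⟨?_, ?_⟩
  · rw [e]
    exact hG.comp (measurable_pi_lambda _ fun i => hobs i)
  · have h1 := hind.indepFun_finset (Finset.range k) {k} (by simp) hobs
    have h2 := h1.comp hG
      (measurable_pi_apply (⟨k, Finset.mem_singleton_self k⟩ : ({k} : Finset ℕ)))
    rw [e]
    exact h2

/-- Integration of a bounded function of two independent variables, one after the other. -/
theorem integral_le_of_indepFun [IsProbabilityMeasure P] {θ : Ω → E} {Y : Ω → O}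
    (hθ : Measurable θ) (hY : Measurable Y) (hind : IndepFun θ Y P) {g : E × O → ℝ}
    (hg : Measurable g) {c : ℝ} (hgc : ∀ z, |g z| ≤ c) {h : E → ℝ}
    (hh : Integrable (fun ω => h (θ ω)) P) (hle : ∀ ω, ∫ ω', g (θ ω, Y ω') ∂P ≤ h (θ ω)) :
    ∫ ω, g (θ ω, Y ω) ∂P ≤ ∫ ω, h (θ ω) ∂P := by
  have hprod := (indepFun_iff_map_prod_eq_prod_map_map hθ.aemeasurable hY.aemeasurable).1 hind
  have : IsProbabilityMeasure (P.map θ) := Measure.isProbabilityMeasure_map hθ.aemeasurable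
  have : IsProbabilityMeasure (P.map Y) := Measure.isProbabilityMeasure_map hY.aemeasurable
  have hint : Integrable g ((P.map θ).prod (P.map Y)) :=
    Integrable.of_bound hg.aestronglyMeasurable c (.of_forall hgc)
  have e1 : ∫ ω, g (θ ω, Y ω) ∂P = ∫ ω, ∫ ω', g (θ ω, Y ω') ∂P ∂P := by
    have e2 : ∫ ω, g (θ ω, Y ω) ∂P = ∫ z, g z ∂(P.map fun ω => (θ ω, Y ω)) :=
      (integral_map (hθ.prodMk hY).aemeasurable hg.aestronglyMeasurable).symm
    have e3 : ∀ x, ∫ y, g (x, y) ∂(P.map Y) = ∫ ω', g (x, Y ω') ∂P := fun x =>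
      integral_map hY.aemeasurable (hg.comp measurable_prodMk_left).aestronglyMeasurable
    rw [e2, hprod, integral_prod _ hint, integral_map hθ.aemeasurable
      hint.integral_prod_left.aestronglyMeasurable]
    simp only [e3]
  rw [e1]
  refine integral_mono ?_ hh hle
  refine Integrable.of_bound (C := c) ?_ (.of_forall fun ω => abs_integral_le_of_abs_le
    (.of_forall fun _ => hgc _))
  have h1 : StronglyMeasurable fun x : E => ∫ ω', g (x, Y ω') ∂P :=
    (hg.comp (measurable_fst.prodMk (hY.comp measurable_snd))).stronglyMeasurable.integral_prod_right'
  exact (h1.comp_measurable hθ).aestronglyMeasurable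

end Independence

end

/-! ### Mean-square error of the iteration -/

section

/-- The initial parameter is arbitrary and may lie outside the ball; the first projection brings it
in. This is why all estimates start at k = 1 and are uniform in θ₀. -/
theorem norm_regTD0_le {d q : ℕ} {Ω : Type*} {X : ℕ → Ω → Torus d} {φ : Torus d → Vec q}
    {δ : ℕ → Ω → Vec q → ℝ} {μ M : ℝ} {θ₀ : Vec q} {θ : ℕ → Ω → Vec q} (hM : 0 ≤ M)
    (hθ : ∀ k ω, θ k ω = regTD0 φ μ M (rate μ) (fun j => X j ω) (fun j => δ j ω) θ₀ k) {k : ℕ}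
    (hk : 1 ≤ k) (ω : Ω) : ‖θ k ω‖ ≤ M := by
  obtain ⟨k, rfl⟩ := Nat.exists_eq_add_of_le' hk
  rw [hθ, regTD0]
  exact norm_ballProj_le hM _

variable {d q : ℕ} {Ω : Type*} [MeasurableSpace Ω] {P : Measure Ω}
  {X : ℕ → Ω → Torus d} {D : ℕ → Ω → Vec d} {R : ℕ → Ω → ℝ} {φ : Torus d → Vec q}
  {u : ℕ → Torus d → Vec d → Vec q} {δ : ℕ → Ω → Vec q → ℝ} {μ M : ℝ} {θ₀ : Vec q}
  {θ : ℕ → Ω → Vec q}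

theorem measurable_and_indepFun_regTD0 [IsProbabilityMeasure P] (hX : ∀ k, Measurable (X k))
    (hD : ∀ k, Measurable (D k)) (hR : ∀ k, Measurable (R k))
    (h_indep : iIndepFun (fun k ω => (X k ω, D k ω, R k ω)) P) (hφ : Continuous φ)
    (hu : ∀ k, Measurable fun y : Torus d × Vec d => u k y.1 y.2)
    (hδ : ∀ k ω θ, δ k ω θ = inner ℝ θ (u k (X k ω) (D k ω)) - R k ω)
    (hθ : ∀ k ω, θ k ω = regTD0 φ μ M (rate μ) (fun j => X j ω) (fun j => δ j ω) θ₀ k) (k : ℕ) :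
    Measurable (θ k) ∧ IndepFun (θ k) (fun ω => (X k ω, D k ω, R k ω)) P := by
  have mφ := hφ.measurable
  refine measurable_and_indepFun_of_recursion (obs := fun k ω => (X k ω, D k ω, R k ω))
    (F := fun k (z : Vec q × Torus d × Vec d × ℝ) => ballProj M (z.1 - rate μ k •
      ((inner ℝ z.1 (u k z.2.1 z.2.2.1) - z.2.2.2) • φ z.2.1 + μ • z.1)))
    (fun k => (hX k).prodMk ((hD k).prodMk (hR k))) h_indep (fun k => ?_) (e₀ := θ₀)
    (fun ω => hθ 0 ω) (fun k ω => ?_) k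
  · have m1 : Measurable fun z : Vec q × Torus d × Vec d × ℝ => u k z.2.1 z.2.2.1 := by
      have h := (hu k).comp (Measurable.prodMk (measurable_fst.comp measurable_snd)
        (measurable_fst.comp (measurable_snd.comp measurable_snd)) :
          Measurable fun z : Vec q × Torus d × Vec d × ℝ => (z.2.1, z.2.2.1))
      simp only [Function.comp_def] at h
      exact h
    have m2 : Measurable fun z : Vec q × Torus d × Vec d × ℝ => φ z.2.1 :=
      mφ.comp (measurable_fst.comp measurable_snd)
    refine (measurable_ballProj M).comp ?_
    fun_prop
  · simp only [hθ (k + 1), regTD0, ← hθ k ω, hδ]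

theorem integral_regTD0_le [IsProbabilityMeasure P] (hM : 0 ≤ M)
    (hθ : ∀ k ω, θ k ω = regTD0 φ μ M (rate μ) (fun j => X j ω) (fun j => δ j ω) θ₀ k) {k : ℕ}
    (hk : 1 ≤ k) (hmeas : Measurable (θ k)) (θs : Vec q) :
    Integrable (fun ω => ‖θ k ω - θs‖ ^ 2) P ∧
      ∫ ω, ‖θ k ω - θs‖ ^ 2 ∂P ≤ (M + ‖θs‖) ^ 2 := by
  have hle : ∀ ω, |‖θ k ω - θs‖ ^ 2| ≤ (M + ‖θs‖) ^ 2 := fun ω => by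
    rw [abs_of_nonneg (by positivity)]
    gcongr
    exact (norm_sub_le _ _).trans (by gcongr; exact norm_regTD0_le hM hθ hk ω)
  exact ⟨Integrable.of_bound (((hmeas.sub_const θs).norm.pow_const 2).aestronglyMeasurable) _
    (.of_forall hle), (le_abs_self _).trans (abs_integral_le_of_abs_le (.of_forall hle))⟩

/-- Puts the one-step noise in the form used by `recursion_le`. One factor of the squared rate is
written 2μ⁻¹/(k+1), whose product with the variance scale w is at most 2μ⁻¹(k+1)^{-s}; constants
cost 1/(k+1) ≤ (k+1)^{-s}, and the squared bias splits into Δ² and μ². -/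
theorem noise_le {K N l s Δ w a : ℝ} (hK : 0 ≤ K) (hl : 0 < l) (hs1 : s ≤ 1) {k : ℕ} (hΔs : Δ ^ 2 ≤ ((k : ℝ) + 1) ^ (-s))
    (hws : w / ((k : ℝ) + 1) ≤ ((k : ℝ) + 1) ^ (-s)) (hμ : 0 < μ) (hμ1 : μ ≤ 1) :
    rate μ k * ((a * Δ + μ * N) ^ 2 / l) +
      rate μ k ^ 2 * (4 * K ^ 2 * N ^ 2 * (K * w) + 4 * K ^ 4 + 2 * μ ^ 2 * N ^ 2) ≤
    ((2 * a ^ 2 + 2 * N ^ 2) / l + 2 * (4 * K ^ 3 * N ^ 2 + 4 * K ^ 4 + 2 * N ^ 2)) * rate μ k *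
      (μ ^ 2 + μ⁻¹ * ((k : ℝ) + 1) ^ (-s)) := by
  have hk1 : (0 : ℝ) < (k : ℝ) + 1 := by positivity
  set p := ((k : ℝ) + 1) ^ (-s) with hp
  have hp0 : 0 < p := by positivity
  have hα0 : 0 < rate μ k := by
    unfold rate
    positivity
  have hμi : 1 ≤ μ⁻¹ := (one_le_inv₀ hμ).2 hμ1
  have hk : 1 / ((k : ℝ) + 1) ≤ p := by
    rw [hp, one_div, ← Real.rpow_neg_one]
    exact Real.rpow_le_rpow_of_exponent_le (by linarith [(Nat.cast_nonneg k : (0 : ℝ) ≤ k)])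
      (by linarith)
  have h1 : (a * Δ + μ * N) ^ 2 ≤ (2 * a ^ 2 + 2 * N ^ 2) * (μ ^ 2 + μ⁻¹ * p) := by
    have h2 : p ≤ μ⁻¹ * p := le_mul_of_one_le_left hp0.le hμi
    calc _ ≤ 2 * (a * Δ) ^ 2 + 2 * (μ * N) ^ 2 := add_sq_le_two_mul _ _
      _ = 2 * a ^ 2 * Δ ^ 2 + 2 * N ^ 2 * μ ^ 2 := by ring
      _ ≤ 2 * a ^ 2 * (μ ^ 2 + μ⁻¹ * p) + 2 * N ^ 2 * (μ ^ 2 + μ⁻¹ * p) := by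
          have : 0 ≤ μ ^ 2 := sq_nonneg μ
          gcongr
          · linarith
          · linarith
      _ = _ := by ring
  have h3 : rate μ k * (4 * K ^ 2 * N ^ 2 * (K * w) + 4 * K ^ 4 + 2 * μ ^ 2 * N ^ 2) ≤
      2 * (4 * K ^ 3 * N ^ 2 + 4 * K ^ 4 + 2 * N ^ 2) * (μ⁻¹ * p) := by
    have hμ2 : μ ^ 2 ≤ 1 := pow_le_one₀ hμ.le hμ1
    calc _ = 2 * μ⁻¹ * (4 * K ^ 3 * N ^ 2 * (w / ((k : ℝ) + 1)) +
            4 * K ^ 4 * (1 / ((k : ℝ) + 1)) + 2 * N ^ 2 * (μ ^ 2 * (1 / ((k : ℝ) + 1)))) := by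
          unfold rate
          field_simp
      _ ≤ 2 * μ⁻¹ * (4 * K ^ 3 * N ^ 2 * p + 4 * K ^ 4 * p + 2 * N ^ 2 * (1 * p)) := by
          gcongr
      _ = _ := by ring
  calc _ ≤ rate μ k * ((2 * a ^ 2 + 2 * N ^ 2) * (μ ^ 2 + μ⁻¹ * p) / l) +
        rate μ k * (2 * (4 * K ^ 3 * N ^ 2 + 4 * K ^ 4 + 2 * N ^ 2) * (μ⁻¹ * p)) := by
        rw [sq (rate μ k), mul_assoc (rate μ k)]
        gcongr
    _ ≤ rate μ k * ((2 * a ^ 2 + 2 * N ^ 2) * (μ ^ 2 + μ⁻¹ * p) / l) +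
        rate μ k * (2 * (4 * K ^ 3 * N ^ 2 + 4 * K ^ 4 + 2 * N ^ 2) * (μ ^ 2 + μ⁻¹ * p)) := by
        gcongr
        exact le_add_of_nonneg_left (sq_nonneg μ)
    _ = _ := by ring

/-- By independence the one-step inequality can be applied with θ_k frozen and then averaged; the
result feeds the scalar recursion. The constant depends on the upper bound N of the radius, not on
μ, M or θ₀. -/
theorem exists_integral_regTD0_le [IsProbabilityMeasure P] (hX : ∀ k, Measurable (X k))
    (hD : ∀ k, Measurable (D k)) (hR : ∀ k, Measurable (R k))
    (h_indep : iIndepFun (fun k ω => (X k ω, D k ω, R k ω)) P) (hφ : Continuous φ)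
    (hu : ∀ k, Measurable fun y : Torus d × Vec d => u k y.1 y.2)
    (hδ : ∀ k ω θ, δ k ω θ = inner ℝ θ (u k (X k ω) (D k ω)) - R k ω)
    {A : Fin q → Fin q → ℝ} {c : Fin q → ℝ} {l : ℝ} (hl : 0 < l)
    (hA : ∀ η : Vec q, l * ‖η‖ ^ 2 ≤ ∑ i, ∑ j, η i * A i j * η j) {θs : Vec q}
    (hθs : ∀ i, ∑ j, A i j * θs j = c i) {K s : ℝ} (hK : 0 ≤ K) {Δ w : ℕ → ℝ}
    (hs : 0 ≤ s) (hs1 : s ≤ 1)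
    (hΔs : ∀ k : ℕ, Δ k ^ 2 ≤ ((k : ℝ) + 1) ^ (-s))
    (hws : ∀ k : ℕ, w k / ((k : ℝ) + 1) ≤ ((k : ℝ) + 1) ^ (-s))
    (hUB : ∀ k, UpdateBound P A c (fun ω => φ (X k ω)) (fun ω => u k (X k ω) (D k ω)) (R k) K
      (K * Δ k) (K * w k)) (N : ℝ) :
    ∃ C : ℝ, 0 ≤ C ∧ ∀ (μ M : ℝ), 0 < μ → μ ≤ 1 → ‖θs‖ ≤ M → M ≤ N → ∀ (θ₀ : Vec q)
      (θ : ℕ → Ω → Vec q),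
      (∀ k ω, θ k ω = regTD0 φ μ M (rate μ) (fun j => X j ω) (fun j => δ j ω) θ₀ k) →
      ∀ k, 1 ≤ k → ∫ ω, ‖θ k ω - θs‖ ^ 2 ∂P ≤ C * (μ ^ 2 + μ⁻¹ * (k : ℝ) ^ (-s)) := by
  -- A negative N leaves no admissible radius.
  by_cases hN : 0 ≤ N
  swap
  · exact ⟨0, le_rfl, fun μ M _ _ h1 h2 => absurd (((norm_nonneg _).trans h1).trans h2) hN⟩
  set a := K * q * (1 + q * N) with ha
  have ha0 : 0 ≤ a := by positivity
  set H := (2 * a ^ 2 + 2 * N ^ 2) / l + 2 * (4 * K ^ 3 * N ^ 2 + 4 * K ^ 4 + 2 * N ^ 2) with hH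
  have hH0 : 0 ≤ H := by positivity
  set E := (N + ‖θs‖) ^ 2 with hE
  have hE0 : 0 ≤ E := by positivity
  refine ⟨E * (2 * l + 4) + H / l + E, by positivity, fun μ M hμ hμ1 hsM hMN θ₀ θ hθ => ?_⟩
  have hM0 : 0 ≤ M := (norm_nonneg _).trans hsM
  have hmeas := measurable_and_indepFun_regTD0 (P := P) hX hD hR h_indep hφ hu hδ hθ
  refine recursion_le (e := fun k => ∫ ω, ‖θ k ω - θs‖ ^ 2 ∂P) hl hμ hμ1 hs hs1 hE0 hH0
    (fun k hk => ?_) fun k hk => ?_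
  · refine (integral_regTD0_le hM0 hθ hk (hmeas k).1 θs).2.trans ?_
    rw [hE]
    gcongr
  · set α := rate μ k with hα
    have hα0 : 0 ≤ α := by
      rw [hα]
      unfold rate
      positivity
    set g : Vec q × Torus d × Vec d × ℝ → Vec q := fun z => ballProj M (z.1 - α •
      ((inner ℝ z.1 (u k z.2.1 z.2.2.1) - z.2.2.2) • φ z.2.1 + μ • z.1)) with hg
    have mg : Measurable g := by
      have m1 : Measurable fun z : Vec q × Torus d × Vec d × ℝ => u k z.2.1 z.2.2.1 := by
        have h := (hu k).comp (Measurable.prodMk (measurable_fst.comp measurable_snd)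
          (measurable_fst.comp (measurable_snd.comp measurable_snd)) :
            Measurable fun z : Vec q × Torus d × Vec d × ℝ => (z.2.1, z.2.2.1))
        simp only [Function.comp_def] at h
        exact h
      have m2 : Measurable fun z : Vec q × Torus d × Vec d × ℝ => φ z.2.1 :=
        hφ.measurable.comp (measurable_fst.comp measurable_snd)
      refine (measurable_ballProj M).comp ?_
      fun_prop
    have hstep : ∀ ω, θ (k + 1) ω = g (θ k ω, X k ω, D k ω, R k ω) := fun ω => by
      simp only [hθ (k + 1), regTD0, ← hθ k ω, hδ, hg, hα]
    have hgle : ∀ z, ‖g z - θs‖ ≤ M + ‖θs‖ := fun z =>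
      (norm_sub_le _ _).trans (add_le_add_left (norm_ballProj_le hM0 _) _)
    have hbd := noise_le (a := a) (N := N) (k := k) hK hl hs1 (hΔs k) (hws k) hμ hμ1
    rw [← hα, ← hH] at hbd
    set noise := H * α * (μ ^ 2 + μ⁻¹ * ((k : ℝ) + 1) ^ (-s)) with hnoise
    have iθ := (integral_regTD0_le (P := P) hM0 hθ hk (hmeas k).1 θs).1
    have h1 := integral_le_of_indepFun (P := P) (hmeas k).1
      ((hX k).prodMk ((hD k).prodMk (hR k))) (hmeas k).2
      (g := fun z => ‖g z - θs‖ ^ 2) ((mg.sub_const θs).norm.pow_const 2) (c := (M + ‖θs‖) ^ 2)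
      (fun z => by
        rw [abs_of_nonneg (by positivity)]
        gcongr
        exact hgle z)
      (h := fun e => (1 - α * (l + 2 * μ)) * ‖e - θs‖ ^ 2 + noise)
      ((iθ.const_mul _).add (integrable_const _))
      (fun ω => by
        have h2 := (hUB k).integral_step_le hK hl hA hθs (θ := θ k ω) (N := N) (μ := μ) (α := α)
          ((norm_regTD0_le hM0 hθ hk ω).trans hMN) (hsM.trans hMN) hμ.le hα0
        have h3 : K * Δ k * q * (1 + q * N) = a * Δ k := by
          rw [ha]
          ring
        rw [h3] at h2
        have h4 : ∫ ω', ‖g (θ k ω, X k ω', D k ω', R k ω') - θs‖ ^ 2 ∂P ≤ _ :=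
          integral_mono (Integrable.of_bound (C := (M + ‖θs‖) ^ 2)
            (((mg.comp (measurable_const.prodMk ((hX k).prodMk ((hD k).prodMk
              (hR k))))).sub_const θs).norm.pow_const 2).aestronglyMeasurable
            (.of_forall fun ω' => by
              rw [Real.norm_of_nonneg (by positivity)]
              gcongr
              exact hgle _)) h2.1 fun ω' =>
                pow_le_pow_left₀ (norm_nonneg _) (norm_ballProj_sub_le hsM _) 2
        linarith [h4.trans h2.2])
    simp only [← hstep] at h1
    refine h1.trans (le_of_eq ?_)
    rw [integral_add_const_prob (iθ.const_mul _), integral_const_mul]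

end

/-! ### Choice of the regularisation, and uniform constants -/

section

section Rate

variable {d q : ℕ} {Ω : Type*} [MeasurableSpace Ω] {P : Measure Ω}
  {X : ℕ → Ω → Torus d} {D : ℕ → Ω → Vec d} {R : ℕ → Ω → ℝ} {φ : Torus d → Vec q}
  {u : ℕ → Torus d → Vec d → Vec q} {δ : ℕ → Ω → Vec q → ℝ}

/-- Convergence rate of the regularised iterations with `μ = K^{-γ}`. -/
theorem exists_integral_regTD0_le_rpow [IsProbabilityMeasure P] (hX : ∀ k, Measurable (X k))
    (hD : ∀ k, Measurable (D k)) (hR : ∀ k, Measurable (R k))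
    (h_indep : iIndepFun (fun k ω => (X k ω, D k ω, R k ω)) P) (hφ : Continuous φ)
    (hu : ∀ k, Measurable fun y : Torus d × Vec d => u k y.1 y.2)
    (hδ : ∀ k ω θ, δ k ω θ = inner ℝ θ (u k (X k ω) (D k ω)) - R k ω)
    {A : Fin q → Fin q → ℝ} {c : Fin q → ℝ} {l : ℝ} (hl : 0 < l)
    (hA : ∀ η : Vec q, l * ‖η‖ ^ 2 ≤ ∑ i, ∑ j, η i * A i j * η j) {θs : Vec q}
    (hθs : ∀ i, ∑ j, A i j * θs j = c i) {B s γ S : ℝ} (hB : 0 ≤ B) {Δ w : ℕ → ℝ}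
    (hs : 0 ≤ s) (hs1 : s ≤ 1)
    (hΔs : ∀ k : ℕ, Δ k ^ 2 ≤ ((k : ℝ) + 1) ^ (-s))
    (hws : ∀ k : ℕ, w k / ((k : ℝ) + 1) ≤ ((k : ℝ) + 1) ^ (-s))
    (hUB : ∀ k, UpdateBound P A c (fun ω => φ (X k ω)) (fun ω => u k (X k ω) (D k ω)) (R k) B
      (B * Δ k) (B * w k)) (hγ : 0 ≤ γ) (hγs : 3 * γ ≤ s) (hS0 : 0 ≤ S)
    (hS : θs ≠ 0 → 0 < S) (M' : ℝ) :
    ∃ C > 0, ∀ K : ℕ, 2 ≤ K → ∀ μ : ℝ, μ = (K : ℝ) ^ (-γ) →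
      ∀ M : ℝ, min ‖θs‖ (μ⁻¹ * S) ≤ M → M ≤ M' → ∀ (θ₀ : Vec q) (θ : ℕ → Ω → Vec q),
      (∀ k ω, θ k ω = regTD0 φ μ M (rate μ) (fun j => X j ω) (fun j => δ j ω) θ₀ k) →
      Integrable (fun ω => ‖θ K ω - θs‖ ^ 2) P ∧
        ∫ ω, ‖θ K ω - θs‖ ^ 2 ∂P ≤ C / (K : ℝ) ^ (2 * γ) := by
  obtain ⟨C, hC0, hC⟩ := exists_integral_regTD0_le hX hD hR h_indep hφ hu hδ hl hA hθs hB hs hs1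
    hΔs hws hUB M'
  -- When the ball contains θ*, both μ² and μ⁻¹K^{-s} are at most K^{-2γ}, whence 2C. The second
  -- term serves balls that miss θ*; its value when S = 0 is irrelevant, as that case then does not
  -- occur. The 1 ensures positivity.
  refine ⟨2 * C + (M' + ‖θs‖) ^ 2 * (‖θs‖ / S) ^ 2 + 1, by positivity,
    fun K hK μ hμ M hM hMM' θ₀ θ hθ => ?_⟩
  have hK1 : (1 : ℝ) ≤ K := by exact_mod_cast (by omega : 1 ≤ K)
  have hK0 : (0 : ℝ) < K := by linarith
  have hμ0 : 0 < μ := by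
    rw [hμ]
    positivity
  have hμ1 : μ ≤ 1 := by
    rw [hμ]
    exact Real.rpow_le_one_of_one_le_of_nonpos hK1 (by linarith)
  have hμi : μ⁻¹ = (K : ℝ) ^ γ := by
    rw [hμ, Real.rpow_neg hK0.le, inv_inv]
  have hK2 : (K : ℝ) ^ (2 * γ) = (μ⁻¹) ^ 2 := by
    rw [hμi, mul_comm, Real.rpow_mul hK0.le]
    norm_num
  have hKp : 0 < (K : ℝ) ^ (2 * γ) := by positivity
  have hM0 : 0 ≤ M := le_trans (le_min (norm_nonneg _) (by positivity)) hM
  have hmeas := (measurable_and_indepFun_regTD0 (P := P) hX hD hR h_indep hφ hu hδ hθ K).1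
  obtain ⟨hint, hle⟩ := integral_regTD0_le (P := P) hM0 hθ (by omega : 1 ≤ K) hmeas θs
  refine ⟨hint, ?_⟩
  by_cases hcase : ‖θs‖ ≤ M
  · have h1 := hC μ M hμ0 hμ1 hcase hMM' θ₀ θ hθ K (by omega)
    have h2 : μ ^ 2 = 1 / (K : ℝ) ^ (2 * γ) := by
      rw [hK2]
      field_simp
    have h3 : μ⁻¹ * (K : ℝ) ^ (-s) ≤ 1 / (K : ℝ) ^ (2 * γ) := by
      rw [hμi, ← Real.rpow_add hK0, one_div, ← Real.rpow_neg hK0.le]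
      exact Real.rpow_le_rpow_of_exponent_le hK1 (by linarith)
    calc _ ≤ C * (μ ^ 2 + μ⁻¹ * (K : ℝ) ^ (-s)) := h1
      _ ≤ C * (1 / (K : ℝ) ^ (2 * γ) + 1 / (K : ℝ) ^ (2 * γ)) := by
          rw [h2]
          gcongr
      _ = 2 * C / (K : ℝ) ^ (2 * γ) := by ring
      _ ≤ _ := by
          gcongr
          have : 0 ≤ (M' + ‖θs‖) ^ 2 * (‖θs‖ / S) ^ 2 := by positivity
          linarith
  -- Here M < |θ*|, so the minimum is the other term and μ⁻¹ ≤ |θ*|/S. Thus K^{2γ} = μ⁻² is bounded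
  -- and the crude bound (M' + |θ*|)² on the error suffices.
  · push Not at hcase
    have hSpos : 0 < S := hS fun h => by
      rw [h, norm_zero] at hcase
      linarith
    have h1 : μ⁻¹ * S ≤ ‖θs‖ := by
      rcases min_le_iff.1 hM with h | h
      · linarith
      · linarith
    have h2 : μ⁻¹ ≤ ‖θs‖ / S := (le_div_iff₀ hSpos).2 h1
    rw [le_div_iff₀ hKp, hK2]
    calc _ ≤ (M' + ‖θs‖) ^ 2 * (‖θs‖ / S) ^ 2 := by
          refine mul_le_mul (hle.trans ?_) ?_ (by positivity) (by positivity)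
          · gcongr
          · gcongr
      _ ≤ _ := by linarith

end Rate

variable {d n q p : ℕ} {b : Torus d → Vec d} {σ : Torus d → Vec n →L[ℝ] Vec d}
  {r : Torus d → ℝ} {φ : Torus d → Vec q} {Ω : Type*} [MeasurableSpace Ω] {P : Measure Ω}

/-- The assumption on the laws gives a constant for each test function, and only the finitely many
φᵢ 𝓛φⱼ and r φᵢ are needed. They are of class C^p because 𝓛 loses two derivatives and φ has p + 2.
-/
theorem exists_uniform_consistent (hp : 2 ≤ p) {ρ : ℝ} (hb : IsCk p b) (hσ : IsCk p σ)
    (hr : IsCk p r) (hφ : IsCk (p + 2) φ) {m : Measure (Torus d)} [IsProbabilityMeasure P]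
    {Δ : ℕ → ℝ} (hΔ : ∀ k, 0 < Δ k) (hΔ1 : ∀ k, Δ k ≤ 1) {X : ℕ → Ω → Torus d}
    {D : ℕ → Ω → Vec d} {R : ℕ → Ω → ℝ} (hX : ∀ k, Measurable (X k))
    (h_obs : ∀ k, IsRealObs b σ r P (Δ k) (X k) (D k) (R k) ∨
      IsSimObs b σ r P (Δ k) (X k) (D k) (R k))
    (h_law : ∀ f : Torus d → ℝ, IsCk p f →
      ∃ C > 0, ∀ k, |∫ ω, f (X k ω) ∂P - ∫ x, f x ∂m| ≤ C * Δ k) :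
    ∃ C : ℝ, 0 ≤ C ∧ ∀ k, Consistent b σ r φ P (Δ k) (X k) (D k) (R k) C ∧
      (∀ i j, |(∫ ω, φ (X k ω) i * opL ρ b σ (fun y => φ y j) (X k ω) ∂P) -
        ∫ x, φ x i * opL ρ b σ (fun y => φ y j) x ∂m| ≤ C * Δ k) ∧
      ∀ i, |(∫ ω, r (X k ω) * φ (X k ω) i ∂P) - ∫ x, r x * φ x i ∂m| ≤ C * Δ k := by
  have hφ4 : IsCk 4 φ := hφ.of_le (by omega)
  have hφp : IsCk p φ := hφ.of_le (by omega)
  obtain ⟨C1, hC1⟩ := exists_consistent_of_isSimObs (P := P) hb.continuous hσ.continuous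
    hr.continuous hφ4
  obtain ⟨C2, hC2⟩ := exists_consistent_of_isRealObs (P := P) (hb.of_le hp) (hσ.of_le hp)
    (hr.of_le hp) hφ4
  have hL : ∀ j, IsCk p (opL ρ b σ fun y => φ y j) := fun j => by
    rw [funext (opL_eq ρ (b := b) (σ := σ) fun y => φ y j)]
    exact ((isCk_const ρ).mul (hφp.coord j)).sub ((hφ.coord j).gen hb hσ)
  choose C3 hC30 hC3 using fun i j => h_law _ ((hφp.coord i).mul (hL j))
  choose C4 hC40 hC4 using fun i => h_law _ (hr.mul (hφp.coord i))
  have hS3 : ∀ i j, C3 i j ≤ ∑ i, ∑ j, C3 i j := fun i j =>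
    (Finset.single_le_sum (f := fun j => C3 i j) (fun j _ => (hC30 i j).le)
      (Finset.mem_univ j)).trans (Finset.single_le_sum (f := fun i => ∑ j, C3 i j)
        (fun i _ => Finset.sum_nonneg fun j _ => (hC30 i j).le) (Finset.mem_univ i))
  have hS4 : ∀ i, C4 i ≤ ∑ i, C4 i := fun i =>
    Finset.single_le_sum (f := C4) (fun i _ => (hC40 i).le) (Finset.mem_univ i)
  have h30 : 0 ≤ ∑ i, ∑ j, C3 i j :=
    Finset.sum_nonneg fun i _ => Finset.sum_nonneg fun j _ => (hC30 i j).le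
  have h40 : 0 ≤ ∑ i, C4 i := Finset.sum_nonneg fun i _ => (hC40 i).le
  have a1 := le_abs_self C1
  have a2 := le_abs_self C2
  have a3 := abs_nonneg C1
  have a4 := abs_nonneg C2
  refine ⟨|C1| + |C2| + (∑ i, ∑ j, C3 i j) + ∑ i, C4 i, by positivity,
    fun k => ⟨?_, fun i j => ?_, fun i => ?_⟩⟩
  · rcases h_obs k with h | h
    · exact (hC2 _ _ _ _ (hΔ k) (hΔ1 k) h).mono (hΔ k).le (by linarith)
    · exact (hC1 _ _ _ _ (hΔ k) (hΔ1 k) (hX k) h).mono (hΔ k).le (by linarith)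
  · refine (hC3 i j k).trans (mul_le_mul_of_nonneg_right ?_ (hΔ k).le)
    linarith [hS3 i j]
  · refine (hC4 i k).trans (mul_le_mul_of_nonneg_right ?_ (hΔ k).le)
    linarith [hS4 i]

end

end ContTD

end

theorem corollary1 {d n q p : ℕ} (hp : 2 ≤ p) {ρ : ℝ} (hρ : 0 < ρ)
    -- the dynamics, the reward and the features
    (b : ContTD.Torus d → ContTD.Vec d)
    (σ : ContTD.Torus d → ContTD.Vec n →L[ℝ] ContTD.Vec d)
    (r : ContTD.Torus d → ℝ) (φ : ContTD.Torus d → ContTD.Vec q)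
    (hb : ContTD.IsCk p b) (hσ : ContTD.IsCk p σ) (hr : ContTD.IsCk p r)
    (hφ : ContTD.IsCk (p + 2) φ)
    (hφ_indep : LinearIndependent ℝ (fun (i : Fin q) (x : ContTD.Torus d) => φ x i))
    -- the stationary measure, with full support
    (m : Measure (ContTD.Torus d)) [IsProbabilityMeasure m]
    (hm : ContTD.IsStationary b σ m) (hm_supp : m.IsOpenPosMeasure)
    -- the observations
    {Ω : Type*} [MeasurableSpace Ω] (P : Measure Ω) [IsProbabilityMeasure P]
    (Δ : ℕ → ℝ) (hΔ : ∀ k, 0 < Δ k)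
    (X : ℕ → Ω → ContTD.Torus d) (D : ℕ → Ω → ContTD.Vec d) (R : ℕ → Ω → ℝ)
    (hX : ∀ k, Measurable (X k)) (hD : ∀ k, Measurable (D k)) (hR : ∀ k, Measurable (R k))
    (h_indep : iIndepFun (fun k ω => (X k ω, D k ω, R k ω)) P)
    (h_obs : ∀ k, ContTD.IsRealObs b σ r P (Δ k) (X k) (D k) (R k) ∨
      ContTD.IsSimObs b σ r P (Δ k) (X k) (D k) (R k))
    (h_law : ∀ f : ContTD.Torus d → ℝ, ContTD.IsCk p f →
      ∃ C > 0, ∀ k, |∫ ω, f (X k ω) ∂P - ∫ x, f x ∂m| ≤ C * Δ k) :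
    ∃ θs : ContTD.Vec q,
      ContTD.IsLimit ρ b σ r φ m θs ∧
      (∀ θ, ContTD.IsLimit ρ b σ r φ m θ → θ = θs) ∧
      -- standard TD(0)
      ((∀ k : ℕ, Δ k = 1 / ((k : ℝ) + 1) ^ (1 / 3 : ℝ)) →
        ∀ M' : ℝ, ∃ C > 0, ∀ K : ℕ, 2 ≤ K → ∀ μ : ℝ, μ = (K : ℝ) ^ (-(1 / 6) : ℝ) →
          ∀ M : ℝ, min ‖θs‖ (μ⁻¹ * ⨆ x, |r x|) ≤ M → M ≤ M' → ∀ θ₀ : ContTD.Vec q,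
            ∀ θ : ℕ → Ω → ContTD.Vec q,
              (∀ k ω, θ k ω = ContTD.regTD0 φ μ M (ContTD.rate μ) (fun j => X j ω)
                (fun j => ContTD.tdError ρ φ (Δ j) (X j ω) (D j ω) (R j ω)) θ₀ k) →
              Integrable (fun ω => ‖θ K ω - θs‖ ^ 2) P ∧
                ∫ ω, ‖θ K ω - θs‖ ^ 2 ∂P ≤ C / (K : ℝ) ^ (1 / 3 : ℝ)) ∧
      -- stochastic TD(0)
      ((∀ k : ℕ, Δ k ≤ 1 / √((k : ℝ) + 1)) →
        ∀ M' : ℝ, ∃ C > 0, ∀ K : ℕ, 2 ≤ K → ∀ μ : ℝ, μ = (K : ℝ) ^ (-(1 / 4) : ℝ) →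
          ∀ M : ℝ, min ‖θs‖ (μ⁻¹ * ⨆ x, |r x|) ≤ M → M ≤ M' → ∀ θ₀ : ContTD.Vec q,
            ∀ θ : ℕ → Ω → ContTD.Vec q,
              (∀ k ω, θ k ω = ContTD.regTD0 φ μ M (ContTD.rate μ) (fun j => X j ω)
                (fun j => ContTD.stochTdError ρ b φ (Δ j) (X j ω) (D j ω) (R j ω)) θ₀ k) →
              Integrable (fun ω => ‖θ K ω - θs‖ ^ 2) P ∧
                ∫ ω, ‖θ K ω - θs‖ ^ 2 ∂P ≤ C / √(K : ℝ)) := by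
  have hρ0 := hρ.le
  have hφ2 : ContTD.IsCk 2 φ := hφ.of_le (by omega)
  have hφ1 : ContTD.IsCk 1 φ := hφ.of_le (by omega)
  have hφc := hφ.continuous
  have hb0 : ContTD.IsCk 0 b := hb.of_le (by omega)
  have hσ0 : ContTD.IsCk 0 σ := hσ.of_le (by omega)
  have hgc : ∀ j, Continuous (ContTD.gen b σ fun y => φ y j) := fun j =>
    (ContTD.IsCk.gen (p := 0) (hφ2.coord j) hb0 hσ0).continuous
  obtain ⟨l, hl, hA⟩ := hm.exists_coercive hρ hb0 hσ0 hφ2 hφ_indep hm_supp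
  obtain ⟨θs, hθs, huniq⟩ := ContTD.existsUnique_of_coercive hl hA
    (fun i => ∫ x, r x * φ x i ∂m)
  have hS0 : 0 ≤ ⨆ x, |r x| := Real.iSup_nonneg fun x => abs_nonneg _
  -- If r vanishes then 0 solves the system, so θ* = 0 by uniqueness.
  have hS : θs ≠ 0 → 0 < ⨆ x, |r x| := by
    intro hne
    refine lt_of_le_of_ne hS0 fun h0 => hne ?_
    obtain ⟨Br, -, hBr⟩ := ContTD.exists_bound_of_continuous hr.continuous
    have hr0 : ∀ x, r x = 0 := fun x => by
      have h1 : |r x| ≤ ⨆ x, |r x| := le_ciSup (f := fun x => |r x|)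
        ⟨Br, by rintro _ ⟨y, rfl⟩; exact hBr y⟩ x
      rw [← h0] at h1
      exact abs_nonpos_iff.1 h1
    exact (huniq 0 fun i => by simp [hr0]).symm
  refine ⟨θs, hθs, huniq, fun hΔeq M' => ?_, fun hΔle M' => ?_⟩
  · have hk1 : ∀ k : ℕ, (1 : ℝ) ≤ (k : ℝ) + 1 := fun k => by
      linarith [(Nat.cast_nonneg k : (0 : ℝ) ≤ k)]
    have hk0 : ∀ k : ℕ, (0 : ℝ) < (k : ℝ) + 1 := fun k => by positivity
    have hΔ1 : ∀ k, Δ k ≤ 1 := fun k => by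
      rw [hΔeq, div_le_one (by have := hk0 k; positivity)]
      exact Real.one_le_rpow (hk1 k) (by norm_num)
    obtain ⟨C, hC0, hC⟩ := ContTD.exists_uniform_consistent (ρ := ρ) hp hb hσ hr hφ hΔ hΔ1 hX
      h_obs h_law
    obtain ⟨B, hB0, hB⟩ := ContTD.exists_updateBound_tdVec (P := P) hρ0 hr.continuous hφ1 hgc
      (fun i j => ∫ x, φ x i * ContTD.opL ρ b σ (fun y => φ y j) x ∂m)
      (fun i => ∫ x, r x * φ x i ∂m) hC0
    -- The variance scale w = 1/Δ = (k+1)^{1/3} gives w/(k+1) = (k+1)^{-2/3} = Δ², so s = 2/3; γ =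
    -- 1/6 satisfies 3γ ≤ s and yields K^{-1/3}.
    have h := ContTD.exists_integral_regTD0_le_rpow (P := P) (u := fun k => ContTD.tdVec ρ φ (Δ k))
      (δ := fun j ω => ContTD.tdError ρ φ (Δ j) (X j ω) (D j ω) (R j ω)) hX hD hR h_indep hφc
      (fun k => ContTD.measurable_tdVec hφc (Δ k))
      (fun k ω θ => ContTD.tdError_eq ρ φ (hΔ k).ne' _ _ _ _) hl hA hθs (s := 2 / 3) (γ := 1 / 6)
      hB0 (Δ := Δ) (w := fun k => 1 / Δ k) (by norm_num) (by norm_num)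
      (fun k => by
        rw [hΔeq, one_div, ← Real.rpow_neg (hk0 k).le, ← Real.rpow_mul_natCast (hk0 k).le]
        norm_num)
      (fun k => by
        rw [hΔeq, one_div_one_div, ← Real.rpow_sub_one (hk0 k).ne']
        norm_num)
      (fun k => by
        rw [mul_one_div]
        exact hB _ _ _ _ (hΔ k) (hΔ1 k) (hX k) (hD k) (hR k) (hC k).1 (hC k).2.1 (hC k).2.2)
      (by norm_num) (by norm_num) hS0 hS M'
    rw [show (2 : ℝ) * (1 / 6) = 1 / 3 by norm_num] at h
    exact h
  · have hk1 : ∀ k : ℕ, (1 : ℝ) ≤ (k : ℝ) + 1 := fun k => by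
      linarith [(Nat.cast_nonneg k : (0 : ℝ) ≤ k)]
    have hk0 : ∀ k : ℕ, (0 : ℝ) < (k : ℝ) + 1 := fun k => by positivity
    have hΔ1 : ∀ k, Δ k ≤ 1 := fun k => (hΔle k).trans (by
      rw [div_le_one (Real.sqrt_pos.2 (hk0 k))]
      exact Real.one_le_sqrt.2 (hk1 k))
    obtain ⟨C, hC0, hC⟩ := ContTD.exists_uniform_consistent (ρ := ρ) hp hb hσ hr hφ hΔ hΔ1 hX
      h_obs h_law
    obtain ⟨B, hB0, hB⟩ := ContTD.exists_updateBound_stochTdVec (P := P) hρ0 hb.continuous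
      hr.continuous hφ2 hgc
      (fun i j => ∫ x, φ x i * ContTD.opL ρ b σ (fun y => φ y j) x ∂m)
      (fun i => ∫ x, r x * φ x i ∂m) hC0
    -- Bounded variance, w = 1, and Δ² ≤ 1/(k+1) allow s = 1; γ = 1/4 satisfies 3γ ≤ s and yields
    -- K^{-1/2}. Only an upper bound on Δ is needed, since 1/Δ does not enter.
    have h := ContTD.exists_integral_regTD0_le_rpow (P := P)
      (u := fun k => ContTD.stochTdVec ρ b φ (Δ k))
      (δ := fun j ω => ContTD.stochTdError ρ b φ (Δ j) (X j ω) (D j ω) (R j ω)) hX hD hR h_indep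
      hφc (fun k => ContTD.measurable_stochTdVec hb.continuous hφ1 (Δ k))
      (fun k ω θ => ContTD.stochTdError_eq ρ b hφ1 (hΔ k).ne' _ _ _ _) hl hA hθs (s := 1)
      (γ := 1 / 4) hB0 (Δ := Δ) (w := fun _ => 1) (by norm_num) (by norm_num)
      (fun k => by
        rw [Real.rpow_neg_one, ← one_div]
        calc Δ k ^ 2 ≤ (1 / √((k : ℝ) + 1)) ^ 2 := pow_le_pow_left₀ (hΔ k).le (hΔle k) 2
          _ = 1 / ((k : ℝ) + 1) := by rw [div_pow, one_pow, Real.sq_sqrt (hk0 k).le])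
      (fun k => by rw [Real.rpow_neg_one, one_div])
      (fun k => by
        rw [mul_one]
        exact hB _ _ _ _ (hΔ k) (hΔ1 k) (hX k) (hD k) (hR k) (hC k).1 (hC k).2.1 (hC k).2.2)
      (by norm_num) (by norm_num) hS0 hS M'
    simp only [show (2 : ℝ) * (1 / 4) = 1 / 2 by norm_num, ← Real.sqrt_eq_rpow] at h
    exact h
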